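/- For $\alpha\in\{2,3\}$ and $N\ge 1$ let $\mathcal N^{(2)}_\alpha(N)$ be the number of $N$-element subsets $s\subset\{1,\dots,N^\alpha\}$ with $$\sum_{i\in s} i=\frac1{N^{\alpha-1}}\sum_{i=1}^{N^\alpha} i\qquad\text{and}\qquad \sum_{i\in s} i^2=\frac1{N^{\alpha-1}}\sum_{i=1}^{N^\alpha} i^2$$ (bimagic square series of order $N$ for $\alpha=2$, bimagic cube series for $\alpha=3$). For $m\ge1$ and $0<\beta<1$ let $R_1,\dots,R_m$ be independent random vectors, with $R_i=v_i:=(1,i,\tfrac12 i(i-1))$ with probability $\beta$ and $R_i=(0,0,0)$ otherwise. Let $P^*(m,\beta)$ be the probability that $R_1+\dots+R_m$ equals its mean, let $\Sigma=\beta(1-\beta)\sum_{i=1}^m v_iv_i^{T}$ be its covariance matrix, and let $P^*_g(m,\beta)=(2\pi)^{-3/2}(\det\Sigma)^{-1/2}$ be the Gaussian approximation of $P^*(m,\beta)$. With indices in $\{x,y,z\}$ and $n_y,n_z$ the numbers of indices $y,z$ in a list, put $$V_{abc\dots}=\frac{(1/2)^{n_z}}{1+n_y+2n_z},\qquad \Pi=\big((V_{ab})_{a,b}\big)^{-1},$$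 and (summing over repeated indices) $$K_1^{(2)}=-\tfrac18V_{abc}V_{def}\Pi_{ab}\Pi_{cd}\Pi_{ef}-\tfrac1{12}V_{abc}V_{def}\Pi_{ad}\Pi_{be}\Pi_{cf}+\tfrac18V_{abcd}\Pi_{ab}\Pi_{cd}.$$ Then $K_1^{(2)}=-\frac{711}{980}$; for $(m,\beta)=(N^2,1/N)$ and for $(m,\beta)=(N^3,1/N^2)$, as $N\to\infty$, $$P^*(m,\beta)=P^*_g(m,\beta)\left(1+\frac{K_1^{(2)}}{N}+O\!\left(\frac1{N^2}\right)\right);$$ and, as $N\to\infty$, $$\mathcal N^{(2)}_2(N)=\frac{6}{\pi^{3/2}}\sqrt{\frac{30}{e}}\;\frac{(Ne)^N}{N^{15/2}}\left(1+\frac{1787}{2940\,N}+O\!\left(\frac1{N^2}\right)\right),$$ $$\mathcal N^{(2)}_3(N)=\frac{6\sqrt{30}}{\pi^{3/2}}\;\frac{(N^2e)^N}{N^{21/2}}\left(1-\frac{1201}{980\,N}+O\!\left(\frac1{N^2}\right)\right).$$ -/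

import Mathlib

open Asymptotics Filter

/-- The `N`-element subsets `s` of `{1, …, N ^ α}` whose sum and whose sum of squares are the
`N ^ (α - 1)`-th parts of the sum and of the sum of squares of all of `{1, …, N ^ α}`
(the bimagic square series for `α = 2`, the bimagic cube series for `α = 3`). -/
def bimagicSeries (α N : ℕ) : Finset (Finset ℕ) :=
  ((Finset.Icc 1 (N ^ α)).powersetCard N).filter fun s =>
    ∑ i ∈ s, (i : ℚ) = (∑ i ∈ Finset.Icc 1 (N ^ α), (i : ℚ)) / (N : ℚ) ^ (α - 1) ∧
    ∑ i ∈ s, (i : ℚ) ^ 2 = (∑ i ∈ Finset.Icc 1 (N ^ α), (i : ℚ) ^ 2) / (N : ℚ) ^ (α - 1)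

noncomputable section

/-- The vector `(1, i, i (i - 1) / 2)`. -/
def bimagicVec (i : ℕ) : Fin 3 → ℝ := ![1, (i : ℝ), (i : ℝ) * ((i : ℝ) - 1) / 2]

open scoped Classical in
/-- Let `R_1, …, R_m` be independent random vectors, `R_i` being `bimagicVec i` with probability
`β` and `0` otherwise. This is the probability that `R_1 + … + R_m` equals its mean: the set `s`
of the indices `i` at which `R_i` is not `0` has probability `β ^ |s| * (1 - β) ^ (m - |s|)`. -/
def bimagicCentralProb (m : ℕ) (β : ℝ) : ℝ :=
  ∑ s ∈ (Finset.Icc 1 m).powerset.filter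
      (fun s => ∑ i ∈ s, bimagicVec i = β • ∑ i ∈ Finset.Icc 1 m, bimagicVec i),
    β ^ s.card * (1 - β) ^ (m - s.card)

/-- The covariance matrix of `R_1 + … + R_m`. -/
def bimagicCov (m : ℕ) (β : ℝ) : Matrix (Fin 3) (Fin 3) ℝ :=
  Matrix.of fun a b => β * (1 - β) * ∑ i ∈ Finset.Icc 1 m, bimagicVec i a * bimagicVec i b

/-- The density at its centre of the Gaussian distribution with covariance `bimagicCov m β`. -/
def bimagicGaussProb (m : ℕ) (β : ℝ) : ℝ :=
  1 / ((2 * Real.pi) ^ (3 / 2 : ℝ) * √(bimagicCov m β).det)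

/-- The rescaled vertex to leading order in `1 / m`: with `n_y` and `n_z` the numbers of indices
`1` and `2` in the list, it is the limit, as `m → ∞`, of
`(∑ j ∈ {1, …, m}, j ^ n_y * (j (j - 1) / 2) ^ n_z) / m ^ (1 + n_y + 2 * n_z)`. -/
def bimagicVertex (l : List (Fin 3)) : ℝ :=
  (1 / 2) ^ l.count 2 / (1 + l.count 1 + 2 * l.count 2)

/-- The propagator to leading order in `1 / m`: the inverse of the rescaled covariance matrix. -/
def bimagicPropagator : Matrix (Fin 3) (Fin 3) ℝ :=
  (Matrix.of fun a b => bimagicVertex [a, b])⁻¹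

/-- The first-order correction coefficient. -/
def bimagicK₁ : ℝ :=
  let V := bimagicVertex
  let P := bimagicPropagator
  (-1 / 8) * (∑ a, ∑ b, ∑ c, ∑ d, ∑ e, ∑ f, V [a, b, c] * V [d, e, f] * P a b * P c d * P e f)
  - (1 / 12) * (∑ a, ∑ b, ∑ c, ∑ d, ∑ e, ∑ f, V [a, b, c] * V [d, e, f] * P a d * P b e * P c f)
  + (1 / 8) * (∑ a, ∑ b, ∑ c, ∑ d, V [a, b, c, d] * P a b * P c d)

/-- Leading-order approximation to the number of bimagic square series of order `N`. -/
def bimagicSquareMain (N : ℕ) : ℝ :=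
  6 / Real.pi ^ (3 / 2 : ℝ) * √(30 / Real.exp 1) *
    ((N * Real.exp 1) ^ N / (N : ℝ) ^ (15 / 2 : ℝ))

/-- Leading-order approximation to the number of bimagic cube series of order `N`. -/
def bimagicCubeMain (N : ℕ) : ℝ :=
  6 * √30 / Real.pi ^ (3 / 2 : ℝ) *
    (((N : ℝ) ^ 2 * Real.exp 1) ^ N / (N : ℝ) ^ (21 / 2 : ℝ))

end

/-!
The proof is a local limit theorem with one Edgeworth correction, by Fourier inversion on the torus.

Since the mean is a lattice vector (`exists_int_mean`), the central probability is `(2π)⁻³` times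
the integral over `(-π, π]³` of the characteristic function `centredCharFun` of the centred sum
(`bimagicCentralProb_eq_integral`).  Its modulus is at most
`exp (-β (1 - β) ∑ (1 - cos (θ · v_j)))`.

*Away from the zero frequency.*  If `∑ (1 - cos (θ · v_j))` is a small multiple of `m`, then
`θ · v_j` is near `2πℤ` for most `j`.  Second differences of the quadratic phase `j ↦ θ · v_j` show
that `h² θ₂` is near `2πℤ` for all `h ≤ m / 4`; starting from `|θ₂| ≤ π`, induction on `h` shows
that `h² θ₂` is itself small.  First differences then do the same for `θ₁`, and a single value for
`θ₀` (`abs_le_of_nearPeriod`).  So outside of a box of size `1 × m⁻¹ × m⁻²` the characteristic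
function is exponentially small in `N = m β`.

*Near the zero frequency.*  A linear substitution `θ = A y` (`gramMatrix`), which expresses the
phases in the orthonormal discrete Chebyshev polynomials, turns the covariance form into `|y|²`; its
determinant is `(det Σ)^(-1/2)`, so the Gaussian approximation appears exactly.  Taking the real
part of the characteristic function removes all terms of odd order in `N^(-1/2)`, and leaves
`exp (-|y|² / 2) (1 + D(y) / N + O(N⁻²))` with error terms dominated by `exp (-|y|² / 8)`
(`exists_abs_indicator_sub_le`).  As `m → ∞` the discrete Chebyshev polynomials become the Legendre
polynomials on `[0, 1]`; this identifies the polynomial `D` as `edgeworthPoly`, whose Gaussian mean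
`-711 / 980` is computed monomial by monomial (`hasGaussMean_edgeworthPoly`) and agrees with
`bimagicK₁` (`bimagicK₁_eq`).

*Counting.*  All series have the same weight `β ^ N (1 - β) ^ (m - N)`, so their number is the
central probability divided by this weight.  The determinant of the covariance matrix has a closed
form (`det_bimagicCov`), and expanding logarithms gives the additional terms `4 / (3 N)` for squares
and `-1 / (2 N)` for cubes.
-/

/-! ### Fourier inversion -/

open MeasureTheory Complex in
theorem integral_Ioc_exp_int (n : ℤ) :
    ∫ t in Set.Ioc (-Real.pi) Real.pi, cexp (I * (t * n)) = if n = 0 then (2 * Real.pi : ℂ) else 0 := by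
  rw [← intervalIntegral.integral_of_le (by linarith [Real.pi_pos])]
  split_ifs with h
  · subst h
    simp
    ring
  · have hc : (I * n : ℂ) ≠ 0 := by simp [h]
    have := integral_exp_mul_complex (a := -Real.pi) (b := Real.pi) hc
    have e : ∀ t : ℝ, cexp (I * (t * n)) = cexp (I * n * t) := fun t => by congr 1; ring
    simp_rw [e, this]
    have : cexp (I * n * Real.pi) = cexp (I * n * (-Real.pi : ℝ)) := by
      rw [Complex.exp_eq_exp_iff_exists_int]
      exact ⟨n, by push_cast; ring⟩
    rw [this]; simp

/-- The cube `(-π, π]³`, a fundamental domain of the torus of frequencies. -/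
def freqCube : Set (Fin 3 → ℝ) := Set.univ.pi fun _ => Set.Ioc (-Real.pi) Real.pi

open MeasureTheory Complex in
theorem integral_freqCube_exp (n : Fin 3 → ℤ) :
    ∫ θ in freqCube, cexp (I * ∑ a, (θ a : ℂ) * n a) =
      if n = 0 then (2 * Real.pi : ℂ) ^ 3 else 0 := by
  have e : ∀ θ : Fin 3 → ℝ, cexp (I * ∑ a, (θ a : ℂ) * n a) = ∏ a, cexp (I * (θ a * n a)) := by
    intro θ; rw [Finset.mul_sum, Complex.exp_sum]
  simp_rw [e]
  rw [freqCube, volume_pi, Measure.restrict_pi_pi]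
  rw [integral_fintype_prod_eq_prod (𝕜 := ℂ) (fun a (t : ℝ) => cexp (I * (t * n a)))]
  simp_rw [integral_Ioc_exp_int]
  split_ifs with h
  · subst h; simp
  · obtain ⟨a, ha⟩ := Function.ne_iff.mp h
    exact Finset.prod_eq_zero (Finset.mem_univ a) (by simpa using ha)

/-- The phase `θ · v_j` of the `j`-th vector at the frequency `θ`. -/
noncomputable def phase (θ : Fin 3 → ℝ) (j : ℕ) : ℝ := ∑ a, θ a * bimagicVec j a

/-- The characteristic function of the centred sum `∑ (R_j - E R_j)`. -/
noncomputable def centredCharFun (m : ℕ) (β : ℝ) (θ : Fin 3 → ℝ) : ℂ :=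
  ∏ j ∈ Finset.Icc 1 m, ((1 + β * (Complex.exp (Complex.I * phase θ j) - 1)) *
    Complex.exp (-(Complex.I * (β * phase θ j))))

theorem continuous_phase (j : ℕ) : Continuous fun θ => phase θ j := by
  unfold phase; fun_prop

theorem continuous_centredCharFun (m : ℕ) (β : ℝ) : Continuous (centredCharFun m β) := by
  unfold centredCharFun
  have := continuous_phase
  fun_prop

theorem exists_int_bimagicVec (j : ℕ) : ∃ v : Fin 3 → ℤ, ∀ a, bimagicVec j a = v a := by
  refine ⟨![1, j, (j.choose 2 : ℕ)], fun a => ?_⟩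
  fin_cases a
  · simp [bimagicVec]
  · simp [bimagicVec]
  · simp [bimagicVec, Nat.cast_choose_two]

theorem centredCharFun_eq_sum (m : ℕ) (β : ℝ) (θ : Fin 3 → ℝ) :
    centredCharFun m β θ = ∑ s ∈ (Finset.Icc 1 m).powerset,
      ((β ^ s.card * (1 - β) ^ (m - s.card) : ℝ) : ℂ) *
      Complex.exp (Complex.I * ∑ a, (θ a : ℂ) *
        ((∑ i ∈ s, bimagicVec i a - β * ∑ i ∈ Finset.Icc 1 m, bimagicVec i a : ℝ) : ℂ)) := by
  unfold centredCharFun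
  rw [Finset.prod_mul_distrib, ← Complex.exp_sum]
  have : ∀ j, (1 + β * (Complex.exp (Complex.I * phase θ j) - 1) : ℂ)
      = β * Complex.exp (Complex.I * phase θ j) + (1 - β) := fun j => by ring
  simp_rw [this]
  rw [Finset.prod_add, Finset.sum_mul]
  refine Finset.sum_congr rfl fun s hs => ?_
  rw [Finset.mem_powerset] at hs
  rw [Finset.prod_mul_distrib, ← Complex.exp_sum, Finset.prod_const, Finset.prod_const,
    Finset.card_sdiff_of_subset hs, Nat.card_Icc, Nat.add_sub_cancel]
  have key : Complex.I * ∑ a, (θ a : ℂ) *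
        ((∑ i ∈ s, bimagicVec i a - β * ∑ i ∈ Finset.Icc 1 m, bimagicVec i a : ℝ) : ℂ)
      = ∑ i ∈ s, Complex.I * phase θ i + ∑ i ∈ Finset.Icc 1 m, -(Complex.I * (β * phase θ i)) := by
    have h1 : ∀ t : Finset ℕ, ∑ i ∈ t, phase θ i = ∑ a, θ a * ∑ i ∈ t, bimagicVec i a := by
      intro t
      simp_rw [phase, Finset.mul_sum]
      exact Finset.sum_comm
    rw [Finset.sum_neg_distrib, ← Finset.mul_sum, ← Finset.mul_sum, ← Finset.mul_sum,
      ← Complex.ofReal_sum, ← Complex.ofReal_sum, h1, h1]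
    push_cast
    simp only [Fin.sum_univ_three]
    ring
  rw [key, Complex.exp_add]
  push_cast
  ring

open MeasureTheory in
/-- Fourier inversion on the torus, for a mean in the lattice `ℤ³`. -/
theorem bimagicCentralProb_eq_integral (m : ℕ) (β : ℝ) (k : Fin 3 → ℤ)
    (hk : ∀ a, β * ∑ i ∈ Finset.Icc 1 m, bimagicVec i a = k a) :
    (2 * Real.pi) ^ 3 * bimagicCentralProb m β = ∫ θ in freqCube, (centredCharFun m β θ).re := by
  have hint : IntegrableOn (centredCharFun m β) freqCube := by
    refine ((continuous_centredCharFun m β).continuousOn.integrableOn_compact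
      (isCompact_univ_pi fun _ => isCompact_Icc (a := -Real.pi) (b := Real.pi))).mono_set ?_
    exact Set.pi_mono fun _ _ => Set.Ioc_subset_Icc_self
  have hre := integral_re hint
  simp only [RCLike.re_eq_complex_re] at hre
  rw [hre]
  have main : ∫ θ in freqCube, centredCharFun m β θ
      = (((2 * Real.pi) ^ 3 * bimagicCentralProb m β : ℝ) : ℂ) := by
    choose v hv using exists_int_bimagicVec
    simp_rw [centredCharFun_eq_sum]
    have e : ∀ (s : Finset ℕ) (a : Fin 3),
        ((∑ i ∈ s, bimagicVec i a - β * ∑ i ∈ Finset.Icc 1 m, bimagicVec i a : ℝ) : ℂ)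
        = (((∑ i ∈ s, v i a - k a : ℤ)) : ℂ) := by
      intro s a; rw [hk]; simp_rw [hv]; push_cast; rfl
    simp_rw [e]
    rw [integral_finsetSum]
    · simp_rw [integral_const_mul]
      have := fun s : Finset ℕ => integral_freqCube_exp (fun a => ∑ i ∈ s, v i a - k a)
      simp_rw [this]
      rw [bimagicCentralProb, Finset.sum_filter]
      push_cast
      rw [Finset.mul_sum]
      refine Finset.sum_congr rfl fun s _ => ?_
      have hiff : (fun a => ∑ i ∈ s, v i a - k a) = 0 ↔
          ∑ i ∈ s, bimagicVec i = β • ∑ i ∈ Finset.Icc 1 m, bimagicVec i := by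
        simp only [funext_iff, Finset.sum_apply, Pi.smul_apply, smul_eq_mul, hk, Pi.zero_apply,
          sub_eq_zero]
        refine forall_congr' fun a => ?_
        simp_rw [hv]
        norm_cast
      by_cases h : ∑ i ∈ s, bimagicVec i = β • ∑ i ∈ Finset.Icc 1 m, bimagicVec i
      · rw [if_pos (hiff.2 h), if_pos h]; push_cast; ring
      · rw [if_neg (fun h' => h (hiff.1 h')), if_neg h]; simp
    · intro s _
      refine (Continuous.integrableOn_Icc (a := fun _ => -Real.pi) (b := fun _ => Real.pi)
        (by fun_prop)).mono_set ?_
      intro θ hθ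
      rw [freqCube, Set.mem_univ_pi] at hθ
      exact ⟨fun a => (hθ a).1.le, fun a => (hθ a).2⟩
  rw [main, Complex.ofReal_re]

/-! ### The characteristic function away from the zero frequency -/

/-- `x` lies within `η` of a multiple of `2π`. -/
def NearPeriod (η x : ℝ) : Prop := ∃ k : ℤ, |x - 2 * Real.pi * k| ≤ η

theorem NearPeriod.add {η η' x y : ℝ} (hx : NearPeriod η x) (hy : NearPeriod η' y) :
    NearPeriod (η + η') (x + y) := by
  obtain ⟨k, hk⟩ := hx
  obtain ⟨l, hl⟩ := hy
  refine ⟨k + l, ?_⟩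
  push_cast
  calc |x + y - 2 * Real.pi * (k + l)| = |(x - 2 * Real.pi * k) + (y - 2 * Real.pi * l)| := by
        congr 1; ring
    _ ≤ _ := (abs_add_le _ _).trans (add_le_add hk hl)

theorem NearPeriod.sub {η η' x y : ℝ} (hx : NearPeriod η x) (hy : NearPeriod η' y) :
    NearPeriod (η + η') (x - y) := by
  obtain ⟨l, hl⟩ := hy
  rw [sub_eq_add_neg]
  refine hx.add ⟨-l, ?_⟩
  push_cast
  rw [← abs_neg]
  convert hl using 2
  ring

theorem nearPeriod_of_abs_le {η x : ℝ} (h : |x| ≤ η) : NearPeriod η x := ⟨0, by simpa using h⟩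

theorem NearPeriod.abs_le {η x : ℝ} (hx : NearPeriod η x) (h : |x| + η < 2 * Real.pi) :
    |x| ≤ η := by
  obtain ⟨k, hk⟩ := hx
  have hk0 : k = 0 := by
    by_contra hne
    have h1 : (1 : ℝ) ≤ |(k : ℝ)| := by exact_mod_cast Int.one_le_abs hne
    have h2 : |2 * Real.pi * k| ≤ |x| + η := by
      calc |2 * Real.pi * k| = |x - (x - 2 * Real.pi * k)| := by congr 1; ring
        _ ≤ |x| + |x - 2 * Real.pi * k| := abs_sub _ _
        _ ≤ _ := by linarith
    rw [abs_mul, abs_of_pos (by positivity : 0 < 2 * Real.pi)] at h2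
    nlinarith [Real.pi_pos]
  simpa [hk0] using hk

theorem le_one_sub_cos_of_not_nearPeriod {η x : ℝ} (hη : 0 ≤ η) (hx : ¬ NearPeriod η x) :
    2 / Real.pi ^ 2 * η ^ 2 ≤ 1 - Real.cos x := by
  set k := round (x / (2 * Real.pi)) with hk
  have hp := Real.pi_pos
  have h1 : |x - 2 * Real.pi * k| ≤ Real.pi := by
    have := abs_sub_round (x / (2 * Real.pi))
    have e : x - 2 * Real.pi * k = 2 * Real.pi * (x / (2 * Real.pi) - k) := by field_simp
    rw [e, abs_mul, abs_of_pos (by positivity : 0 < 2 * Real.pi)]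
    nlinarith
  have h2 : η < |x - 2 * Real.pi * k| := by
    by_contra h; exact hx ⟨k, not_lt.1 h⟩
  have h3 := Real.cos_le_one_sub_mul_cos_sq h1
  have h4 : Real.cos (x - 2 * Real.pi * k) = Real.cos x := by
    rw [mul_comm]; exact Real.cos_sub_int_mul_two_pi x k
  have h5 : η ^ 2 ≤ (x - 2 * Real.pi * k) ^ 2 := by rw [← sq_abs (x - _)]; gcongr
  have h6 : 2 / Real.pi ^ 2 * η ^ 2 ≤ 2 / Real.pi ^ 2 * (x - 2 * Real.pi * k) ^ 2 := by gcongr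
  rw [h4] at h3
  linarith

theorem phase_eq (θ : Fin 3 → ℝ) (j : ℕ) :
    phase θ j = θ 0 + θ 1 * j + θ 2 * ((j : ℝ) * (j - 1) / 2) := by
  simp [phase, bimagicVec, Fin.sum_univ_three]

/-- If at most `m / 16` indices are exceptional, then for each small `h` some `j, j + h, j + 2h` are
all unexceptional. -/
theorem exists_progression {m : ℕ} {G : ℕ → Prop} {B : Finset ℕ}
    (hB : 16 * B.card ≤ m) (hG : ∀ j, 1 ≤ j → j ≤ m → j ∉ B → G j) (hm : 1 ≤ m) {h : ℕ}
    (hh : 4 * h ≤ m) : ∃ j, 1 ≤ j ∧ j + 2 * h ≤ m ∧ G j ∧ G (j + h) ∧ G (j + 2 * h) := by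
  classical
  by_contra! hcon
  have hsub : Finset.Icc 1 (m - 2 * h) ⊆
      B ∪ B.image (fun i => i - h) ∪ B.image (fun i => i - 2 * h) := by
    intro j hj
    rw [Finset.mem_Icc] at hj
    by_contra hn
    simp only [Finset.mem_union, Finset.mem_image, not_or, not_exists, not_and] at hn
    obtain ⟨⟨h1, h2⟩, h3⟩ := hn
    refine hcon j hj.1 (by omega) (hG _ hj.1 (by omega) h1)
      (hG _ (by omega) (by omega) fun hb => h2 _ hb (by omega))
      (hG _ (by omega) (by omega) fun hb => h3 _ hb (by omega))
  have h1 := Finset.card_le_card hsub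
  rw [Nat.card_Icc] at h1
  have h2 := Finset.card_union_le (B ∪ B.image (fun i => i - h)) (B.image (fun i => i - 2 * h))
  have h3 := Finset.card_union_le B (B.image (fun i => i - h))
  have h4 : (B.image (fun i => i - h)).card ≤ B.card := Finset.card_image_le
  have h5 : (B.image (fun i => i - 2 * h)).card ≤ B.card := Finset.card_image_le
  omega

/-- Weyl-type rigidity: a real quadratic phase that is near a period at most integers of `[1, m]`
has, up to periods, tiny coefficients. -/
theorem abs_le_of_nearPeriod {m : ℕ} (hm : 8 ≤ m) {η : ℝ} (hη0 : 0 < η) (hη : η ≤ 1 / 5000)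
    {θ : Fin 3 → ℝ} (hθ : ∀ a, |θ a| ≤ Real.pi) {B : Finset ℕ} (hB : 16 * B.card ≤ m)
    (hG : ∀ j, 1 ≤ j → j ≤ m → j ∉ B → NearPeriod η (phase θ j)) :
    |θ 0| ≤ 5000 * η ∧ |θ 1| * m ≤ 5000 * η ∧ |θ 2| * (m : ℝ) ^ 2 ≤ 5000 * η := by
  have hp := Real.pi_gt_three
  have hmR : (8 : ℝ) ≤ m := by exact_mod_cast hm
  have ex : ∀ h : ℕ, 4 * h ≤ m → _ := fun h hh => exists_progression hB hG (by omega) hh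
  -- second differences give the quadratic coefficient
  have n2 : ∀ h : ℕ, 4 * h ≤ m → NearPeriod (4 * η) ((h : ℝ) ^ 2 * θ 2) := by
    intro h hh
    obtain ⟨j, -, -, a, b, c⟩ := ex h hh
    have := (c.sub b).sub (b.sub a)
    rw [phase_eq, phase_eq, phase_eq] at this
    push_cast at this
    convert this using 1
    · ring
    · ring
  have b2 : ∀ h : ℕ, 4 * h ≤ m → |(h : ℝ) ^ 2 * θ 2| ≤ 4 * η := by
    intro h
    induction h with
    | zero => intro _; simp; positivity
    | succ h ih =>
      intro hh
      refine (n2 _ hh).abs_le ?_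
      rcases Nat.eq_zero_or_pos h with rfl | hpos
      · have := hθ 2
        simp only [zero_add, Nat.cast_one, one_pow, one_mul]
        linarith
      · have h1 := ih (by omega)
        have h2 : (1 : ℝ) ≤ h := by exact_mod_cast hpos
        rw [abs_mul, abs_of_nonneg (by positivity)] at h1 ⊢
        have h3 : ((h + 1 : ℕ) : ℝ) ^ 2 ≤ 4 * (h : ℝ) ^ 2 := by push_cast; nlinarith
        have := mul_le_mul_of_nonneg_right h3 (abs_nonneg (θ 2))
        nlinarith
  have t2 : |θ 2| * (m : ℝ) ^ 2 ≤ 256 * η := by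
    have h1 := b2 (m / 4) (by omega)
    have h2 : (m : ℝ) ≤ 8 * ((m / 4 : ℕ) : ℝ) := by
      have : m ≤ 8 * (m / 4) := by omega
      exact_mod_cast this
    rw [abs_mul, abs_of_nonneg (by positivity)] at h1
    have h3 : (m : ℝ) ^ 2 ≤ 64 * ((m / 4 : ℕ) : ℝ) ^ 2 := by nlinarith
    have := mul_le_mul_of_nonneg_right h3 (abs_nonneg (θ 2))
    nlinarith
  -- first differences give the linear coefficient
  have n1 : ∀ h : ℕ, 4 * h ≤ m → NearPeriod (258 * η) ((h : ℝ) * θ 1) := by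
    intro h hh
    obtain ⟨j, hj1, hjm, a, b, -⟩ := ex h hh
    have hs := b.sub a
    rw [phase_eq, phase_eq] at hs
    have hjR : (1 : ℝ) ≤ j := by exact_mod_cast hj1
    have hjm' : (j : ℝ) + 2 * h ≤ m := by exact_mod_cast hjm
    have hh0 : (0 : ℝ) ≤ h := by positivity
    have small : |θ 2 * ((h : ℝ) * (2 * j + h - 1) / 2)| ≤ 256 * η := by
      rw [abs_mul, abs_of_nonneg (by nlinarith : (0 : ℝ) ≤ (h : ℝ) * (2 * j + h - 1) / 2)]
      refine le_trans ?_ t2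
      gcongr
      nlinarith
    have := hs.sub (nearPeriod_of_abs_le small)
    push_cast at this
    convert this using 1
    · ring
    · ring
  have b1 : ∀ h : ℕ, 4 * h ≤ m → |(h : ℝ) * θ 1| ≤ 258 * η := by
    intro h
    induction h with
    | zero => intro _; simp; positivity
    | succ h ih =>
      intro hh
      refine (n1 _ hh).abs_le ?_
      rcases Nat.eq_zero_or_pos h with rfl | hpos
      · have := hθ 1
        simp only [zero_add, Nat.cast_one, one_mul]
        linarith
      · have h1 := ih (by omega)
        have h2 : (1 : ℝ) ≤ h := by exact_mod_cast hpos
        rw [abs_mul, abs_of_nonneg (by positivity)] at h1 ⊢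
        have h3 : ((h + 1 : ℕ) : ℝ) ≤ 2 * (h : ℝ) := by push_cast; linarith
        have := mul_le_mul_of_nonneg_right h3 (abs_nonneg (θ 1))
        nlinarith
  have t1 : |θ 1| * m ≤ 2064 * η := by
    have h1 := b1 (m / 4) (by omega)
    have h2 : (m : ℝ) ≤ 8 * ((m / 4 : ℕ) : ℝ) := by
      have : m ≤ 8 * (m / 4) := by omega
      exact_mod_cast this
    rw [abs_mul, abs_of_nonneg (by positivity)] at h1
    have := mul_le_mul_of_nonneg_right h2 (abs_nonneg (θ 1))
    nlinarith
  have t0 : |θ 0| ≤ 5000 * η := by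
    obtain ⟨j, hj1, hjm, a, -, -⟩ := ex 0 (by omega)
    rw [phase_eq] at a
    have hjR : (1 : ℝ) ≤ j := by exact_mod_cast hj1
    have hjm' : (j : ℝ) ≤ m := by exact_mod_cast hjm
    have s1 : |θ 1 * j| ≤ 2064 * η := by
      rw [abs_mul, abs_of_nonneg (by positivity : (0 : ℝ) ≤ j)]
      exact le_trans (by gcongr) t1
    have s2 : |θ 2 * ((j : ℝ) * (j - 1) / 2)| ≤ 256 * η := by
      rw [abs_mul, abs_of_nonneg (by nlinarith : (0 : ℝ) ≤ (j : ℝ) * (j - 1) / 2)]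
      refine le_trans ?_ t2
      gcongr
      nlinarith
    have := (a.sub (nearPeriod_of_abs_le s1)).sub (nearPeriod_of_abs_le s2)
    have e : θ 0 + θ 1 * j + θ 2 * ((j : ℝ) * (j - 1) / 2) - θ 1 * j
        - θ 2 * ((j : ℝ) * (j - 1) / 2) = θ 0 := by ring
    rw [e] at this
    have h0 := hθ 0
    linarith [this.abs_le (by linarith)]
  exact ⟨t0, t1.trans (by linarith), t2.trans (by linarith)⟩

/-- The neighbourhood of the zero frequency in which all phases `θ · v_1, …, θ · v_m` are small. -/
def centralRegion (m : ℕ) (δ : ℝ) : Set (Fin 3 → ℝ) :=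
  {θ | |θ 0| ≤ δ ∧ |θ 1| * m ≤ δ ∧ |θ 2| * (m : ℝ) ^ 2 ≤ δ}

theorem exists_le_sum_one_sub_cos {δ : ℝ} (hδ : 0 < δ) (hδ1 : δ ≤ 1) :
    ∃ ε > 0, ∀ m : ℕ, 8 ≤ m → ∀ θ ∈ freqCube, θ ∉ centralRegion m δ →
      ε * m ≤ ∑ j ∈ Finset.Icc 1 m, (1 - Real.cos (phase θ j)) := by
  classical
  set η := δ / 5000 with hη
  have hη0 : 0 < η := by positivity
  refine ⟨2 / Real.pi ^ 2 * η ^ 2 / 16, by positivity, fun m hm θ hθ hout => ?_⟩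
  by_contra! hlt
  apply hout
  set B := (Finset.Icc 1 m).filter fun j => ¬ NearPeriod η (phase θ j) with hB
  have h1 : B.card * (2 / Real.pi ^ 2 * η ^ 2) ≤
      ∑ j ∈ Finset.Icc 1 m, (1 - Real.cos (phase θ j)) := by
    rw [← nsmul_eq_mul]
    refine (Finset.card_nsmul_le_sum B (fun j => 1 - Real.cos (phase θ j)) _ fun j hj =>
      le_one_sub_cos_of_not_nearPeriod hη0.le (Finset.mem_filter.1 hj).2).trans ?_
    exact Finset.sum_le_sum_of_subset_of_nonneg (Finset.filter_subset _ _)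
      fun j _ _ => by linarith [Real.cos_le_one (phase θ j)]
  have h2 : 16 * B.card ≤ m := by
    have hc : 0 < 2 / Real.pi ^ 2 * η ^ 2 := by positivity
    have : (16 * B.card : ℝ) < m := by
      by_contra! h
      have := mul_le_mul_of_nonneg_right h hc.le
      linarith
    exact_mod_cast this.le
  have h3 := abs_le_of_nearPeriod hm hη0 (by rw [hη]; linarith) (θ := θ) (B := B)
    (fun a => by
      have := (Set.mem_univ_pi.1 hθ) a
      exact abs_le.2 ⟨this.1.le, this.2⟩) h2
    (fun j hj1 hjm hj => by
      by_contra hn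
      exact hj (Finset.mem_filter.2 ⟨Finset.mem_Icc.2 ⟨hj1, hjm⟩, hn⟩))
  have e : 5000 * η = δ := by rw [hη]; ring
  rwa [e] at h3

theorem norm_one_add_mul_exp_sub_one_le (β u : ℝ) :
    ‖(1 + β * (Complex.exp (Complex.I * u) - 1) : ℂ)‖ ≤
      Real.exp (-(β * (1 - β) * (1 - Real.cos u))) := by
  have h1 : ‖(1 + β * (Complex.exp (Complex.I * u) - 1) : ℂ)‖ ^ 2
      = 1 - 2 * (β * (1 - β) * (1 - Real.cos u)) := by
    rw [mul_comm Complex.I, Complex.exp_mul_I, ← Complex.ofReal_cos, ← Complex.ofReal_sin,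
      Complex.sq_norm, Complex.normSq_apply]
    simp only [Complex.add_re, Complex.add_im, Complex.one_re, Complex.one_im, Complex.mul_re,
      Complex.mul_im, Complex.sub_re, Complex.sub_im, Complex.ofReal_re, Complex.ofReal_im,
      Complex.I_re, Complex.I_im]
    linear_combination β ^ 2 * Real.sin_sq_add_cos_sq u
  refine le_of_sq_le_sq ?_ (Real.exp_pos _).le
  rw [h1, ← Real.exp_nat_mul]
  have := Real.add_one_le_exp (-(2 * (β * (1 - β) * (1 - Real.cos u))))
  refine le_trans (by linarith) (this.trans (le_of_eq ?_))
  congr 1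
  push_cast
  ring

theorem norm_centredCharFun_le (m : ℕ) (β : ℝ) (θ : Fin 3 → ℝ) :
    ‖centredCharFun m β θ‖ ≤
      Real.exp (-(β * (1 - β) * ∑ j ∈ Finset.Icc 1 m, (1 - Real.cos (phase θ j)))) := by
  rw [centredCharFun, norm_prod, Finset.mul_sum, ← Finset.sum_neg_distrib, Real.exp_sum]
  refine Finset.prod_le_prod (fun _ _ => norm_nonneg _) fun j _ => ?_
  rw [norm_mul]
  have : ‖Complex.exp (-(Complex.I * (β * phase θ j)))‖ = 1 := by
    rw [Complex.norm_exp]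
    simp
  rw [this, mul_one]
  exact norm_one_add_mul_exp_sub_one_le _ _

/-! ### The covariance matrix and discrete Chebyshev polynomials -/

theorem sum_Icc_id (m : ℕ) : ∑ j ∈ Finset.Icc 1 m, (j : ℝ) = m * (m + 1) / 2 := by
  induction m with
  | zero => simp
  | succ n ih => rw [Finset.sum_Icc_succ_top (by omega), ih]; push_cast; ring

theorem sum_Icc_sq (m : ℕ) :
    ∑ j ∈ Finset.Icc 1 m, (j : ℝ) ^ 2 = m * (m + 1) * (2 * m + 1) / 6 := by
  induction m with
  | zero => simp
  | succ n ih => rw [Finset.sum_Icc_succ_top (by omega), ih]; push_cast; ring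

theorem sum_Icc_cube (m : ℕ) :
    ∑ j ∈ Finset.Icc 1 m, (j : ℝ) ^ 3 = (m : ℝ) ^ 2 * (m + 1) ^ 2 / 4 := by
  induction m with
  | zero => simp
  | succ n ih => rw [Finset.sum_Icc_succ_top (by omega), ih]; push_cast; ring

theorem sum_Icc_pow_four (m : ℕ) : ∑ j ∈ Finset.Icc 1 m, (j : ℝ) ^ 4
    = m * (m + 1) * (2 * m + 1) * (3 * (m : ℝ) ^ 2 + 3 * m - 1) / 30 := by
  induction m with
  | zero => simp
  | succ n ih => rw [Finset.sum_Icc_succ_top (by omega), ih]; push_cast; ring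

theorem sum_Icc_quartic (m : ℕ) (c₀ c₁ c₂ c₃ c₄ : ℝ) :
    ∑ j ∈ Finset.Icc 1 m, (c₀ + c₁ * (j : ℝ) + c₂ * (j : ℝ) ^ 2 + c₃ * (j : ℝ) ^ 3 +
      c₄ * (j : ℝ) ^ 4) = c₀ * m + c₁ * (m * (m + 1) / 2) + c₂ * (m * (m + 1) * (2 * m + 1) / 6)
      + c₃ * ((m : ℝ) ^ 2 * (m + 1) ^ 2 / 4)
      + c₄ * (m * (m + 1) * (2 * m + 1) * (3 * (m : ℝ) ^ 2 + 3 * m - 1) / 30) := by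
  simp only [Finset.sum_add_distrib, ← Finset.mul_sum, sum_Icc_id, sum_Icc_sq, sum_Icc_cube,
    sum_Icc_pow_four]
  simp [mul_comm]

theorem det_bimagicCov (m : ℕ) (β : ℝ) : (bimagicCov m β).det =
    (β * (1 - β)) ^ 3 * ((m : ℝ) ^ 3 * ((m : ℝ) ^ 2 - 1) ^ 2 * ((m : ℝ) ^ 2 - 4) / 8640) := by
  have h00 := sum_Icc_quartic m 1 0 0 0 0
  have h01 := sum_Icc_quartic m 0 1 0 0 0
  have h02 := sum_Icc_quartic m 0 (-1 / 2) (1 / 2) 0 0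
  have h11 := sum_Icc_quartic m 0 0 1 0 0
  have h12 := sum_Icc_quartic m 0 0 (-1 / 2) (1 / 2) 0
  have h22 := sum_Icc_quartic m 0 0 (1 / 4) (-1 / 2) (1 / 4)
  have e00 : ∑ i ∈ Finset.Icc 1 m, bimagicVec i 0 * bimagicVec i 0 = _ :=
    (Finset.sum_congr rfl fun j _ => by simp [bimagicVec]).trans h00
  have e01 : ∑ i ∈ Finset.Icc 1 m, bimagicVec i 0 * bimagicVec i 1 = _ :=
    (Finset.sum_congr rfl fun j _ => by simp [bimagicVec]).trans h01
  have e02 : ∑ i ∈ Finset.Icc 1 m, bimagicVec i 0 * bimagicVec i 2 = _ :=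
    (Finset.sum_congr rfl fun j _ => by simp [bimagicVec]; ring).trans h02
  have e11 : ∑ i ∈ Finset.Icc 1 m, bimagicVec i 1 * bimagicVec i 1 = _ :=
    (Finset.sum_congr rfl fun j _ => by simp [bimagicVec]; ring).trans h11
  have e12 : ∑ i ∈ Finset.Icc 1 m, bimagicVec i 1 * bimagicVec i 2 = _ :=
    (Finset.sum_congr rfl fun j _ => by simp [bimagicVec]; ring).trans h12
  have e22 : ∑ i ∈ Finset.Icc 1 m, bimagicVec i 2 * bimagicVec i 2 = _ :=
    (Finset.sum_congr rfl fun j _ => by simp [bimagicVec]; ring).trans h22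
  have hs : ∀ a b, ∑ i ∈ Finset.Icc 1 m, bimagicVec i a * bimagicVec i b =
      ∑ i ∈ Finset.Icc 1 m, bimagicVec i b * bimagicVec i a :=
    fun a b => Finset.sum_congr rfl fun j _ => mul_comm _ _
  rw [Matrix.det_fin_three]
  simp only [bimagicCov, Matrix.of_apply]
  rw [hs 1 0, hs 2 0, hs 2 1, e00, e01, e02, e11, e12, e22]
  ring

/-- The norming constant of the linear discrete Chebyshev (Gram) polynomial on `{1, …, m}`. -/
noncomputable def gramCoeff₁ (m : ℕ) : ℝ := √3 / √((m : ℝ) ^ 2 - 1)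

/-- The norming constant of the quadratic discrete Chebyshev (Gram) polynomial on `{1, …, m}`. -/
noncomputable def gramCoeff₂ (m : ℕ) : ℝ := √5 / √(((m : ℝ) ^ 2 - 1) * ((m : ℝ) ^ 2 - 4))

/-- The quadratic polynomial in `j` with coordinates `y` in the basis of Gram polynomials, the
orthonormal polynomials for the uniform probability on `{1, …, m}`. -/
noncomputable def gramPoly (m : ℕ) (y : Fin 3 → ℝ) (j : ℕ) : ℝ :=
  y 0 + y 1 * (gramCoeff₁ m * (2 * j - m - 1)) +
    y 2 * (gramCoeff₂ m * (6 * (j : ℝ) ^ 2 - 6 * (m + 1) * j + (m + 1) * (m + 2)))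

theorem gramCoeff₁_sq {m : ℕ} (hm : 3 ≤ m) : gramCoeff₁ m ^ 2 * ((m : ℝ) ^ 2 - 1) = 3 := by
  have : (3 : ℝ) ≤ m := by exact_mod_cast hm
  have h : 0 < (m : ℝ) ^ 2 - 1 := by nlinarith
  rw [gramCoeff₁, div_pow, Real.sq_sqrt (by norm_num), Real.sq_sqrt h.le]
  field_simp

theorem gramCoeff₂_sq {m : ℕ} (hm : 3 ≤ m) :
    gramCoeff₂ m ^ 2 * (((m : ℝ) ^ 2 - 1) * ((m : ℝ) ^ 2 - 4)) = 5 := by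
  have : (3 : ℝ) ≤ m := by exact_mod_cast hm
  have h : 0 < ((m : ℝ) ^ 2 - 1) * ((m : ℝ) ^ 2 - 4) := mul_pos (by nlinarith) (by nlinarith)
  rw [gramCoeff₂, div_pow, Real.sq_sqrt (by norm_num), Real.sq_sqrt h.le]
  exact div_mul_cancel₀ _ h.ne'

theorem gramCoeff₁_pos {m : ℕ} (hm : 3 ≤ m) : 0 < gramCoeff₁ m := by
  have : (3 : ℝ) ≤ m := by exact_mod_cast hm
  have h : 0 < (m : ℝ) ^ 2 - 1 := by nlinarith
  unfold gramCoeff₁; positivity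

theorem gramCoeff₂_pos {m : ℕ} (hm : 3 ≤ m) : 0 < gramCoeff₂ m := by
  have : (3 : ℝ) ≤ m := by exact_mod_cast hm
  have h : 0 < ((m : ℝ) ^ 2 - 1) * ((m : ℝ) ^ 2 - 4) := mul_pos (by nlinarith) (by nlinarith)
  unfold gramCoeff₂; positivity

theorem sum_gramPoly_sq {m : ℕ} (hm : 3 ≤ m) (y : Fin 3 → ℝ) :
    ∑ j ∈ Finset.Icc 1 m, gramPoly m y j ^ 2 = m * ∑ a, y a ^ 2 := by
  have h1 := gramCoeff₁_sq hm
  have h2 := gramCoeff₂_sq hm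
  simp only [gramPoly, Fin.sum_univ_three]
  set a := gramCoeff₁ m
  set b := gramCoeff₂ m
  set p := y 0 - y 1 * a * (m + 1) + y 2 * b * ((m + 1) * (m + 2)) with hp
  set q := 2 * y 1 * a - 6 * y 2 * b * (m + 1) with hq
  set r := 6 * y 2 * b with hr
  have := sum_Icc_quartic m (p ^ 2) (2 * p * q) (q ^ 2 + 2 * p * r) (2 * q * r) (r ^ 2)
  refine (Finset.sum_congr rfl fun j _ => ?_).trans (this.trans ?_)
  · rw [hp, hq, hr]; ring
  · rw [hp, hq, hr]
    linear_combination (m / 3 * y 1 ^ 2) * h1 + (m / 5 * y 2 ^ 2) * h2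

/-- The standard deviation `√(m β (1 - β))` of the number of selected indices. -/
noncomputable def countDev (m : ℕ) (β : ℝ) : ℝ := √(m * (β * (1 - β)))

/-- The linear substitution `θ = A y` that turns the covariance form into `∑ y_a²`. -/
noncomputable def gramMatrix (m : ℕ) (β : ℝ) : Matrix (Fin 3) (Fin 3) ℝ :=
  (countDev m β)⁻¹ • !![1, -(gramCoeff₁ m * (m + 1)), gramCoeff₂ m * ((m + 1) * (m + 2));
    0, 2 * gramCoeff₁ m, -(6 * m * gramCoeff₂ m); 0, 0, 12 * gramCoeff₂ m]

theorem phase_gramMatrix (m : ℕ) (β : ℝ) (y : Fin 3 → ℝ) (j : ℕ) :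
    phase ((gramMatrix m β).mulVec y) j = gramPoly m y j / countDev m β := by
  rw [phase_eq]
  simp [gramMatrix, gramPoly, Matrix.mulVec, dotProduct, Fin.sum_univ_three]
  ring

theorem det_gramMatrix (m : ℕ) (β : ℝ) :
    (gramMatrix m β).det = 24 * gramCoeff₁ m * gramCoeff₂ m / countDev m β ^ 3 := by
  rw [gramMatrix, Matrix.det_smul, Matrix.det_fin_three]
  simp
  ring

theorem countDev_pos {m : ℕ} (hm : 3 ≤ m) {β : ℝ} (h0 : 0 < β) (h1 : β < 1) :
    0 < countDev m β := by
  have : (3 : ℝ) ≤ m := by exact_mod_cast hm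
  have : 0 < m * (β * (1 - β)) := by
    have := sub_pos.2 h1
    positivity
  exact Real.sqrt_pos.2 this

theorem det_gramMatrix_pos {m : ℕ} (hm : 3 ≤ m) {β : ℝ} (h0 : 0 < β) (h1 : β < 1) :
    0 < (gramMatrix m β).det := by
  rw [det_gramMatrix]
  have := countDev_pos hm h0 h1
  have := gramCoeff₁_pos hm
  have := gramCoeff₂_pos hm
  positivity

theorem countDev_sq {m : ℕ} {β : ℝ} (h0 : 0 ≤ β) (h1 : β ≤ 1) :
    countDev m β ^ 2 = m * (β * (1 - β)) := by
  have := sub_nonneg.2 h1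
  rw [countDev, Real.sq_sqrt (by positivity)]

theorem det_gramMatrix_eq_inv_sqrt {m : ℕ} (hm : 3 ≤ m) {β : ℝ} (h0 : 0 < β) (h1 : β < 1) :
    (gramMatrix m β).det = 1 / √(bimagicCov m β).det := by
  have hA := det_gramMatrix_pos hm h0 h1
  have hc := countDev_pos hm h0 h1
  have hs : (gramMatrix m β).det ^ 2 * (bimagicCov m β).det = 1 := by
    have e : (gramMatrix m β).det ^ 2 * (bimagicCov m β).det = (gramCoeff₁ m ^ 2 *
      ((m : ℝ) ^ 2 - 1)) * (gramCoeff₂ m ^ 2 * (((m : ℝ) ^ 2 - 1) * ((m : ℝ) ^ 2 - 4))) *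
      (m * (β * (1 - β))) ^ 3 / (15 * (countDev m β ^ 2) ^ 3) := by
      rw [det_gramMatrix, det_bimagicCov]; field_simp; ring
    rw [e, gramCoeff₁_sq hm, gramCoeff₂_sq hm, ← countDev_sq h0.le h1.le]
    field_simp; norm_num
  have hd : (bimagicCov m β).det = 1 / (gramMatrix m β).det ^ 2 := by
    field_simp; linarith
  rw [hd, Real.sqrt_div zero_le_one, Real.sqrt_one, Real.sqrt_sq hA.le, one_div_one_div]

theorem bimagicGaussProb_eq {m : ℕ} (hm : 3 ≤ m) {β : ℝ} (h0 : 0 < β) (h1 : β < 1) :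
    bimagicGaussProb m β = (gramMatrix m β).det / (2 * Real.pi) ^ (3 / 2 : ℝ) := by
  rw [bimagicGaussProb, det_gramMatrix_eq_inv_sqrt hm h0 h1, div_div, mul_comm]

open MeasureTheory in
/-- Change of variables `θ = A y`. -/
theorem integral_gramMatrix {m : ℕ} (hm : 3 ≤ m) {β : ℝ} (h0 : 0 < β) (h1 : β < 1)
    (f : (Fin 3 → ℝ) → ℝ) :
    ∫ θ, f θ = (gramMatrix m β).det * ∫ y, f ((gramMatrix m β).mulVec y) := by
  have hA := det_gramMatrix_pos hm h0 h1
  have hmap := Real.map_matrix_volume_pi_eq_smul_volume_pi hA.ne'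
  set e : (Fin 3 → ℝ) ≃ₗ[ℝ] (Fin 3 → ℝ) :=
    Matrix.toLinearEquiv' (gramMatrix m β)
      ((gramMatrix m β).invertibleOfIsUnitDet hA.ne'.isUnit) with he
  have hemb : MeasurableEmbedding (Matrix.toLin' (gramMatrix m β)) :=
    e.toContinuousLinearEquiv.toHomeomorph.measurableEmbedding
  have := hemb.integral_map (μ := volume) f
  rw [hmap, integral_smul_measure, abs_of_pos (inv_pos.2 hA), ENNReal.toReal_ofReal (inv_pos.2 hA).le,
    smul_eq_mul] at this
  simp only [Matrix.toLin'_apply] at this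
  rw [← this]
  field_simp

/-! ### Taylor expansion of the logarithm of the characteristic function -/

theorem abs_cos_sub_le {u : ℝ} (hu : |u| ≤ 1) :
    |Real.cos u - (1 - u ^ 2 / 2 + u ^ 4 / 24)| ≤ u ^ 6 := by
  have hn : ‖(u * Complex.I : ℂ)‖ = |u| := by simp
  have h := Complex.exp_bound (x := u * Complex.I) (by rw [hn]; exact hu) (n := 6) (by norm_num)
  have h2 := (Complex.abs_re_le_norm _).trans h
  rw [Complex.exp_mul_I, hn] at h2
  simp only [Finset.sum_range_succ, Finset.sum_range_zero, ← Complex.ofReal_cos,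
    ← Complex.ofReal_sin, mul_pow, Complex.I_sq, show Complex.I ^ 3 = -Complex.I from
      Complex.I_pow_three, Complex.I_pow_four, show Complex.I ^ 5 = Complex.I by
      rw [show (5 : ℕ) = 4 + 1 from rfl, pow_succ, Complex.I_pow_four, one_mul]] at h2
  norm_num [Nat.factorial, ← Complex.ofReal_pow] at h2
  rw [Even.pow_abs (by decide)] at h2
  have e : Real.cos u - (1 - u ^ 2 / 2 + u ^ 4 / 24) = Real.cos u - (1 + -u ^ 2 / 2 + u ^ 4 / 24) := by
    ring
  rw [e]
  refine h2.trans ?_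
  have : 0 ≤ u ^ 6 := by positivity
  linarith

theorem abs_sin_sub_le {u : ℝ} (hu : |u| ≤ 1) :
    |Real.sin u - (u - u ^ 3 / 6)| ≤ |u| ^ 5 := by
  have hn : ‖(u * Complex.I : ℂ)‖ = |u| := by simp
  have h := Complex.exp_bound (x := u * Complex.I) (by rw [hn]; exact hu) (n := 5) (by norm_num)
  have h2 := (Complex.abs_im_le_norm _).trans h
  rw [Complex.exp_mul_I, hn] at h2
  simp only [Finset.sum_range_succ, Finset.sum_range_zero, ← Complex.ofReal_cos,
    ← Complex.ofReal_sin, mul_pow, Complex.I_sq, show Complex.I ^ 3 = -Complex.I from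
      Complex.I_pow_three, Complex.I_pow_four] at h2
  norm_num [Nat.factorial, ← Complex.ofReal_pow] at h2
  have e : Real.sin u - (u - u ^ 3 / 6) = Real.sin u - (u + -u ^ 3 / 6) := by
    ring
  rw [e]
  refine h2.trans ?_
  have : 0 ≤ |u| ^ 5 := by positivity
  linarith

/-- The logarithm of the characteristic function of a centred Bernoulli variable of mean `β`. -/
noncomputable def bernoulliLog (β u : ℝ) : ℂ :=
  Complex.log (1 + β * (Complex.exp (Complex.I * u) - 1)) - Complex.I * (β * u)

theorem norm_exp_I_sub_one_le (u : ℝ) : ‖Complex.exp (Complex.I * u) - 1‖ ≤ |u| := by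
  simpa using Real.norm_exp_I_mul_ofReal_sub_one_le (x := u)

/-- Two terms of the logarithm suffice: the remainder `β³ |u|³` sums to `O(N⁻²)` in the regime
`β ≤ 1 / N`. -/
theorem norm_bernoulliLog_sub_le {β u : ℝ} (hβ0 : 0 ≤ β) (hβ : β ≤ 1 / 4) (hu : |u| ≤ 1) :
    ‖bernoulliLog β u - (β * (Complex.exp (Complex.I * u) - 1)
      - (β * (Complex.exp (Complex.I * u) - 1)) ^ 2 / 2 - Complex.I * (β * u))‖ ≤ β ^ 3 * |u| ^ 3 := by
  set w : ℂ := β * (Complex.exp (Complex.I * u) - 1) with hw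
  have hwn : ‖w‖ ≤ β * |u| := by
    rw [hw, norm_mul, Complex.norm_real, Real.norm_of_nonneg hβ0]
    gcongr
    exact norm_exp_I_sub_one_le u
  have hw4 : ‖w‖ ≤ 1 / 4 := hwn.trans (by nlinarith [abs_nonneg u])
  have h := Complex.norm_log_sub_logTaylor_le 2 (z := w) (by linarith)
  have e : bernoulliLog β u - (w - w ^ 2 / 2 - Complex.I * (β * u))
      = Complex.log (1 + w) - Complex.logTaylor (2 + 1) w := by
    rw [bernoulliLog, ← hw, Complex.logTaylor]
    simp [Finset.sum_range_succ]
    ring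
  rw [e]
  refine h.trans ?_
  have h1 : (1 - ‖w‖)⁻¹ ≤ 2 := by
    rw [inv_le_comm₀ (by linarith) (by norm_num)]; linarith
  calc ‖w‖ ^ (2 + 1) * (1 - ‖w‖)⁻¹ / ((2 : ℕ) + 1) ≤ ‖w‖ ^ 3 * 2 / ((2 : ℕ) + 1) := by gcongr
    _ ≤ ‖w‖ ^ 3 := by push_cast; have : 0 ≤ ‖w‖ ^ 3 := by positivity
                      linarith
    _ ≤ (β * |u|) ^ 3 := by gcongr
    _ = _ := by ring

theorem abs_re_bernoulliLog_le {β u : ℝ} (hβ0 : 0 ≤ β) (hβ : β ≤ 1 / 4) (hu : |u| ≤ 1) :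
    |(bernoulliLog β u).re + β * (1 - β) * u ^ 2 / 2 - β * u ^ 4 / 24| ≤
      β * u ^ 6 + 2 * β ^ 2 * u ^ 4 + β ^ 3 * |u| ^ 3 := by
  have h := (Complex.abs_re_le_norm _).trans (norm_bernoulliLog_sub_le hβ0 hβ hu)
  set c := Real.cos u with hc
  have e : (bernoulliLog β u - (β * (Complex.exp (Complex.I * u) - 1)
      - (β * (Complex.exp (Complex.I * u) - 1)) ^ 2 / 2 - Complex.I * (β * u))).re
      = (bernoulliLog β u).re - (β * (c - 1) + β ^ 2 * (c * (1 - c))) := by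
    rw [mul_comm Complex.I, Complex.exp_mul_I, ← Complex.ofReal_cos, ← Complex.ofReal_sin]
    have e2 : ∀ z : ℂ, (z ^ 2 / 2).re = (z.re ^ 2 - z.im ^ 2) / 2 := by
      intro z; rw [sq, Complex.div_ofNat_re, Complex.mul_re]; ring
    simp only [Complex.sub_re, e2, Complex.mul_re, Complex.mul_im, Complex.add_re, Complex.add_im,
      Complex.ofReal_re, Complex.ofReal_im, Complex.I_re, Complex.I_im, Complex.one_re,
      Complex.one_im, Complex.sub_im]
    rw [← hc]
    linear_combination (-β ^ 2 / 2) * Real.sin_sq_add_cos_sq u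
  rw [e] at h
  have h1 := abs_cos_sub_le hu
  have h2 := Real.cos_bound hu
  rw [Even.pow_abs (by decide)] at h2
  have h3 : |c * (1 - c) - u ^ 2 / 2| ≤ 2 * u ^ 4 := by
    have a := abs_le.1 h2
    have b1 := Real.one_sub_sq_div_two_le_cos (x := u)
    have b2 := Real.cos_le_one u
    rw [← hc] at a b1 b2
    have b3 : (1 - c) ^ 2 ≤ (u ^ 2 / 2) ^ 2 := by
      have : 0 ≤ 1 - c := by linarith
      gcongr; linarith
    have : 0 ≤ u ^ 4 := by positivity
    rw [abs_le]
    constructor <;> nlinarith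
  have e3 : (bernoulliLog β u).re + β * (1 - β) * u ^ 2 / 2 - β * u ^ 4 / 24
      = ((bernoulliLog β u).re - (β * (c - 1) + β ^ 2 * (c * (1 - c)))) +
        β * (c - (1 - u ^ 2 / 2 + u ^ 4 / 24)) + β ^ 2 * (c * (1 - c) - u ^ 2 / 2) := by ring
  rw [e3]
  refine (abs_add_three _ _ _).trans ?_
  rw [abs_mul β, abs_mul (β ^ 2), abs_of_nonneg hβ0, abs_of_nonneg (sq_nonneg β)]
  have := mul_le_mul_of_nonneg_left h1 hβ0
  have := mul_le_mul_of_nonneg_left h3 (sq_nonneg β)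
  linarith

theorem abs_im_bernoulliLog_le {β u : ℝ} (hβ0 : 0 ≤ β) (hβ : β ≤ 1 / 4) (hu : |u| ≤ 1) :
    |(bernoulliLog β u).im + β * u ^ 3 / 6| ≤ β * |u| ^ 5 + 2 * β ^ 2 * |u| ^ 3 := by
  have h := (Complex.abs_im_le_norm _).trans (norm_bernoulliLog_sub_le hβ0 hβ hu)
  set c := Real.cos u with hc
  set s := Real.sin u with hs
  have e : (bernoulliLog β u - (β * (Complex.exp (Complex.I * u) - 1)
      - (β * (Complex.exp (Complex.I * u) - 1)) ^ 2 / 2 - Complex.I * (β * u))).im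
      = (bernoulliLog β u).im - (β * s + β ^ 2 * (s * (1 - c)) - β * u) := by
    rw [mul_comm Complex.I, Complex.exp_mul_I, ← Complex.ofReal_cos, ← Complex.ofReal_sin]
    have e2 : ∀ z : ℂ, (z ^ 2 / 2).im = z.re * z.im := by
      intro z; rw [sq, Complex.div_ofNat_im, Complex.mul_im]; ring
    simp only [Complex.sub_re, e2, Complex.mul_re, Complex.mul_im, Complex.add_re, Complex.add_im,
      Complex.ofReal_re, Complex.ofReal_im, Complex.I_re, Complex.I_im, Complex.one_re,
      Complex.one_im, Complex.sub_im]
    rw [← hc, ← hs]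
    ring
  rw [e] at h
  have h1 := abs_sin_sub_le hu
  have h3 : |s * (1 - c)| ≤ |u| ^ 3 := by
    have b1 := Real.one_sub_sq_div_two_le_cos (x := u)
    have b2 := Real.cos_le_one u
    rw [abs_mul, abs_of_nonneg (by linarith : 0 ≤ 1 - c), pow_succ', sq_abs]
    have : 0 ≤ u ^ 2 := sq_nonneg u
    exact mul_le_mul Real.abs_sin_le_abs (by linarith) (by linarith) (abs_nonneg u)
  have e3 : (bernoulliLog β u).im + β * u ^ 3 / 6
      = ((bernoulliLog β u).im - (β * s + β ^ 2 * (s * (1 - c)) - β * u)) +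
        β * (s - (u - u ^ 3 / 6)) + β ^ 2 * (s * (1 - c)) := by ring
  rw [e3]
  refine (abs_add_three _ _ _).trans ?_
  rw [abs_mul β, abs_mul (β ^ 2), abs_of_nonneg hβ0, abs_of_nonneg (sq_nonneg β)]
  have := mul_le_mul_of_nonneg_left h1 hβ0
  have := mul_le_mul_of_nonneg_left h3 (sq_nonneg β)
  have : β ^ 3 * |u| ^ 3 ≤ β ^ 2 * |u| ^ 3 := by
    gcongr ?_ * _
    exact pow_le_pow_of_le_one hβ0 (by linarith) (by norm_num)
  linarith

theorem exp_bernoulliLog {β u : ℝ} (hβ0 : 0 ≤ β) (hβ : β ≤ 1 / 4) (hu : |u| ≤ 1) :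
    Complex.exp (bernoulliLog β u) = (1 + β * (Complex.exp (Complex.I * u) - 1)) *
      Complex.exp (-(Complex.I * (β * u))) := by
  rw [bernoulliLog, sub_eq_add_neg, Complex.exp_add, Complex.exp_log]
  intro h0
  have h1 : ‖(β * (Complex.exp (Complex.I * u) - 1) : ℂ)‖ ≤ 1 / 4 := by
    rw [norm_mul, Complex.norm_real, Real.norm_of_nonneg hβ0]
    have := norm_exp_I_sub_one_le u
    nlinarith [norm_nonneg (Complex.exp (Complex.I * u) - 1)]
  rw [eq_neg_of_add_eq_zero_right h0] at h1
  norm_num at h1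

theorem re_centredCharFun {m : ℕ} {β : ℝ} (hβ0 : 0 ≤ β) (hβ : β ≤ 1 / 4) {θ : Fin 3 → ℝ}
    (hθ : ∀ j ∈ Finset.Icc 1 m, |phase θ j| ≤ 1) :
    (centredCharFun m β θ).re = Real.exp (∑ j ∈ Finset.Icc 1 m, (bernoulliLog β (phase θ j)).re) *
      Real.cos (∑ j ∈ Finset.Icc 1 m, (bernoulliLog β (phase θ j)).im) := by
  have : centredCharFun m β θ = Complex.exp (∑ j ∈ Finset.Icc 1 m, bernoulliLog β (phase θ j)) := by
    rw [Complex.exp_sum, centredCharFun]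
    exact Finset.prod_congr rfl fun j hj => (exp_bernoulliLog hβ0 hβ (hθ j hj)).symm
  rw [this, Complex.exp_re, Complex.re_sum, Complex.im_sum]

theorem abs_cos_sub_one_add_le (x : ℝ) : |Real.cos x - 1 + x ^ 2 / 2| ≤ 3 * x ^ 4 := by
  rcases le_or_gt |x| 1 with h | h
  · have h2 := Real.cos_bound h
    rw [Even.pow_abs (by decide)] at h2
    have e : Real.cos x - 1 + x ^ 2 / 2 = Real.cos x - (1 - x ^ 2 / 2) := by ring
    rw [e]
    have : 0 ≤ x ^ 4 := by positivity
    linarith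
  · have h1 : 1 < x ^ 2 := by rw [← sq_abs]; nlinarith
    rw [abs_le]
    constructor <;> nlinarith [Real.cos_le_one x, Real.neg_one_le_cos x]

theorem abs_exp_sub_one_sub_le (x : ℝ) : |Real.exp x - 1 - x| ≤ x ^ 2 * Real.exp |x| := by
  have := Complex.norm_exp_sub_sum_le_norm_mul_exp (x : ℂ) 2
  simp only [Finset.sum_range_succ, Finset.sum_range_zero] at this
  norm_num at this
  rw [← Complex.ofReal_exp, ← Complex.ofReal_one, ← Complex.ofReal_add, ← Complex.ofReal_sub,
    Complex.norm_real, Real.norm_eq_abs] at this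
  rwa [← sub_sub] at this

/-- Second-order expansion of `e ^ X * cos B` when `X` is of order `n⁻²` and `B` of order `n⁻¹`;
taking the real part removes all terms of odd order in `n⁻¹`. -/
theorem abs_exp_mul_cos_sub_le {X B s₄ s₃ T n ρ : ℝ} (hn : 1 ≤ n) (hT : 1 ≤ T)
    (hX : |X - s₄| ≤ T / n ^ 4) (hB : |B - s₃| ≤ T / n ^ 3) (h4 : |s₄| ≤ T / n ^ 2)
    (h3 : |s₃| ≤ T / n) (hXρ : |X| ≤ ρ) :
    |Real.exp X * Real.cos B - (1 + s₄ - s₃ ^ 2 / 2)| ≤ 110 * T ^ 5 * Real.exp ρ / n ^ 4 := by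
  have hn0 : 0 < n := by linarith
  have i1 : n⁻¹ ≤ 1 := inv_le_one_of_one_le₀ hn
  have i0 : 0 < n⁻¹ := inv_pos.2 hn0
  set i := n⁻¹ with hi
  have d : ∀ k : ℕ, T / n ^ k = T * i ^ k := fun k => by rw [hi, inv_pow, div_eq_mul_inv]
  rw [d] at hX hB h4
  rw [show T / n = T * i from div_eq_mul_inv _ _] at h3
  rw [div_eq_mul_inv _ (n ^ 4), ← inv_pow, ← hi]
  have hE : 1 ≤ Real.exp ρ := Real.one_le_exp ((abs_nonneg X).trans hXρ)
  have hi4 : 0 ≤ i ^ 4 := by positivity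
  have hT0 : 0 ≤ T := by linarith
  have hXb : |X| ≤ 2 * T * i ^ 2 := by
    have : |X| ≤ |X - s₄| + |s₄| := by simpa using abs_add_le (X - s₄) s₄
    have : i ^ 4 ≤ i ^ 2 := pow_le_pow_of_le_one i0.le i1 (by norm_num)
    nlinarith
  have hBb : |B| ≤ 2 * T * i := by
    have : |B| ≤ |B - s₃| + |s₃| := by simpa using abs_add_le (B - s₃) s₃
    have : i ^ 3 ≤ i ^ 1 := pow_le_pow_of_le_one i0.le i1 (by norm_num)
    nlinarith
  have p2 : T ≤ T ^ 2 := by nlinarith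
  have p4 : T ^ 2 ≤ T ^ 4 := pow_le_pow_right₀ hT (by norm_num)
  have p5 : T ^ 4 ≤ T ^ 5 := pow_le_pow_right₀ hT (by norm_num)
  have p35 : T ^ 3 ≤ T ^ 5 := pow_le_pow_right₀ hT (by norm_num)
  have E2 : |Real.exp X - 1 - s₄| ≤ 5 * T ^ 5 * Real.exp ρ * i ^ 4 := by
    have a := abs_exp_sub_one_sub_le X
    have b : X ^ 2 * Real.exp |X| ≤ (2 * T * i ^ 2) ^ 2 * Real.exp ρ := by
      rw [← sq_abs X]; gcongr
    have c : |Real.exp X - 1 - s₄| ≤ |Real.exp X - 1 - X| + |X - s₄| := by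
      simpa using abs_add_le (Real.exp X - 1 - X) (X - s₄)
    have d1 : T * i ^ 4 ≤ T ^ 5 * Real.exp ρ * i ^ 4 := by
      gcongr; nlinarith
    have d2 : (2 * T * i ^ 2) ^ 2 * Real.exp ρ ≤ 4 * T ^ 5 * Real.exp ρ * i ^ 4 := by
      calc (2 * T * i ^ 2) ^ 2 * Real.exp ρ = 4 * T ^ 2 * Real.exp ρ * i ^ 4 := by ring
        _ ≤ _ := by gcongr; linarith
    linarith
  have E1 : |Real.cos B - 1 + s₃ ^ 2 / 2| ≤ 50 * T ^ 4 * i ^ 4 := by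
    have a := abs_cos_sub_one_add_le B
    have b : B ^ 4 ≤ (2 * T * i) ^ 4 := by
      rw [← Even.pow_abs (by decide : Even 4) B]; gcongr
    have c : |s₃ ^ 2 - B ^ 2| ≤ 3 * T ^ 2 * i ^ 4 := by
      rw [show s₃ ^ 2 - B ^ 2 = -((B - s₃) * (B + s₃)) by ring, abs_neg, abs_mul]
      have : |B + s₃| ≤ 3 * T * i := (abs_add_le _ _).trans (by linarith)
      calc |B - s₃| * |B + s₃| ≤ (T * i ^ 3) * (3 * T * i) := by gcongr
        _ = _ := by ring
    have e : Real.cos B - 1 + s₃ ^ 2 / 2 = (Real.cos B - 1 + B ^ 2 / 2) + (s₃ ^ 2 - B ^ 2) / 2 := by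
      ring
    rw [e]
    refine (abs_add_le _ _).trans ?_
    rw [abs_div, abs_two]
    have : T ^ 2 * i ^ 4 ≤ T ^ 4 * i ^ 4 := by gcongr
    nlinarith [mul_nonneg (pow_nonneg hT0 4) hi4]
  have e : Real.exp X * Real.cos B - (1 + s₄ - s₃ ^ 2 / 2) = (Real.exp X - 1 - s₄) * Real.cos B
      + (1 + s₄) * (Real.cos B - 1 + s₃ ^ 2 / 2) + -(s₄ * (s₃ ^ 2 / 2)) := by ring
  rw [e]
  refine (abs_add_three _ _ _).trans ?_
  rw [abs_neg, abs_mul, abs_mul, abs_mul, abs_of_nonneg (by positivity : 0 ≤ s₃ ^ 2 / 2)]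
  have i2 : i ^ 2 ≤ 1 := pow_le_one₀ i0.le i1
  have f1 : |Real.exp X - 1 - s₄| * |Real.cos B| ≤ 5 * T ^ 5 * Real.exp ρ * i ^ 4 * 1 := by
    gcongr
    exact Real.abs_cos_le_one B
  have f2 : |1 + s₄| * |Real.cos B - 1 + s₃ ^ 2 / 2| ≤ (2 * T) * (50 * T ^ 4 * i ^ 4) := by
    gcongr
    refine (abs_add_le _ _).trans ?_
    rw [abs_one]
    nlinarith
  have f3 : |s₄| * (s₃ ^ 2 / 2) ≤ (T * i ^ 2) * ((T * i) ^ 2 / 2) := by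
    gcongr ?_ * (?_ / 2)
    rw [← sq_abs]; gcongr
  have g : T ^ 5 * i ^ 4 ≤ T ^ 5 * Real.exp ρ * i ^ 4 := by
    have := mul_nonneg (pow_nonneg hT0 5) hi4
    nlinarith
  have g3 : T ^ 3 * i ^ 4 ≤ T ^ 5 * i ^ 4 := by gcongr
  nlinarith [mul_nonneg (pow_nonneg hT0 5) hi4]

/-! ### Riemann sums and the limit of the discrete Chebyshev polynomials -/

/-- Riemann sums over a uniform partition, with the integral expressed by a primitive `F`. -/
theorem abs_riemannSum_sub_le {F f : ℝ → ℝ} {L : ℝ} (hF : ∀ s, HasDerivAt F (f s) s)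
    (hL : ∀ s ∈ Set.Icc (0 : ℝ) 1, ∀ t ∈ Set.Icc (0 : ℝ) 1, |f s - f t| ≤ L * |s - t|)
    {m : ℕ} (hm : 1 ≤ m) :
    |(∑ j ∈ Finset.Icc 1 m, f (j / m)) / m - (F 1 - F 0)| ≤ L / m := by
  have hm0 : (0 : ℝ) < m := by exact_mod_cast hm
  have hL0 : 0 ≤ L := by
    have := hL 0 (by simp) 1 (by simp)
    simp at this
    exact (abs_nonneg _).trans this
  have tel : F 1 - F 0 = ∑ j ∈ Finset.Icc 1 m, (F (j / m) - F ((j - 1) / m)) := by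
    have h := Finset.sum_range_sub (fun j : ℕ => F (j / m)) m
    rw [div_self hm0.ne', Nat.cast_zero, zero_div] at h
    rw [← h, Finset.range_eq_Ico, Finset.sum_Ico_eq_sum_range, ← Finset.Ico_add_one_right_eq_Icc,
      Finset.sum_Ico_eq_sum_range]
    refine Finset.sum_congr (by simp) fun j _ => ?_
    push_cast
    congr 3 <;> ring
  have term : ∀ j ∈ Finset.Icc 1 m,
      |f (j / m) / m - (F (j / m) - F ((j - 1) / m))| ≤ L / m / m := by
    intro j hj
    rw [Finset.mem_Icc] at hj
    have hj1 : (1 : ℝ) ≤ j := by exact_mod_cast hj.1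
    have hjm : (j : ℝ) ≤ m := by exact_mod_cast hj.2
    have hlt : ((j : ℝ) - 1) / m < j / m := by gcongr; linarith
    obtain ⟨ξ, hξ, hs⟩ := exists_hasDerivAt_eq_slope F f hlt
      (fun x _ => (hF x).continuousAt.continuousWithinAt) fun x _ => hF x
    have hd : (j : ℝ) / m - (j - 1) / m = 1 / m := by ring
    rw [hd] at hs
    have hs' : F (j / m) - F ((j - 1) / m) = f ξ / m := by
      rw [hs]; field_simp
    rw [hs', ← sub_div, abs_div, abs_of_pos hm0]
    have j0 : 0 ≤ ((j : ℝ) - 1) / m := div_nonneg (by linarith) hm0.le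
    have j1 : (j : ℝ) / m ≤ 1 := (div_le_one hm0).2 hjm
    have hb := hL (j / m) ⟨by linarith, j1⟩ ξ ⟨by linarith [hξ.1], by linarith [hξ.2]⟩
    have habs : |(j : ℝ) / m - ξ| ≤ 1 / m := by
      rw [abs_of_pos (by linarith [hξ.2])]; linarith [hξ.1]
    gcongr
    calc _ ≤ L * |(j : ℝ) / m - ξ| := hb
      _ ≤ L * (1 / m) := by gcongr
      _ = L / m := by ring
  rw [tel, Finset.sum_div, ← Finset.sum_sub_distrib]
  refine (Finset.abs_sum_le_sum_abs _ _).trans ((Finset.sum_le_sum term).trans ?_)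
  rw [Finset.sum_const, Nat.card_Icc, Nat.add_sub_cancel, nsmul_eq_mul]
  apply le_of_eq
  field_simp

/-- The quadratic polynomial on `[0, 1]` with coordinates `y` in the basis of normalized shifted
Legendre polynomials. -/
noncomputable def legendrePoly (y : Fin 3 → ℝ) (s : ℝ) : ℝ :=
  y 0 + y 1 * (√3 * (2 * s - 1)) + y 2 * (√5 * (6 * s ^ 2 - 6 * s + 1))

/-- `√(1 + |y|²)`, the gauge in which all error terms are measured. -/
noncomputable def regNorm (y : Fin 3 → ℝ) : ℝ := √(1 + ∑ a, y a ^ 2)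

theorem regNorm_sq (y : Fin 3 → ℝ) : regNorm y ^ 2 = 1 + ∑ a, y a ^ 2 :=
  Real.sq_sqrt (by positivity)

theorem one_le_regNorm (y : Fin 3 → ℝ) : 1 ≤ regNorm y :=
  Real.one_le_sqrt.2 (le_add_of_nonneg_right (by positivity))

theorem abs_le_regNorm (y : Fin 3 → ℝ) (a : Fin 3) : |y a| ≤ regNorm y := by
  refine Real.abs_le_sqrt ?_
  have := Finset.single_le_sum (f := fun a => y a ^ 2) (fun _ _ => sq_nonneg _) (Finset.mem_univ a)
  linarith

theorem sqrt_three_le : √3 ≤ 2 := Real.sqrt_le_iff.2 (by norm_num)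
theorem sqrt_five_le : √5 ≤ 3 := Real.sqrt_le_iff.2 (by norm_num)

theorem abs_add_mul_add_mul_le {y : Fin 3 → ℝ} {p q P Q : ℝ} (hp : |p| ≤ P) (hq : |q| ≤ Q) :
    |y 1 * p + y 2 * q| ≤ (P + Q) * regNorm y := by
  have h1 := abs_le_regNorm y 1
  have h2 := abs_le_regNorm y 2
  have := one_le_regNorm y
  refine (abs_add_le _ _).trans ?_
  rw [abs_mul, abs_mul]
  have a1 : |y 1| * |p| ≤ regNorm y * P := by gcongr
  have a2 : |y 2| * |q| ≤ regNorm y * Q := by gcongr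
  linarith

theorem abs_legendrePoly_le (y : Fin 3 → ℝ) {s : ℝ} (hs : s ∈ Set.Icc (0 : ℝ) 1) :
    |legendrePoly y s| ≤ 6 * regNorm y := by
  obtain ⟨h0, h1⟩ := hs
  have hp : |√3 * (2 * s - 1)| ≤ 2 := by
    rw [abs_mul, abs_of_nonneg (Real.sqrt_nonneg _)]
    have : |2 * s - 1| ≤ 1 := abs_le.2 ⟨by linarith, by linarith⟩
    nlinarith [sqrt_three_le, abs_nonneg (2 * s - 1), Real.sqrt_nonneg 3]
  have hq : |√5 * (6 * s ^ 2 - 6 * s + 1)| ≤ 3 := by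
    rw [abs_mul, abs_of_nonneg (Real.sqrt_nonneg _)]
    have : |6 * s ^ 2 - 6 * s + 1| ≤ 1 := abs_le.2 ⟨by nlinarith [sq_nonneg (2 * s - 1)], by nlinarith⟩
    nlinarith [sqrt_five_le, abs_nonneg (6 * s ^ 2 - 6 * s + 1), Real.sqrt_nonneg 5]
  have := abs_add_mul_add_mul_le (y := y) hp hq
  have h3 := abs_le_regNorm y 0
  rw [legendrePoly, add_assoc]
  exact (abs_add_le _ _).trans (by linarith)

theorem abs_legendrePoly_sub_le (y : Fin 3 → ℝ) {s t : ℝ} (hs : s ∈ Set.Icc (0 : ℝ) 1)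
    (ht : t ∈ Set.Icc (0 : ℝ) 1) :
    |legendrePoly y s - legendrePoly y t| ≤ 22 * regNorm y * |s - t| := by
  obtain ⟨h0, h1⟩ := hs
  obtain ⟨h0', h1'⟩ := ht
  have hp : |2 * √3| ≤ 4 := by
    rw [abs_of_nonneg (by positivity)]; linarith [sqrt_three_le]
  have hq : |√5 * (6 * (s + t) - 6)| ≤ 18 := by
    rw [abs_mul, abs_of_nonneg (Real.sqrt_nonneg _)]
    have : |6 * (s + t) - 6| ≤ 6 := abs_le.2 ⟨by linarith, by linarith⟩
    nlinarith [sqrt_five_le, abs_nonneg (6 * (s + t) - 6), Real.sqrt_nonneg 5]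
  have := abs_add_mul_add_mul_le (y := y) hp hq
  have e : legendrePoly y s - legendrePoly y t
      = (y 1 * (2 * √3) + y 2 * (√5 * (6 * (s + t) - 6))) * (s - t) := by
    rw [legendrePoly, legendrePoly]; ring
  rw [e, abs_mul]
  gcongr
  linarith

theorem abs_sub_sqrt_le {x c d : ℝ} (hx : 0 ≤ x) (hc : 1 ≤ c) (h : |x ^ 2 - c| ≤ d) :
    |x - √c| ≤ d := by
  have h1 : 1 ≤ √c := Real.one_le_sqrt.2 hc
  have e : x ^ 2 - c = (x - √c) * (x + √c) := by
    have := Real.sq_sqrt (by linarith : 0 ≤ c)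
    linear_combination this
  rw [e, abs_mul, abs_of_nonneg (by linarith : 0 ≤ x + √c)] at h
  nlinarith [abs_nonneg (x - √c)]

theorem abs_gramCoeff₁_mul_sub_le {m : ℕ} (hm : 64 ≤ m) : |gramCoeff₁ m * m - √3| ≤ 1 / m := by
  have hmR : (64 : ℝ) ≤ m := by exact_mod_cast hm
  have h1 := gramCoeff₁_sq (m := m) (by omega)
  have h0 := gramCoeff₁_pos (m := m) (by omega)
  refine abs_sub_sqrt_le (by positivity) (by norm_num) ?_
  have hp : 0 < (m : ℝ) ^ 2 - 1 := by nlinarith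
  have e : (gramCoeff₁ m * m) ^ 2 - 3 = 3 / ((m : ℝ) ^ 2 - 1) := by
    have : gramCoeff₁ m ^ 2 = 3 / ((m : ℝ) ^ 2 - 1) := by
      rw [eq_div_iff hp.ne', h1]
    rw [mul_pow, this]; field_simp; ring
  rw [e, abs_of_pos (by positivity), div_le_div_iff₀ hp (by linarith)]
  nlinarith

theorem abs_gramCoeff₂_mul_sub_le {m : ℕ} (hm : 64 ≤ m) :
    |gramCoeff₂ m * (m : ℝ) ^ 2 - √5| ≤ 1 / m := by
  have hmR : (64 : ℝ) ≤ m := by exact_mod_cast hm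
  have h1 := gramCoeff₂_sq (m := m) (by omega)
  have h0 := gramCoeff₂_pos (m := m) (by omega)
  refine abs_sub_sqrt_le (by positivity) (by norm_num) ?_
  have hp1 : 0 < (m : ℝ) ^ 2 - 1 := by nlinarith
  have hp4 : 0 < (m : ℝ) ^ 2 - 4 := by nlinarith
  have e : (gramCoeff₂ m * (m : ℝ) ^ 2) ^ 2 - 5
      = (25 * (m : ℝ) ^ 2 - 20) / (((m : ℝ) ^ 2 - 1) * ((m : ℝ) ^ 2 - 4)) := by
    have : gramCoeff₂ m ^ 2 = 5 / (((m : ℝ) ^ 2 - 1) * ((m : ℝ) ^ 2 - 4)) := by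
      rw [eq_div_iff (by positivity), h1]
    rw [mul_pow, this]; field_simp; ring
  have hn : 0 ≤ 25 * (m : ℝ) ^ 2 - 20 := by nlinarith
  rw [e, abs_of_nonneg (by positivity), div_le_div_iff₀ (by positivity) (by linarith)]
  have a1 : 30 * (m : ℝ) ≤ (m : ℝ) ^ 2 - 4 := by nlinarith
  have a2 : (m : ℝ) ^ 2 * (30 * m) ≤ ((m : ℝ) ^ 2 - 1) * (30 * m) + 30 * m := by linarith
  nlinarith [mul_le_mul_of_nonneg_left a1 hp1.le]

theorem abs_gramPoly_sub_legendrePoly_le {m : ℕ} (hm : 64 ≤ m) (y : Fin 3 → ℝ) {j : ℕ}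
    (hj : j ∈ Finset.Icc 1 m) : |gramPoly m y j - legendrePoly y (j / m)| ≤ 22 * regNorm y / m := by
  have hmR : (64 : ℝ) ≤ m := by exact_mod_cast hm
  have hm0 : (0 : ℝ) < m := by linarith
  rw [Finset.mem_Icc] at hj
  have hj1 : (1 : ℝ) ≤ j := by exact_mod_cast hj.1
  have hjm : (j : ℝ) ≤ m := by exact_mod_cast hj.2
  have d1 := abs_gramCoeff₁_mul_sub_le hm
  have d2 := abs_gramCoeff₂_mul_sub_le hm
  set s : ℝ := j / m with hs
  have hjs : (j : ℝ) = s * m := by rw [hs]; field_simp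
  have s0 : 0 ≤ s := by positivity
  have s1 : s ≤ 1 := (div_le_one hm0).2 hjm
  set μ := gramCoeff₁ m * m with hμ
  set κ := gramCoeff₂ m * (m : ℝ) ^ 2 with hκ
  have im : 1 / (m : ℝ) ≤ 1 / 64 := by gcongr
  have im0 : 0 < 1 / (m : ℝ) := by positivity
  have bμ : |μ| ≤ 3 := by
    have := abs_add_le (μ - √3) (√3)
    rw [sub_add_cancel, abs_of_nonneg (Real.sqrt_nonneg 3)] at this
    linarith [sqrt_three_le]
  have bκ : |κ| ≤ 4 := by
    have := abs_add_le (κ - √5) (√5)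
    rw [sub_add_cancel, abs_of_nonneg (Real.sqrt_nonneg 5)] at this
    linarith [sqrt_five_le]
  have hp : |(μ - √3) * (2 * s - 1) - μ * (1 / m)| ≤ 4 * (1 / (m : ℝ)) := by
    refine (abs_sub _ _).trans ?_
    rw [abs_mul, abs_mul, abs_of_pos im0]
    have : |2 * s - 1| ≤ 1 := abs_le.2 ⟨by linarith, by linarith⟩
    have := mul_le_mul d1 this (abs_nonneg _) im0.le
    have := mul_le_mul_of_nonneg_right bμ im0.le
    linarith
  have hq : |(κ - √5) * (6 * s ^ 2 - 6 * s + 1) + κ * ((-6 * s + 3 + 2 * (1 / m)) * (1 / m))|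
      ≤ 18 * (1 / (m : ℝ)) := by
    refine (abs_add_le _ _).trans ?_
    rw [abs_mul, abs_mul, abs_mul _ (1 / (m : ℝ)), abs_of_pos im0]
    have h1 : |6 * s ^ 2 - 6 * s + 1| ≤ 1 :=
      abs_le.2 ⟨by nlinarith [sq_nonneg (2 * s - 1)], by nlinarith⟩
    have h2 : |-6 * s + 3 + 2 * (1 / m)| ≤ 4 := abs_le.2 ⟨by linarith, by linarith⟩
    have := mul_le_mul d2 h1 (abs_nonneg _) im0.le
    have h3 := mul_le_mul bκ (mul_le_mul_of_nonneg_right h2 im0.le) (by positivity) (by norm_num)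
    linarith
  have := abs_add_mul_add_mul_le (y := y) hp hq
  have e : gramPoly m y j - legendrePoly y s = y 1 * ((μ - √3) * (2 * s - 1) - μ * (1 / m)) +
      y 2 * ((κ - √5) * (6 * s ^ 2 - 6 * s + 1) + κ * ((-6 * s + 3 + 2 * (1 / m)) * (1 / m))) := by
    rw [gramPoly, legendrePoly, hjs, hμ, hκ]
    field_simp
    ring
  rw [e]
  refine this.trans (le_of_eq ?_)
  ring

/-! ### Third and fourth moments, and the sparse regime -/

/-- The integral over `[0, 1]` of the cube of `legendrePoly y`. -/
noncomputable def cubicMoment (y : Fin 3 → ℝ) : ℝ :=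
  y 0 ^ 3 + y 0 * (√3 * y 1) ^ 2 + 3 / 5 * (y 0 * (√5 * y 2) ^ 2)
    + 2 / 5 * ((√3 * y 1) ^ 2 * (√5 * y 2)) + 2 / 35 * (√5 * y 2) ^ 3

/-- The integral over `[0, 1]` of the fourth power of `legendrePoly y`. -/
noncomputable def quarticMoment (y : Fin 3 → ℝ) : ℝ :=
  y 0 ^ 4 + 2 * (y 0 ^ 2 * (√3 * y 1) ^ 2) + 6 / 5 * (y 0 ^ 2 * (√5 * y 2) ^ 2)
    + 8 / 5 * (y 0 * (√3 * y 1) ^ 2 * (√5 * y 2)) + 8 / 35 * (y 0 * (√5 * y 2) ^ 3)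
    + 1 / 5 * (√3 * y 1) ^ 4 + 22 / 35 * ((√3 * y 1) ^ 2 * (√5 * y 2) ^ 2)
    + 3 / 35 * (√5 * y 2) ^ 4

theorem hasDerivAt_sum_pow {n : ℕ} (c : Fin n → ℝ) (s : ℝ) :
    HasDerivAt (fun s : ℝ => ∑ i, c i / ((i : ℕ) + 1) * s ^ ((i : ℕ) + 1))
      (∑ i, c i * s ^ (i : ℕ)) s := by
  refine HasDerivAt.fun_sum fun i _ => ?_
  have := (hasDerivAt_pow ((i : ℕ) + 1) s).const_mul (c i / ((i : ℕ) + 1))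
  refine this.congr_deriv ?_
  have h : ((i : ℕ) + 1 : ℝ) ≠ 0 := by positivity
  push_cast
  field_simp

theorem exists_primitive_legendrePoly_cube (y : Fin 3 → ℝ) :
    ∃ F : ℝ → ℝ, (∀ s, HasDerivAt F (legendrePoly y s ^ 3) s) ∧ F 1 - F 0 = cubicMoment y := by
  -- `legendrePoly y s = a + b s + c s²`
  set a := y 0 - √3 * y 1 + √5 * y 2 with ha
  set b := 2 * (√3 * y 1) - 6 * (√5 * y 2) with hb
  set c := 6 * (√5 * y 2) with hc
  refine ⟨_, fun s => (hasDerivAt_sum_pow ![a ^ 3, 3 * a ^ 2 * b, 3 * a ^ 2 * c + 3 * a * b ^ 2,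
    6 * a * b * c + b ^ 3, 3 * a * c ^ 2 + 3 * b ^ 2 * c, 3 * b * c ^ 2, c ^ 3] s).congr_deriv ?_, ?_⟩
  · simp [Fin.sum_univ_succ, legendrePoly, ha, hb, hc]
    ring
  · simp [Fin.sum_univ_succ, cubicMoment, ha, hb, hc]
    ring

theorem exists_primitive_legendrePoly_pow_four (y : Fin 3 → ℝ) :
    ∃ F : ℝ → ℝ, (∀ s, HasDerivAt F (legendrePoly y s ^ 4) s) ∧ F 1 - F 0 = quarticMoment y := by
  -- `legendrePoly y s = a + b s + c s²`
  set a := y 0 - √3 * y 1 + √5 * y 2 with ha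
  set b := 2 * (√3 * y 1) - 6 * (√5 * y 2) with hb
  set c := 6 * (√5 * y 2) with hc
  refine ⟨_, fun s => (hasDerivAt_sum_pow ![a ^ 4, 4 * a ^ 3 * b, 4 * a ^ 3 * c + 6 * a ^ 2 * b ^ 2,
    12 * a ^ 2 * b * c + 4 * a * b ^ 3, 6 * a ^ 2 * c ^ 2 + 12 * a * b ^ 2 * c + b ^ 4,
    12 * a * b * c ^ 2 + 4 * b ^ 3 * c, 4 * a * c ^ 3 + 6 * b ^ 2 * c ^ 2, 4 * b * c ^ 3,
    c ^ 4] s).congr_deriv ?_, ?_⟩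
  · simp [Fin.sum_univ_succ, legendrePoly, ha, hb, hc]
    ring
  · simp [Fin.sum_univ_succ, quarticMoment, ha, hb, hc]
    ring

theorem abs_gramPoly_le {m : ℕ} (hm : 64 ≤ m) (y : Fin 3 → ℝ) {j : ℕ} (hj : j ∈ Finset.Icc 1 m) :
    |gramPoly m y j| ≤ 7 * regNorm y := by
  have hmR : (64 : ℝ) ≤ m := by exact_mod_cast hm
  have h1 := abs_gramPoly_sub_legendrePoly_le hm y hj
  rw [Finset.mem_Icc] at hj
  have hjm : (j : ℝ) ≤ m := by exact_mod_cast hj.2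
  have h2 := abs_legendrePoly_le y (s := j / m) ⟨by positivity, div_le_one_of_le₀ hjm (by linarith)⟩
  have h3 : 22 * regNorm y / m ≤ regNorm y := by
    rw [div_le_iff₀ (by linarith)]
    nlinarith [one_le_regNorm y]
  have := abs_add_le (gramPoly m y j - legendrePoly y (j / m)) (legendrePoly y (j / m))
  rw [sub_add_cancel] at this
  linarith

theorem abs_pow_sub_pow_le_of_abs_le {x y H : ℝ} (hx : |x| ≤ H) (hy : |y| ≤ H) (n : ℕ) :
    |x ^ n - y ^ n| ≤ |x - y| * n * H ^ (n - 1) := by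
  refine (abs_pow_sub_pow_le x y n).trans ?_
  have : 0 ≤ max |x| |y| := (abs_nonneg x).trans (le_max_left _ _)
  gcongr
  exact max_le hx hy

/-- The power means of the Gram polynomials converge at rate `1 / m` to the integrals of the powers
of the Legendre polynomials. -/
theorem abs_sum_gramPoly_pow_sub_le {m : ℕ} (hm : 64 ≤ m) (y : Fin 3 → ℝ) (k : ℕ) {F : ℝ → ℝ}
    (hF : ∀ s, HasDerivAt F (legendrePoly y s ^ (k + 1)) s) :
    |(∑ j ∈ Finset.Icc 1 m, gramPoly m y j ^ (k + 1)) / m - (F 1 - F 0)|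
      ≤ 44 * (k + 1) * 7 ^ k * regNorm y ^ (k + 1) / m := by
  have hmR : (64 : ℝ) ≤ m := by exact_mod_cast hm
  have hm0 : (0 : ℝ) < m := by linarith
  have hr := one_le_regNorm y
  have h7 : ∀ s ∈ Set.Icc (0 : ℝ) 1, |legendrePoly y s| ≤ 7 * regNorm y := fun s hs =>
    (abs_legendrePoly_le y hs).trans (by linarith)
  have h1 := abs_riemannSum_sub_le hF (L := 22 * (k + 1) * 7 ^ k * regNorm y ^ (k + 1))
    (fun s hs t ht => by
      refine (abs_pow_sub_pow_le_of_abs_le (h7 s hs) (h7 t ht) _).trans ?_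
      have := abs_legendrePoly_sub_le y hs ht
      calc _ ≤ (22 * regNorm y * |s - t|) * ((k + 1 : ℕ) : ℝ) * (7 * regNorm y) ^ (k + 1 - 1) := by
            gcongr
        _ = _ := by rw [Nat.add_sub_cancel]; push_cast; ring) (m := m) (by omega)
  have h2 : |(∑ j ∈ Finset.Icc 1 m, gramPoly m y j ^ (k + 1)) / m -
      (∑ j ∈ Finset.Icc 1 m, legendrePoly y (j / m) ^ (k + 1)) / m|
      ≤ 22 * (k + 1) * 7 ^ k * regNorm y ^ (k + 1) / m := by
    rw [← sub_div, ← Finset.sum_sub_distrib, abs_div, abs_of_pos hm0]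
    gcongr
    have term : ∀ j ∈ Finset.Icc 1 m,
        |gramPoly m y j ^ (k + 1) - legendrePoly y (j / m) ^ (k + 1)|
        ≤ 22 * (k + 1) * 7 ^ k * regNorm y ^ (k + 1) / m := by
      intro j hj
      have hj' := Finset.mem_Icc.1 hj
      have hjm : (j : ℝ) ≤ m := by exact_mod_cast hj'.2
      refine (abs_pow_sub_pow_le_of_abs_le (abs_gramPoly_le hm y hj)
        (h7 (j / m) ⟨by positivity, div_le_one_of_le₀ hjm (by linarith)⟩) _).trans ?_
      have := abs_gramPoly_sub_legendrePoly_le hm y hj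
      calc _ ≤ (22 * regNorm y / m) * ((k + 1 : ℕ) : ℝ) * (7 * regNorm y) ^ (k + 1 - 1) := by
            gcongr
        _ = _ := by rw [Nat.add_sub_cancel]; push_cast; ring
    refine (Finset.abs_sum_le_sum_abs _ _).trans ((Finset.sum_le_sum term).trans ?_)
    rw [Finset.sum_const, Nat.card_Icc, Nat.add_sub_cancel, nsmul_eq_mul]
    apply le_of_eq
    field_simp
  have e := abs_sub_le ((∑ j ∈ Finset.Icc 1 m, gramPoly m y j ^ (k + 1)) / m)
    ((∑ j ∈ Finset.Icc 1 m, legendrePoly y (j / m) ^ (k + 1)) / m) (F 1 - F 0)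
  refine e.trans ((add_le_add h2 h1).trans (le_of_eq ?_))
  ring

theorem abs_sum_gramPoly_pow_le {m : ℕ} (hm : 64 ≤ m) (y : Fin 3 → ℝ) (k : ℕ) :
    |(∑ j ∈ Finset.Icc 1 m, gramPoly m y j ^ k) / m| ≤ 7 ^ k * regNorm y ^ k := by
  have hm0 : (0 : ℝ) < m := by exact_mod_cast (by omega : 0 < m)
  rw [abs_div, abs_of_pos hm0, div_le_iff₀ hm0]
  refine (Finset.abs_sum_le_sum_abs _ _).trans ?_
  calc _ ≤ ∑ j ∈ Finset.Icc 1 m, (7 * regNorm y) ^ k := Finset.sum_le_sum fun j hj => by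
        rw [abs_pow]
        exact pow_le_pow_left₀ (abs_nonneg _) (abs_gramPoly_le hm y hj) k
    _ = _ := by
        rw [Finset.sum_const, Nat.card_Icc, Nat.add_sub_cancel, nsmul_eq_mul]; ring

theorem abs_sum_gramPoly_cube_sub_le {m : ℕ} (hm : 64 ≤ m) (y : Fin 3 → ℝ) :
    |(∑ j ∈ Finset.Icc 1 m, gramPoly m y j ^ 3) / m - cubicMoment y| ≤ 6468 * regNorm y ^ 3 / m := by
  obtain ⟨F, hF, he⟩ := exists_primitive_legendrePoly_cube y
  have := abs_sum_gramPoly_pow_sub_le hm y 2 hF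
  norm_num [he] at this
  exact this

theorem abs_sum_gramPoly_pow_four_sub_le {m : ℕ} (hm : 64 ≤ m) (y : Fin 3 → ℝ) :
    |(∑ j ∈ Finset.Icc 1 m, gramPoly m y j ^ 4) / m - quarticMoment y|
      ≤ 60368 * regNorm y ^ 4 / m := by
  obtain ⟨F, hF, he⟩ := exists_primitive_legendrePoly_pow_four y
  have := abs_sum_gramPoly_pow_sub_le hm y 3 hF
  norm_num [he] at this
  exact this

theorem abs_cubicMoment_le (y : Fin 3 → ℝ) : |cubicMoment y| ≤ 450 * regNorm y ^ 3 := by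
  -- a bound for the moment follows from any single instance of the comparison, here `m = 64`
  have h1 := abs_sum_gramPoly_cube_sub_le le_rfl y
  have h2 := abs_sum_gramPoly_pow_le le_rfl y 3
  rw [abs_sub_comm] at h1
  have := abs_sub_abs_le_abs_sub (cubicMoment y) ((∑ j ∈ Finset.Icc 1 64, gramPoly 64 y j ^ 3) / (64 : ℕ))
  have : 0 ≤ regNorm y ^ 3 := pow_nonneg (Real.sqrt_nonneg _) 3
  push_cast at *
  linarith

theorem abs_quarticMoment_le (y : Fin 3 → ℝ) : |quarticMoment y| ≤ 3400 * regNorm y ^ 4 := by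
  have h1 := abs_sum_gramPoly_pow_four_sub_le le_rfl y
  have h2 := abs_sum_gramPoly_pow_le le_rfl y 4
  rw [abs_sub_comm] at h1
  have := abs_sub_abs_le_abs_sub (quarticMoment y) ((∑ j ∈ Finset.Icc 1 64, gramPoly 64 y j ^ 4) / (64 : ℕ))
  have : 0 ≤ regNorm y ^ 4 := pow_nonneg (Real.sqrt_nonneg _) 4
  push_cast at *
  linarith

/-- The Edgeworth correction polynomial: `1 / N` times it is the leading correction to the Gaussian
form of the characteristic function. -/
noncomputable def edgeworthPoly (y : Fin 3 → ℝ) : ℝ :=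
  quarticMoment y / 24 - cubicMoment y ^ 2 / 72

theorem abs_edgeworthPoly_le (y : Fin 3 → ℝ) : |edgeworthPoly y| ≤ 3000 * regNorm y ^ 6 := by
  have h3 := abs_cubicMoment_le y
  have h4 := abs_quarticMoment_le y
  have hr := one_le_regNorm y
  have h46 : regNorm y ^ 4 ≤ regNorm y ^ 6 := pow_le_pow_right₀ hr (by norm_num)
  have hc : cubicMoment y ^ 2 ≤ (450 * regNorm y ^ 3) ^ 2 := by
    rw [← sq_abs]; gcongr
  have e : (450 * regNorm y ^ 3) ^ 2 = 202500 * regNorm y ^ 6 := by ring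
  rw [e] at hc
  have := abs_sub (quarticMoment y / 24) (cubicMoment y ^ 2 / 72)
  rw [abs_div, abs_of_nonneg (by positivity : 0 ≤ cubicMoment y ^ 2 / 72),
    abs_of_pos (by norm_num : (0 : ℝ) < 24)] at this
  rw [edgeworthPoly]
  have : 0 ≤ regNorm y ^ 6 := by positivity
  linarith

/-- The regime of the expansion: `m` indices are each selected with probability `β`, the expected
number of selected indices is `n ^ 2`, and `β` is at most its inverse. -/
structure SparseRegime (m : ℕ) (β n : ℝ) : Prop where
  eight_le : 8 ≤ n
  mean_eq : m * β = n ^ 2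
  prob_pos : 0 < β
  prob_le : β ≤ 1 / n ^ 2

namespace SparseRegime

variable {m : ℕ} {β n : ℝ}

theorem pos (h : SparseRegime m β n) : 0 < n := by linarith [h.eight_le]

theorem sq_ge (h : SparseRegime m β n) : 64 ≤ n ^ 2 := by nlinarith [h.eight_le]

theorem prob_le' (h : SparseRegime m β n) : β ≤ 1 / 64 :=
  h.prob_le.trans (one_div_le_one_div_of_le (by norm_num) h.sq_ge)

theorem sq_le (h : SparseRegime m β n) : n ^ 2 ≤ m := by
  have h1 := h.mean_eq
  have h2 := h.prob_le'
  have h3 : (0 : ℝ) ≤ m := by positivity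
  nlinarith

theorem le_card (h : SparseRegime m β n) : 64 ≤ m := by
  have := h.sq_ge.trans h.sq_le
  exact_mod_cast this

theorem countDev_sq (h : SparseRegime m β n) : countDev m β ^ 2 = n ^ 2 * (1 - β) := by
  rw [_root_.countDev_sq h.prob_pos.le (by linarith [h.prob_le']), ← h.mean_eq]; ring

theorem countDev_pos (h : SparseRegime m β n) : 0 < countDev m β :=
  _root_.countDev_pos (by have := h.le_card; omega) h.prob_pos (by linarith [h.prob_le'])

theorem inv_countDev_le (h : SparseRegime m β n) : (countDev m β)⁻¹ ≤ 8 / 7 / n := by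
  have h1 := h.countDev_sq
  have h2 := h.countDev_pos
  have h3 := h.pos
  have h4 : 7 / 8 * n ≤ countDev m β := by
    refine le_of_sq_le_sq ?_ h2.le
    rw [h1]
    nlinarith [h.prob_le', sq_nonneg n]
  calc (countDev m β)⁻¹ ≤ (7 / 8 * n)⁻¹ := by gcongr
    _ = _ := by field_simp

theorem abs_phase_le (h : SparseRegime m β n) (y : Fin 3 → ℝ) {j : ℕ} (hj : j ∈ Finset.Icc 1 m) :
    |gramPoly m y j / countDev m β| ≤ 8 * regNorm y / n := by
  have h0 := h.countDev_pos
  have h1 := abs_gramPoly_le h.le_card y hj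
  have h2 := h.inv_countDev_le
  have hr := one_le_regNorm y
  rw [abs_div, abs_of_pos h0, div_eq_mul_inv]
  calc _ ≤ (7 * regNorm y) * (8 / 7 / n) := by gcongr
    _ = _ := by ring

theorem sum_abs_pow_le (h : SparseRegime m β n) (y : Fin 3 → ℝ) (k : ℕ) :
    β * ∑ j ∈ Finset.Icc 1 m, |gramPoly m y j / countDev m β| ^ k
      ≤ n ^ 2 * (8 * regNorm y / n) ^ k := by
  have hb := h.prob_pos
  calc _ ≤ β * ∑ j ∈ Finset.Icc 1 m, (8 * regNorm y / n) ^ k := by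
        gcongr with j hj
        exact h.abs_phase_le y hj
    _ = _ := by
        rw [Finset.sum_const, Nat.card_Icc, Nat.add_sub_cancel, nsmul_eq_mul, ← h.mean_eq]; ring

theorem sum_sq (h : SparseRegime m β n) (y : Fin 3 → ℝ) :
    β * (1 - β) * ∑ j ∈ Finset.Icc 1 m, (gramPoly m y j / countDev m β) ^ 2 = ∑ a, y a ^ 2 := by
  simp_rw [div_pow]
  rw [← Finset.sum_div, sum_gramPoly_sq (by have := h.le_card; omega), h.countDev_sq, ← h.mean_eq]
  have h1 := h.prob_pos
  have h2 := h.prob_le'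
  have h3 := h.le_card
  have h4 : (m : ℝ) ≠ 0 := by positivity
  have h5 : 1 - β ≠ 0 := by linarith
  field_simp

end SparseRegime

/-! ### Expansion of the cumulants -/

namespace SparseRegime

variable {m : ℕ} {β n : ℝ}

/-- The even part of the cumulant expansion. -/
theorem sum_re_bernoulliLog (h : SparseRegime m β n) (y : Fin 3 → ℝ)
    (hu : ∀ j ∈ Finset.Icc 1 m, |gramPoly m y j / countDev m β| ≤ 1 / 4) :
    |∑ j ∈ Finset.Icc 1 m, (bernoulliLog β (gramPoly m y j / countDev m β)).re + (∑ a, y a ^ 2) / 2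
      - β * (∑ j ∈ Finset.Icc 1 m, (gramPoly m y j / countDev m β) ^ 4) / 24|
      ≤ 10 ^ 6 * regNorm y ^ 6 / n ^ 4 := by
  have h0 := h.pos
  have hb := h.prob_pos
  have hb' := h.prob_le'
  have hr := one_le_regNorm y
  have h4 := h.sum_abs_pow_le y 4
  have h6 := h.sum_abs_pow_le y 6
  have h3 := h.sum_abs_pow_le y 3
  have hbn : β ≤ 1 / n ^ 2 := h.prob_le
  set u : ℕ → ℝ := fun j => gramPoly m y j / countDev m β with hudef
  set r := regNorm y
  have e : ∑ j ∈ Finset.Icc 1 m, (bernoulliLog β (u j)).re + (∑ a, y a ^ 2) / 2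
      - β * (∑ j ∈ Finset.Icc 1 m, (u j) ^ 4) / 24
      = ∑ j ∈ Finset.Icc 1 m, ((bernoulliLog β (u j)).re + β * (1 - β) * u j ^ 2 / 2
        - β * u j ^ 4 / 24) := by
    rw [← h.sum_sq y, Finset.sum_sub_distrib, Finset.sum_add_distrib, ← Finset.sum_div,
      ← Finset.sum_div, ← Finset.mul_sum, ← Finset.mul_sum]
  have key : |∑ j ∈ Finset.Icc 1 m, ((bernoulliLog β (u j)).re + β * (1 - β) * u j ^ 2 / 2
        - β * u j ^ 4 / 24)| ≤ β * ∑ j ∈ Finset.Icc 1 m, |u j| ^ 6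
        + 2 * β * (β * ∑ j ∈ Finset.Icc 1 m, |u j| ^ 4)
        + β ^ 2 * (β * ∑ j ∈ Finset.Icc 1 m, |u j| ^ 3) := by
    refine (Finset.abs_sum_le_sum_abs _ _).trans ?_
    rw [Finset.mul_sum, Finset.mul_sum, Finset.mul_sum, Finset.mul_sum, Finset.mul_sum,
      ← Finset.sum_add_distrib, ← Finset.sum_add_distrib]
    refine Finset.sum_le_sum fun j hj => ?_
    refine (abs_re_bernoulliLog_le hb.le (by linarith) ((hu j hj).trans (by norm_num))).trans ?_
    change β * u j ^ 6 + 2 * β ^ 2 * u j ^ 4 + β ^ 3 * |u j| ^ 3 ≤ _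
    rw [Even.pow_abs (by decide : Even 6) (u j), Even.pow_abs (by decide : Even 4) (u j)]
    apply le_of_eq; ring
  have key' : |∑ j ∈ Finset.Icc 1 m, (bernoulliLog β (u j)).re + (∑ a, y a ^ 2) / 2
      - β * (∑ j ∈ Finset.Icc 1 m, (u j) ^ 4) / 24| ≤ _ := e ▸ key
  refine key'.trans ?_
  have r4 : r ^ 4 ≤ r ^ 6 := pow_le_pow_right₀ hr (by norm_num)
  have r3 : r ^ 3 ≤ r ^ 6 := pow_le_pow_right₀ hr (by norm_num)
  have f6 : n ^ 2 * (8 * r / n) ^ 6 = 262144 * r ^ 6 / n ^ 4 := by field_simp; norm_num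
  have f4 : 2 * β * (n ^ 2 * (8 * r / n) ^ 4) ≤ 8192 * r ^ 6 / n ^ 4 := by
    calc _ ≤ 2 * (1 / n ^ 2) * (n ^ 2 * (8 * r / n) ^ 4) := by gcongr
      _ = 8192 * r ^ 4 / n ^ 4 := by field_simp; norm_num
      _ ≤ _ := by gcongr
  have f3 : β ^ 2 * (n ^ 2 * (8 * r / n) ^ 3) ≤ 512 * r ^ 6 / n ^ 4 := by
    calc _ ≤ (1 / n ^ 2) ^ 2 * (n ^ 2 * (8 * r / n) ^ 3) := by gcongr
      _ = 512 * r ^ 3 / n ^ 4 / n := by field_simp; norm_num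
      _ ≤ 512 * r ^ 3 / n ^ 4 := div_le_self (by positivity) (by linarith [h.eight_le])
      _ ≤ _ := by gcongr
  have g4 := mul_le_mul_of_nonneg_left h4 (by positivity : 0 ≤ 2 * β)
  have g3 := mul_le_mul_of_nonneg_left h3 (by positivity : 0 ≤ β ^ 2)
  have : 0 ≤ r ^ 6 / n ^ 4 := by positivity
  rw [f6] at h6
  simp only [mul_div_assoc] at *
  linarith

/-- The odd part of the cumulant expansion.  Only its leading term is needed, as it enters the real
part of the characteristic function through its square. -/
theorem sum_im_bernoulliLog (h : SparseRegime m β n) (y : Fin 3 → ℝ)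
    (hu : ∀ j ∈ Finset.Icc 1 m, |gramPoly m y j / countDev m β| ≤ 1 / 4) :
    |∑ j ∈ Finset.Icc 1 m, (bernoulliLog β (gramPoly m y j / countDev m β)).im
      - -(β * (∑ j ∈ Finset.Icc 1 m, (gramPoly m y j / countDev m β) ^ 3) / 6)|
      ≤ 10 ^ 6 * regNorm y ^ 6 / n ^ 3 := by
  have h0 := h.pos
  have hb := h.prob_pos
  have hb' := h.prob_le'
  have hr := one_le_regNorm y
  have h5 := h.sum_abs_pow_le y 5
  have h3 := h.sum_abs_pow_le y 3
  have hbn : β ≤ 1 / n ^ 2 := h.prob_le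
  set u : ℕ → ℝ := fun j => gramPoly m y j / countDev m β with hudef
  set r := regNorm y
  have e : ∑ j ∈ Finset.Icc 1 m, (bernoulliLog β (u j)).im
      - -(β * (∑ j ∈ Finset.Icc 1 m, (u j) ^ 3) / 6)
      = ∑ j ∈ Finset.Icc 1 m, ((bernoulliLog β (u j)).im + β * u j ^ 3 / 6) := by
    rw [sub_neg_eq_add, Finset.sum_add_distrib, ← Finset.sum_div, ← Finset.mul_sum]
  have key : |∑ j ∈ Finset.Icc 1 m, ((bernoulliLog β (u j)).im + β * u j ^ 3 / 6)|
      ≤ β * ∑ j ∈ Finset.Icc 1 m, |u j| ^ 5 + 2 * β * (β * ∑ j ∈ Finset.Icc 1 m, |u j| ^ 3) := by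
    refine (Finset.abs_sum_le_sum_abs _ _).trans ?_
    rw [Finset.mul_sum, Finset.mul_sum, Finset.mul_sum, ← Finset.sum_add_distrib]
    refine Finset.sum_le_sum fun j hj => ?_
    refine (abs_im_bernoulliLog_le hb.le (by linarith) ((hu j hj).trans (by norm_num))).trans ?_
    apply le_of_eq; ring
  have key' : |∑ j ∈ Finset.Icc 1 m, (bernoulliLog β (u j)).im
      - -(β * (∑ j ∈ Finset.Icc 1 m, (u j) ^ 3) / 6)| ≤ _ := e ▸ key
  refine key'.trans ?_
  have r5 : r ^ 5 ≤ r ^ 6 := pow_le_pow_right₀ hr (by norm_num)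
  have r3 : r ^ 3 ≤ r ^ 6 := pow_le_pow_right₀ hr (by norm_num)
  have f5 : n ^ 2 * (8 * r / n) ^ 5 ≤ 32768 * r ^ 6 / n ^ 3 := by
    calc _ = 32768 * r ^ 5 / n ^ 3 := by field_simp; norm_num
      _ ≤ _ := by gcongr
  have f3 : 2 * β * (n ^ 2 * (8 * r / n) ^ 3) ≤ 1024 * r ^ 6 / n ^ 3 := by
    calc _ ≤ 2 * (1 / n ^ 2) * (n ^ 2 * (8 * r / n) ^ 3) := by gcongr
      _ = 1024 * r ^ 3 / n ^ 3 := by field_simp; norm_num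
      _ ≤ _ := by gcongr
  have g3 := mul_le_mul_of_nonneg_left h3 (by positivity : 0 ≤ 2 * β)
  have : 0 ≤ r ^ 6 / n ^ 3 := by positivity
  simp only [mul_div_assoc] at *
  linarith

/-- On the central region the modulus of the characteristic function is at most `exp (-|y|² / 4)`;
this is the domination needed to integrate the expansion. -/
theorem abs_sum_re_add_le (h : SparseRegime m β n) (y : Fin 3 → ℝ)
    (hu : ∀ j ∈ Finset.Icc 1 m, |gramPoly m y j / countDev m β| ≤ 1 / 4) :
    |∑ j ∈ Finset.Icc 1 m, (bernoulliLog β (gramPoly m y j / countDev m β)).re + (∑ a, y a ^ 2) / 2|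
      ≤ (∑ a, y a ^ 2) / 4 := by
  have hb := h.prob_pos
  have hb' := h.prob_le'
  rw [← h.sum_sq y, Finset.mul_sum, Finset.sum_div, ← Finset.sum_add_distrib, Finset.sum_div]
  refine (Finset.abs_sum_le_sum_abs _ _).trans (Finset.sum_le_sum fun j hj => ?_)
  have hj := hu j hj
  set u := gramPoly m y j / countDev m β
  have h1 := abs_re_bernoulliLog_le hb.le (by linarith) (hj.trans (by norm_num))
  have e : (bernoulliLog β u).re + β * (1 - β) * u ^ 2 / 2 =
    ((bernoulliLog β u).re + β * (1 - β) * u ^ 2 / 2 - β * u ^ 4 / 24) + β * u ^ 4 / 24 := by ring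
  rw [e]
  refine (abs_add_le _ _).trans ?_
  rw [abs_of_nonneg (by positivity : 0 ≤ β * u ^ 4 / 24)]
  have u0 := abs_nonneg u
  have u2 : u ^ 2 ≤ 1 / 16 := by rw [← sq_abs]; nlinarith
  have hU : 0 ≤ β * u ^ 2 := by positivity
  have a4 : β * u ^ 4 ≤ β * u ^ 2 * (1 / 16) := by
    calc β * u ^ 4 = β * u ^ 2 * u ^ 2 := by ring
      _ ≤ _ := by gcongr
  have a6 : β * u ^ 6 ≤ β * u ^ 2 * (1 / 16) := by
    calc β * u ^ 6 = β * u ^ 2 * (u ^ 2 * u ^ 2) := by ring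
      _ ≤ _ := by gcongr; nlinarith [sq_nonneg u]
  have b4 : β ^ 2 * u ^ 4 ≤ β * u ^ 2 * (1 / 64) := by
    calc β ^ 2 * u ^ 4 = β * u ^ 2 * (β * u ^ 2) := by ring
      _ ≤ _ := by gcongr; nlinarith [sq_nonneg u]
  have b3 : β ^ 3 * |u| ^ 3 ≤ β * u ^ 2 * (1 / 64) := by
    calc β ^ 3 * |u| ^ 3 = β * |u| ^ 2 * (β ^ 2 * |u|) := by ring
      _ = β * u ^ 2 * (β ^ 2 * |u|) := by rw [sq_abs]
      _ ≤ _ := by gcongr; nlinarith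
  have c : β * (1 - β) * u ^ 2 ≥ β * u ^ 2 * (3 / 4) := by nlinarith
  linarith

theorem abs_quartic_sub_le (h : SparseRegime m β n) (y : Fin 3 → ℝ) :
    |β * (∑ j ∈ Finset.Icc 1 m, (gramPoly m y j / countDev m β) ^ 4) - quarticMoment y / n ^ 2|
      ≤ 10 ^ 5 * regNorm y ^ 4 / n ^ 4 := by
  have h0 := h.pos
  have hb := h.prob_pos
  have hb' := h.prob_le'
  have hbn : β ≤ 1 / n ^ 2 := h.prob_le
  have hr := one_le_regNorm y
  have hm : (0 : ℝ) < m := by have := h.le_card; positivity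
  have h1 := abs_sum_gramPoly_pow_four_sub_le h.le_card y
  have h2 := abs_sum_gramPoly_pow_le h.le_card y 4
  set M := (∑ j ∈ Finset.Icc 1 m, gramPoly m y j ^ 4) / m with hM
  have hq : 0 < 1 - β := by linarith
  have e : β * (∑ j ∈ Finset.Icc 1 m, (gramPoly m y j / countDev m β) ^ 4)
      - quarticMoment y / n ^ 2
      = (M * (1 / (1 - β) ^ 2 - 1) + (M - quarticMoment y)) / n ^ 2 := by
    have : ∑ j ∈ Finset.Icc 1 m, gramPoly m y j ^ 4 = m * M := by rw [hM]; field_simp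
    simp_rw [div_pow]
    rw [← Finset.sum_div, this, show countDev m β ^ 4 = (countDev m β ^ 2) ^ 2 by ring,
      h.countDev_sq]
    have hme := h.mean_eq
    field_simp
    linear_combination M * hme
  have hq1 : |1 / (1 - β) ^ 2 - 1| ≤ 4 / n ^ 2 := by
    have : 1 / (1 - β) ^ 2 - 1 = β * (2 - β) / (1 - β) ^ 2 := by field_simp; ring
    rw [this, abs_of_nonneg (div_nonneg (mul_nonneg hb.le (by linarith)) (by positivity))]
    calc β * (2 - β) / (1 - β) ^ 2 ≤ 4 * β := by
          rw [div_le_iff₀ (by positivity), mul_comm 4 β, mul_assoc]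
          gcongr
          nlinarith [sq_nonneg β]
      _ ≤ 4 * (1 / n ^ 2) := by gcongr
      _ = _ := by ring
  have h1' : |M - quarticMoment y| ≤ 60368 * regNorm y ^ 4 / n ^ 2 := by
    refine h1.trans ?_
    gcongr
    exact h.sq_le
  rw [e, abs_div, abs_of_pos (by positivity : 0 < n ^ 2), div_le_iff₀ (by positivity)]
  refine (abs_add_le _ _).trans ?_
  rw [abs_mul]
  have := mul_le_mul h2 hq1 (abs_nonneg _) (by positivity)
  have e2 : 10 ^ 5 * regNorm y ^ 4 / n ^ 4 * n ^ 2 = 10 ^ 5 * (regNorm y ^ 4 / n ^ 2) := by field_simp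
  rw [e2]
  have : 0 ≤ regNorm y ^ 4 / n ^ 2 := by positivity
  calc _ ≤ 7 ^ 4 * regNorm y ^ 4 * (4 / n ^ 2) + 60368 * regNorm y ^ 4 / n ^ 2 := by linarith
    _ = 69972 * (regNorm y ^ 4 / n ^ 2) := by ring
    _ ≤ _ := by linarith

theorem abs_cubic_sq_sub_le (h : SparseRegime m β n) (y : Fin 3 → ℝ) :
    |(β * (∑ j ∈ Finset.Icc 1 m, (gramPoly m y j / countDev m β) ^ 3)) ^ 2
      - cubicMoment y ^ 2 / n ^ 2| ≤ 10 ^ 7 * regNorm y ^ 6 / n ^ 4 := by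
  have h0 := h.pos
  have hb := h.prob_pos
  have hb' := h.prob_le'
  have hbn : β ≤ 1 / n ^ 2 := h.prob_le
  have hr := one_le_regNorm y
  have hm : (0 : ℝ) < m := by have := h.le_card; positivity
  have h1 := abs_sum_gramPoly_cube_sub_le h.le_card y
  have h2 := abs_sum_gramPoly_pow_le h.le_card y 3
  have h3 := abs_cubicMoment_le y
  set M := (∑ j ∈ Finset.Icc 1 m, gramPoly m y j ^ 3) / m with hM
  have hq : 0 < 1 - β := by linarith
  have e : (β * (∑ j ∈ Finset.Icc 1 m, (gramPoly m y j / countDev m β) ^ 3)) ^ 2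
      - cubicMoment y ^ 2 / n ^ 2
      = (M ^ 2 * (1 / (1 - β) ^ 3 - 1) + (M - cubicMoment y) * (M + cubicMoment y)) / n ^ 2 := by
    have : ∑ j ∈ Finset.Icc 1 m, gramPoly m y j ^ 3 = m * M := by rw [hM]; field_simp
    simp_rw [div_pow]
    rw [← Finset.sum_div, this]
    have e1 : (β * (m * M / countDev m β ^ 3)) ^ 2 = (m * β) ^ 2 * M ^ 2 / (countDev m β ^ 2) ^ 3 := by
      ring
    rw [e1, h.countDev_sq, h.mean_eq]
    field_simp
    ring
  have hq1 : |1 / (1 - β) ^ 3 - 1| ≤ 4 / n ^ 2 := by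
    have : 1 / (1 - β) ^ 3 - 1 = β * (3 - 3 * β + β ^ 2) / (1 - β) ^ 3 := by field_simp; ring
    rw [this, abs_of_nonneg (div_nonneg (mul_nonneg hb.le (by nlinarith)) (by positivity))]
    calc β * (3 - 3 * β + β ^ 2) / (1 - β) ^ 3 ≤ 4 * β := by
          rw [div_le_iff₀ (by positivity), mul_comm 4 β, mul_assoc]
          gcongr
          nlinarith [mul_pos hb hb, mul_pos hb (mul_pos hb hb)]
      _ ≤ 4 * (1 / n ^ 2) := by gcongr
      _ = _ := by ring
  have h1' : |M - cubicMoment y| ≤ 6468 * regNorm y ^ 3 / n ^ 2 := by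
    refine h1.trans ?_
    gcongr
    exact h.sq_le
  have h5 : |M + cubicMoment y| ≤ 800 * regNorm y ^ 3 := by
    refine (abs_add_le _ _).trans ?_
    have : 0 ≤ regNorm y ^ 3 := by positivity
    linarith
  have h6 : M ^ 2 ≤ (7 ^ 3 * regNorm y ^ 3) ^ 2 := by rw [← sq_abs]; gcongr
  rw [e, abs_div, abs_of_pos (by positivity : 0 < n ^ 2), div_le_iff₀ (by positivity)]
  refine (abs_add_le _ _).trans ?_
  rw [abs_mul, abs_mul, abs_of_nonneg (sq_nonneg M)]
  have g1 := mul_le_mul h6 hq1 (abs_nonneg _) (by positivity)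
  have g2 := mul_le_mul h1' h5 (abs_nonneg _) (by positivity)
  have e2 : 10 ^ 7 * regNorm y ^ 6 / n ^ 4 * n ^ 2 = 10 ^ 7 * (regNorm y ^ 6 / n ^ 2) := by field_simp
  rw [e2]
  have : 0 ≤ regNorm y ^ 6 / n ^ 2 := by positivity
  calc _ ≤ (7 ^ 3 * regNorm y ^ 3) ^ 2 * (4 / n ^ 2)
        + 6468 * regNorm y ^ 3 / n ^ 2 * (800 * regNorm y ^ 3) := by linarith
    _ = 5644996 * (regNorm y ^ 6 / n ^ 2) := by ring
    _ ≤ _ := by linarith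

end SparseRegime

/-! ### Expansion of the characteristic function near the zero frequency -/

theorem pow_mul_exp_neg_le (k : ℕ) {x : ℝ} (hx : 0 ≤ x) :
    (1 + x) ^ k * Real.exp (-x / 4) ≤ 8 ^ k * k.factorial * Real.exp 1 * Real.exp (-x / 8) := by
  have h := Real.pow_div_factorial_le_exp ((1 + x) / 8) (by positivity) k
  rw [div_le_iff₀ (by positivity), div_pow, div_le_iff₀ (by positivity)] at h
  have h1 : Real.exp ((1 + x) / 8) ≤ Real.exp 1 * Real.exp (x / 8) := by
    rw [← Real.exp_add]; gcongr; linarith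
  calc (1 + x) ^ k * Real.exp (-x / 4)
      ≤ (Real.exp 1 * Real.exp (x / 8) * k.factorial * 8 ^ k) * Real.exp (-x / 4) := by
        gcongr
        exact h.trans (by gcongr)
    _ = 8 ^ k * k.factorial * Real.exp 1 * (Real.exp (x / 8) * Real.exp (-x / 4)) := by ring
    _ = _ := by rw [← Real.exp_add]; congr 2; ring

theorem abs_phase_le_of_mem_centralRegion {m : ℕ} {β : ℝ} {y : Fin 3 → ℝ}
    (hy : (gramMatrix m β).mulVec y ∈ centralRegion m (1 / 12)) {j : ℕ} (hj : j ∈ Finset.Icc 1 m) :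
    |gramPoly m y j / countDev m β| ≤ 1 / 4 := by
  rw [← phase_gramMatrix, phase_eq]
  obtain ⟨h0, h1, h2⟩ := hy
  rw [Finset.mem_Icc] at hj
  have hj1 : (1 : ℝ) ≤ j := by exact_mod_cast hj.1
  have hjm : (j : ℝ) ≤ m := by exact_mod_cast hj.2
  refine (abs_add_three _ _ _).trans ?_
  rw [abs_mul, abs_mul, abs_of_nonneg (by linarith : (0 : ℝ) ≤ j),
    abs_of_nonneg (by nlinarith : (0 : ℝ) ≤ (j : ℝ) * (j - 1) / 2)]
  have a1 := mul_le_mul_of_nonneg_left hjm (abs_nonneg ((gramMatrix m β).mulVec y 1))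
  have a2 := mul_le_mul_of_nonneg_left (by nlinarith : (j : ℝ) * (j - 1) / 2 ≤ (m : ℝ) ^ 2)
    (abs_nonneg ((gramMatrix m β).mulVec y 2))
  linarith

namespace SparseRegime

variable {m : ℕ} {β n : ℝ}

/-- The expansion on the central region; in it `gramPoly m y j / countDev m β` is the phase
`θ · v_j` at `θ = A y`. -/
theorem abs_re_centredCharFun_sub_le (h : SparseRegime m β n) (y : Fin 3 → ℝ)
    (hu : ∀ j ∈ Finset.Icc 1 m, |gramPoly m y j / countDev m β| ≤ 1 / 4) :
    |(centredCharFun m β ((gramMatrix m β).mulVec y)).re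
      - Real.exp (-(∑ a, y a ^ 2) / 2) * (1 + edgeworthPoly y / n ^ 2)|
      ≤ 10 ^ 33 * regNorm y ^ 30 * Real.exp (-(∑ a, y a ^ 2) / 4) / n ^ 4 := by
  have h0 := h.pos
  have hb := h.prob_pos
  have hr := one_le_regNorm y
  have hre := re_centredCharFun (m := m) hb.le (by linarith [h.prob_le'])
    (θ := (gramMatrix m β).mulVec y)
    (fun j hj => by rw [phase_gramMatrix]; exact (hu j hj).trans (by norm_num))
  simp only [phase_gramMatrix] at hre
  have hX := h.sum_re_bernoulliLog y hu
  have hB := h.sum_im_bernoulliLog y hu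
  have hd := h.abs_sum_re_add_le y hu
  have h4 := h.abs_quartic_sub_le y
  have h3 := h.abs_cubic_sq_sub_le y
  have b4 : |β * (∑ j ∈ Finset.Icc 1 m, (gramPoly m y j / countDev m β) ^ 4) / 24|
      ≤ 10 ^ 6 * regNorm y ^ 6 / n ^ 2 := by
    have a := h.sum_abs_pow_le y 4
    have r46 : regNorm y ^ 4 ≤ regNorm y ^ 6 := pow_le_pow_right₀ hr (by norm_num)
    rw [abs_div, abs_mul, abs_of_pos hb, abs_of_pos (by norm_num : (0 : ℝ) < 24)]
    have b := Finset.abs_sum_le_sum_abs (fun j => (gramPoly m y j / countDev m β) ^ 4)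
      (Finset.Icc 1 m)
    simp only [abs_pow] at b
    calc _ ≤ β * (∑ j ∈ Finset.Icc 1 m, |gramPoly m y j / countDev m β| ^ 4) / 24 := by gcongr
      _ ≤ n ^ 2 * (8 * regNorm y / n) ^ 4 / 24 := by gcongr
      _ = (512 / 3) * regNorm y ^ 4 / n ^ 2 := by field_simp; norm_num
      _ ≤ _ := by gcongr; norm_num
  have b3 : |-(β * (∑ j ∈ Finset.Icc 1 m, (gramPoly m y j / countDev m β) ^ 3) / 6)|
      ≤ 10 ^ 6 * regNorm y ^ 6 / n := by
    have a := h.sum_abs_pow_le y 3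
    have r36 : regNorm y ^ 3 ≤ regNorm y ^ 6 := pow_le_pow_right₀ hr (by norm_num)
    rw [abs_neg, abs_div, abs_mul, abs_of_pos hb, abs_of_pos (by norm_num : (0 : ℝ) < 6)]
    have b := Finset.abs_sum_le_sum_abs (fun j => (gramPoly m y j / countDev m β) ^ 3)
      (Finset.Icc 1 m)
    simp only [abs_pow] at b
    calc _ ≤ β * (∑ j ∈ Finset.Icc 1 m, |gramPoly m y j / countDev m β| ^ 3) / 6 := by gcongr
      _ ≤ n ^ 2 * (8 * regNorm y / n) ^ 3 / 6 := by gcongr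
      _ = (256 / 3) * regNorm y ^ 3 / n := by field_simp; norm_num
      _ ≤ _ := by gcongr; norm_num
  have r6 : 1 ≤ regNorm y ^ 6 := one_le_pow₀ hr
  have main := abs_exp_mul_cos_sub_le (T := 10 ^ 6 * regNorm y ^ 6) (by linarith [h.eight_le])
    (by linarith) hX hB b4 b3 hd
  set ρ := ∑ a, y a ^ 2
  set A := ∑ j ∈ Finset.Icc 1 m, (bernoulliLog β (gramPoly m y j / countDev m β)).re
  set S₄ := β * (∑ j ∈ Finset.Icc 1 m, (gramPoly m y j / countDev m β) ^ 4)
  set S₃ := β * (∑ j ∈ Finset.Icc 1 m, (gramPoly m y j / countDev m β) ^ 3)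
  set B := ∑ j ∈ Finset.Icc 1 m, (bernoulliLog β (gramPoly m y j / countDev m β)).im
  have e : Real.exp A * Real.cos B - Real.exp (-ρ / 2) * (1 + edgeworthPoly y / n ^ 2)
      = Real.exp (-ρ / 2) * ((Real.exp (A + ρ / 2) * Real.cos B - (1 + S₄ / 24 - (-(S₃ / 6)) ^ 2 / 2))
        + ((S₄ - quarticMoment y / n ^ 2) / 24 - (S₃ ^ 2 - cubicMoment y ^ 2 / n ^ 2) / 72)) := by
    have : Real.exp A = Real.exp (-ρ / 2) * Real.exp (A + ρ / 2) := by
      rw [← Real.exp_add]; congr 1; ring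
    rw [this, edgeworthPoly]
    ring
  rw [hre, e, abs_mul, abs_of_pos (Real.exp_pos _)]
  have r630 : regNorm y ^ 6 ≤ regNorm y ^ 30 := pow_le_pow_right₀ hr (by norm_num)
  have r46 : regNorm y ^ 4 ≤ regNorm y ^ 30 := pow_le_pow_right₀ hr (by norm_num)
  have hρ0 : 0 ≤ ρ := by positivity
  have E1 : 1 ≤ Real.exp (ρ / 4) := Real.one_le_exp (by positivity)
  set Z := regNorm y ^ 30 * Real.exp (ρ / 4) / n ^ 4 with hZ
  have hZ4 : 10 ^ 5 * regNorm y ^ 4 / n ^ 4 ≤ 10 ^ 5 * Z := by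
    rw [hZ, mul_div_assoc]
    gcongr
    nlinarith [pow_nonneg (zero_le_one.trans hr) 30]
  have hZ3 : 10 ^ 7 * regNorm y ^ 6 / n ^ 4 ≤ 10 ^ 7 * Z := by
    rw [hZ, mul_div_assoc]
    gcongr
    nlinarith [pow_nonneg (zero_le_one.trans hr) 30]
  have hZm : 110 * (10 ^ 6 * regNorm y ^ 6) ^ 5 * Real.exp (ρ / 4) / n ^ 4 = 110 * 10 ^ 30 * Z := by
    rw [hZ]; ring
  have hZ0 : 0 ≤ Z := by positivity
  have tot : |(Real.exp (A + ρ / 2) * Real.cos B - (1 + S₄ / 24 - (-(S₃ / 6)) ^ 2 / 2))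
        + ((S₄ - quarticMoment y / n ^ 2) / 24 - (S₃ ^ 2 - cubicMoment y ^ 2 / n ^ 2) / 72)|
      ≤ 10 ^ 33 * Z := by
    refine (abs_add_le _ _).trans ?_
    have := abs_sub ((S₄ - quarticMoment y / n ^ 2) / 24) ((S₃ ^ 2 - cubicMoment y ^ 2 / n ^ 2) / 72)
    rw [abs_div _ 24, abs_div _ 72, abs_of_pos (by norm_num : (0 : ℝ) < 24),
      abs_of_pos (by norm_num : (0 : ℝ) < 72)] at this
    linarith
  calc _ ≤ Real.exp (-ρ / 2) * (10 ^ 33 * Z) := by gcongr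
    _ = 10 ^ 33 * regNorm y ^ 30 * (Real.exp (-ρ / 2) * Real.exp (ρ / 4)) / n ^ 4 := by
      rw [hZ]; ring
    _ = _ := by rw [← Real.exp_add]; congr 3; ring

/-- The central region contains, in the coordinates `y`, a ball of radius of order `n`. -/
theorem le_regNorm_of_notMem_centralRegion (h : SparseRegime m β n) {y : Fin 3 → ℝ}
    (hy : (gramMatrix m β).mulVec y ∉ centralRegion m (1 / 12)) : n ≤ 1000 * regNorm y := by
  by_contra! hlt
  apply hy
  have hm := h.le_card
  have hmR : (64 : ℝ) ≤ m := by exact_mod_cast hm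
  have h0 := h.pos
  have hc := h.countDev_pos
  have hi := h.inv_countDev_le
  have hr := one_le_regNorm y
  have g1 := gramCoeff₁_pos (m := m) (by omega)
  have g2 := gramCoeff₂_pos (m := m) (by omega)
  have im : 1 / (m : ℝ) ≤ 1 / 64 := by gcongr
  have d1 : gramCoeff₁ m * m ≤ 3 := by
    have := (abs_le.1 (abs_gramCoeff₁_mul_sub_le hm)).2
    linarith [sqrt_three_le]
  have d2 : gramCoeff₂ m * (m : ℝ) ^ 2 ≤ 4 := by
    have := (abs_le.1 (abs_gramCoeff₂_mul_sub_le hm)).2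
    linarith [sqrt_five_le]
  have y0 := abs_le_regNorm y 0
  have y1 := abs_le_regNorm y 1
  have y2 := abs_le_regNorm y 2
  have fin : ∀ w : ℝ, |w| ≤ 60 * regNorm y → |(countDev m β)⁻¹ * w| ≤ 1 / 12 := by
    intro w hw
    rw [abs_mul, abs_of_pos (inv_pos.2 hc)]
    calc _ ≤ (8 / 7 / n) * (60 * regNorm y) := by gcongr
      _ ≤ 1 / 12 := by
        rw [div_mul_eq_mul_div, div_le_iff₀ h0]; linarith
  have e0 : (gramMatrix m β).mulVec y 0 = (countDev m β)⁻¹ * (y 0 +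
      (y 1 * -(gramCoeff₁ m * (m + 1)) + y 2 * (gramCoeff₂ m * ((m + 1) * (m + 2))))) := by
    simp [gramMatrix, Matrix.mulVec, dotProduct, Fin.sum_univ_three]; ring
  have e1 : (gramMatrix m β).mulVec y 1 * m = (countDev m β)⁻¹ * (
      y 1 * (2 * (gramCoeff₁ m * m)) + y 2 * -(6 * (gramCoeff₂ m * (m : ℝ) ^ 2))) := by
    simp [gramMatrix, Matrix.mulVec, dotProduct, Fin.sum_univ_three]; ring
  have e2 : (gramMatrix m β).mulVec y 2 * (m : ℝ) ^ 2 = (countDev m β)⁻¹ * (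
      y 1 * 0 + y 2 * (12 * (gramCoeff₂ m * (m : ℝ) ^ 2))) := by
    simp [gramMatrix, Matrix.mulVec, dotProduct, Fin.sum_univ_three]; ring
  refine ⟨?_, ?_, ?_⟩
  · rw [e0]
    refine fin _ ((abs_add_le _ _).trans ?_)
    have p1 : |-(gramCoeff₁ m * (m + 1))| ≤ 6 := by
      rw [abs_neg, abs_of_pos (by positivity)]; nlinarith
    have p2 : |gramCoeff₂ m * ((m + 1) * (m + 2))| ≤ 16 := by
      rw [abs_of_pos (by positivity)]
      have : gramCoeff₂ m * ((m + 1) * (m + 2)) ≤ gramCoeff₂ m * (4 * (m : ℝ) ^ 2) :=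
        mul_le_mul_of_nonneg_left (by nlinarith) g2.le
      linarith
    have := abs_add_mul_add_mul_le (y := y) p1 p2
    linarith
  · rw [← abs_of_nonneg (by linarith : (0 : ℝ) ≤ m), ← abs_mul, e1]
    have p1 : |2 * (gramCoeff₁ m * m)| ≤ 6 := by
      rw [abs_of_pos (by positivity)]; linarith
    have p2 : |-(6 * (gramCoeff₂ m * (m : ℝ) ^ 2))| ≤ 24 := by
      rw [abs_neg, abs_of_pos (by positivity)]; linarith
    have := abs_add_mul_add_mul_le (y := y) p1 p2
    exact fin _ (by linarith)
  · have hm2 : (0 : ℝ) ≤ (m : ℝ) ^ 2 := by positivity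
    rw [← abs_of_nonneg hm2, ← abs_mul, e2]
    have p2 : |12 * (gramCoeff₂ m * (m : ℝ) ^ 2)| ≤ 48 := by
      rw [abs_of_pos (by positivity)]; linarith
    have := abs_add_mul_add_mul_le (y := y) (p := 0) (P := 0) (by simp) p2
    exact fin _ (by linarith)

end SparseRegime

/-- Pointwise form of the expansion, valid for all `y`: outside of the central region both terms
are negligible because `n` is then at most a multiple of `√(1 + |y|²)`. -/
theorem exists_abs_indicator_sub_le : ∃ K : ℝ, 0 < K ∧ ∀ (m : ℕ) (β n : ℝ), SparseRegime m β n →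
    ∀ y : Fin 3 → ℝ, |(centralRegion m (1 / 12)).indicator (fun θ => (centredCharFun m β θ).re)
        ((gramMatrix m β).mulVec y)
      - Real.exp (-(∑ a, y a ^ 2) / 2) * (1 + edgeworthPoly y / n ^ 2)|
      ≤ K / n ^ 4 * Real.exp (-(∑ a, y a ^ 2) / 8) := by
  refine ⟨10 ^ 33 * (8 ^ 15 * (15 : ℕ).factorial * Real.exp 1), by positivity,
    fun m β n h y => ?_⟩
  have h0 := h.pos
  have hr := one_le_regNorm y
  have hρ : 0 ≤ ∑ a, y a ^ 2 := by positivity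
  have hg : regNorm y ^ 30 = (1 + ∑ a, y a ^ 2) ^ 15 := by
    rw [← regNorm_sq]; ring
  have hpe := pow_mul_exp_neg_le 15 hρ
  rw [← hg] at hpe
  have step : |(centralRegion m (1 / 12)).indicator (fun θ => (centredCharFun m β θ).re)
        ((gramMatrix m β).mulVec y)
      - Real.exp (-(∑ a, y a ^ 2) / 2) * (1 + edgeworthPoly y / n ^ 2)|
      ≤ 10 ^ 33 * regNorm y ^ 30 * Real.exp (-(∑ a, y a ^ 2) / 4) / n ^ 4 := by
    by_cases hy : (gramMatrix m β).mulVec y ∈ centralRegion m (1 / 12)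
    · rw [Set.indicator_of_mem hy]
      exact h.abs_re_centredCharFun_sub_le y fun j hj => abs_phase_le_of_mem_centralRegion hy hj
    · have hn := h.le_regNorm_of_notMem_centralRegion hy
      rw [Set.indicator_of_notMem hy, zero_sub, abs_neg, abs_mul, abs_of_pos (Real.exp_pos _)]
      have hD := abs_edgeworthPoly_le y
      have h6 : 1 ≤ regNorm y ^ 6 := one_le_pow₀ hr
      have hA : |1 + edgeworthPoly y / n ^ 2| ≤ 3001 * regNorm y ^ 6 := by
        refine (abs_add_le _ _).trans ?_
        rw [abs_one, abs_div, abs_of_pos (by positivity : 0 < n ^ 2)]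
        have : |edgeworthPoly y| / n ^ 2 ≤ |edgeworthPoly y| :=
          div_le_self (abs_nonneg _) (by linarith [h.sq_ge])
        linarith
      have hn4 : n ^ 4 ≤ (1000 * regNorm y) ^ 4 := by gcongr
      rw [le_div_iff₀ (by positivity)]
      have hee : Real.exp (-(∑ a, y a ^ 2) / 2) ≤ Real.exp (-(∑ a, y a ^ 2) / 4) := by
        rw [Real.exp_le_exp]
        linarith
      calc _ ≤ Real.exp (-(∑ a, y a ^ 2) / 4) * (3001 * regNorm y ^ 6) * (1000 * regNorm y) ^ 4 := by
            gcongr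
        _ = 3001 * 1000 ^ 4 * regNorm y ^ 10 * Real.exp (-(∑ a, y a ^ 2) / 4) := by ring
        _ ≤ 10 ^ 33 * regNorm y ^ 30 * Real.exp (-(∑ a, y a ^ 2) / 4) := by
            gcongr
            · norm_num
            · norm_num
  refine step.trans ?_
  calc _ = 10 ^ 33 / n ^ 4 * (regNorm y ^ 30 * Real.exp (-(∑ a, y a ^ 2) / 4)) := by ring
    _ ≤ 10 ^ 33 / n ^ 4 * (8 ^ 15 * (15 : ℕ).factorial * Real.exp 1 *
        Real.exp (-(∑ a, y a ^ 2) / 8)) := mul_le_mul_of_nonneg_left hpe (by positivity)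
    _ = _ := by ring

/-! ### Gaussian moments -/

/-- The moments of the standard Gaussian distribution. -/
def gaussMoment : ℕ → ℝ
  | 0 => 1
  | 1 => 0
  | n + 2 => (n + 1) * gaussMoment n

open MeasureTheory

theorem integrable_pow_mul_exp (n : ℕ) {b : ℝ} (hb : 0 < b) :
    Integrable fun x : ℝ => x ^ n * Real.exp (-b * x ^ 2) := by
  have := integrable_rpow_mul_exp_neg_mul_sq hb (s := n) (by
    have : (0 : ℝ) ≤ n := by positivity
    linarith)
  simpa using this

theorem integral_pow_mul_exp (n : ℕ) :
    ∫ x : ℝ, x ^ n * Real.exp (-(1 / 2) * x ^ 2) = gaussMoment n * √(2 * Real.pi) := by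
  have hint := fun k => integrable_pow_mul_exp k (b := 1 / 2) (by norm_num)
  have hexp : ∀ x : ℝ, HasDerivAt (fun x => Real.exp (-(1 / 2) * x ^ 2))
      (-x * Real.exp (-(1 / 2) * x ^ 2)) x := by
    intro x
    have := (((hasDerivAt_pow 2 x).const_mul (-(1 / 2))).exp)
    refine this.congr_deriv ?_
    push_cast; ring
  induction n using gaussMoment.induct with
  | case1 =>
    have := integral_gaussian (1 / 2)
    simp only [pow_zero, one_mul, gaussMoment, this]
    congr 1; ring
  | case2 =>
    have := integral_eq_zero_of_hasDerivAt_of_integrable hexp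
      (by simpa [neg_mul] using (hint 1).neg) (by simpa using hint 0)
    simp only [gaussMoment, zero_mul, pow_one]
    simp only [neg_mul, integral_neg, neg_eq_zero] at this ⊢
    exact this
  | case3 n ih =>
    have hd : ∀ x : ℝ, HasDerivAt (fun x => x ^ (n + 1) * Real.exp (-(1 / 2) * x ^ 2))
        ((n + 1) * (x ^ n * Real.exp (-(1 / 2) * x ^ 2))
          - x ^ (n + 2) * Real.exp (-(1 / 2) * x ^ 2)) x := by
      intro x
      refine ((hasDerivAt_pow (n + 1) x).mul (hexp x)).congr_deriv ?_
      push_cast; ring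
    have := integral_eq_zero_of_hasDerivAt_of_integrable hd
      (((hint n).const_mul _).sub (hint (n + 2))) (hint (n + 1))
    rw [integral_sub ((hint n).const_mul _) (hint (n + 2)), integral_const_mul, ih,
      sub_eq_zero] at this
    rw [← this, gaussMoment]
    ring

theorem exp_neg_sum_sq (y : Fin 3 → ℝ) (b : ℝ) : Real.exp (-(∑ a, y a ^ 2) * b)
    = Real.exp (-b * y 0 ^ 2) * Real.exp (-b * y 1 ^ 2) * Real.exp (-b * y 2 ^ 2) := by
  rw [← Real.exp_add, ← Real.exp_add, Fin.sum_univ_three]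
  congr 1; ring

theorem integrable_exp_neg_sum_sq {b : ℝ} (hb : 0 < b) :
    Integrable fun y : Fin 3 → ℝ => Real.exp (-(∑ a, y a ^ 2) * b) := by
  have := Integrable.fintype_prod (𝕜 := ℝ) (f := fun (_ : Fin 3) (x : ℝ) => Real.exp (-b * x ^ 2))
    (μ := fun _ => volume) (fun _ => by simpa using integrable_pow_mul_exp 0 hb)
  simp only [Fin.prod_univ_three, ← volume_pi] at this
  simpa only [exp_neg_sum_sq] using this

/-- `f` has the mean `v` with respect to the standard Gaussian distribution on `ℝ³`. -/
def HasGaussMean (f : (Fin 3 → ℝ) → ℝ) (v : ℝ) : Prop :=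
  Integrable (fun y => Real.exp (-(∑ a, y a ^ 2) / 2) * f y) ∧
    ∫ y, Real.exp (-(∑ a, y a ^ 2) / 2) * f y = v * √(2 * Real.pi) ^ 3

theorem HasGaussMean.add {f g : (Fin 3 → ℝ) → ℝ} {v w : ℝ} (hf : HasGaussMean f v)
    (hg : HasGaussMean g w) : HasGaussMean (fun y => f y + g y) (v + w) := by
  refine ⟨?_, ?_⟩
  · simp only [mul_add]
    exact hf.1.add hg.1
  · simp only [mul_add]
    rw [integral_add hf.1 hg.1, hf.2, hg.2]; ring

theorem HasGaussMean.const_mul {f : (Fin 3 → ℝ) → ℝ} {v : ℝ} (c : ℝ) (hf : HasGaussMean f v) :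
    HasGaussMean (fun y => c * f y) (c * v) := by
  refine ⟨?_, ?_⟩
  · simp only [mul_left_comm _ c]
    exact hf.1.const_mul c
  · simp only [mul_left_comm _ c]
    rw [integral_const_mul, hf.2]; ring

theorem hasGaussMean_monomial (a b c : ℕ) :
    HasGaussMean (fun y => y 0 ^ a * y 1 ^ b * y 2 ^ c)
      (gaussMoment a * gaussMoment b * gaussMoment c) := by
  set g : Fin 3 → ℝ → ℝ := fun i x => x ^ (![a, b, c] i) * Real.exp (-(1 / 2) * x ^ 2) with hg
  have e : ∀ y : Fin 3 → ℝ, Real.exp (-(∑ a, y a ^ 2) / 2) * (y 0 ^ a * y 1 ^ b * y 2 ^ c)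
      = ∏ i, g i (y i) := by
    intro y
    rw [div_eq_mul_inv, exp_neg_sum_sq]
    simp [hg, Fin.prod_univ_three]
    ring
  refine ⟨?_, ?_⟩
  · simp only [e]
    exact Integrable.fintype_prod (𝕜 := ℝ) (f := g) (μ := fun _ => volume)
      fun i => integrable_pow_mul_exp _ (by norm_num)
  · simp only [e]
    rw [volume_pi, integral_fintype_prod_eq_prod (𝕜 := ℝ) g]
    simp only [hg, integral_pow_mul_exp, Fin.prod_univ_three]
    simp
    ring

theorem hasGaussMean_edgeworthPoly : HasGaussMean edgeworthPoly (-711 / 980) := by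
  have M := fun (k : ℝ) (a b c : ℕ) => (hasGaussMean_monomial a b c).const_mul k
  have h3 : √3 ^ 2 = 3 := Real.sq_sqrt (by norm_num)
  have h5 : √5 ^ 2 = 5 := Real.sq_sqrt (by norm_num)
  have h5' : √5 ^ 3 = 5 * √5 := by rw [pow_succ, h5]
  have h5f : √5 ^ 4 = 25 := by rw [pow_mul √5 2 2, h5]; norm_num
  have h3f : √3 ^ 4 = 9 := by rw [pow_mul √3 2 2, h3]; norm_num
  have q := ((((((((M 1 4 0 0).add (M 6 2 2 0)).add (M 6 2 0 2)).add (M (24 / 5 * √5) 1 2 1)).add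
    (M (8 / 7 * √5) 1 0 3)).add (M (9 / 5) 0 4 0)).add (M (66 / 7) 0 2 2)).add
    (M (15 / 7) 0 0 4)).const_mul (1 / 24)
  have c := ((((((((((((((M 1 6 0 0).add (M 9 2 4 0)).add (M 9 2 0 4)).add
    (M (36 / 5) 0 4 2)).add (M (20 / 49) 0 0 6)).add (M 6 4 2 0)).add (M 6 4 0 2)).add
    (M 18 2 2 2)).add (M (24 / 7) 0 2 4)).add (M (12 / 5 * √5) 3 2 1)).add
    (M (4 / 7 * √5) 3 0 3)).add (M (36 / 5 * √5) 1 4 1)).add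
    (M ((12 / 7 + 36 / 5) * √5) 1 2 3)).add (M (12 / 7 * √5) 1 0 5)).const_mul (-1 / 72)
  have := q.add c
  convert this using 1
  · funext y
    simp only [edgeworthPoly, quarticMoment, cubicMoment, mul_pow, h3, h5, h5', h5f, h3f]
    ring_nf
    rw [h5]
    ring
  · simp [gaussMoment]
    norm_num

/-! ### The local limit theorem -/

theorem measurableSet_centralRegion (m : ℕ) (δ : ℝ) : MeasurableSet (centralRegion m δ) := by
  unfold centralRegion
  refine IsClosed.measurableSet ?_
  simp only [Set.ofPred_and]
  exact (isClosed_le (by fun_prop) (by fun_prop)).inter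
    ((isClosed_le (by fun_prop) (by fun_prop)).inter (isClosed_le (by fun_prop) (by fun_prop)))

theorem measurableSet_freqCube : MeasurableSet freqCube :=
  MeasurableSet.univ_pi fun _ => measurableSet_Ioc

theorem volume_real_freqCube : volume.real freqCube = (2 * Real.pi) ^ 3 := by
  rw [freqCube, measureReal_def, Real.volume_pi_Ioc_toReal (fun _ => by linarith [Real.pi_pos])]
  simp
  ring

theorem volume_freqCube_lt_top : volume freqCube < ⊤ := by
  rw [freqCube, Real.volume_pi_Ioc]
  exact ENNReal.prod_lt_top fun _ _ => ENNReal.ofReal_lt_top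

theorem centralRegion_subset_freqCube {m : ℕ} (hm : 1 ≤ m) :
    centralRegion m (1 / 12) ⊆ freqCube := by
  rintro θ ⟨h0, h1, h2⟩
  have hm' : (1 : ℝ) ≤ m := by exact_mod_cast hm
  have hp := Real.pi_gt_three
  have b1 : |θ 1| ≤ 1 / 12 := (le_mul_of_one_le_right (abs_nonneg _) hm').trans h1
  have b2 : |θ 2| ≤ 1 / 12 :=
    (le_mul_of_one_le_right (abs_nonneg _) (one_le_pow₀ hm')).trans h2
  have key : ∀ a, |θ a| ≤ 1 / 12 → θ a ∈ Set.Ioc (-Real.pi) Real.pi := fun a ha => by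
    rw [abs_le] at ha
    exact ⟨by linarith [ha.1], by linarith [ha.2]⟩
  refine Set.mem_univ_pi.2 fun a => ?_
  fin_cases a
  · exact key 0 h0
  · exact key 1 b1
  · exact key 2 b2

theorem exists_abs_integral_centralRegion_sub_le : ∃ K : ℝ, 0 < K ∧ ∀ (m : ℕ) (β n : ℝ),
    SparseRegime m β n → |(∫ θ in centralRegion m (1 / 12), (centredCharFun m β θ).re)
      - (gramMatrix m β).det * (√(2 * Real.pi) ^ 3 * (1 + -711 / 980 / n ^ 2))|
      ≤ (gramMatrix m β).det * (K / n ^ 4) := by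
  obtain ⟨K, hK, hb⟩ := exists_abs_indicator_sub_le
  set I := ∫ y : Fin 3 → ℝ, Real.exp (-(∑ a, y a ^ 2) / 8) with hI
  have hint8 : Integrable fun y : Fin 3 → ℝ => Real.exp (-(∑ a, y a ^ 2) / 8) := by
    simpa only [div_eq_mul_inv] using integrable_exp_neg_sum_sq (b := 8⁻¹) (by norm_num)
  have hI0 : 0 ≤ I := integral_nonneg fun _ => (Real.exp_pos _).le
  refine ⟨K * I + 1, by positivity, fun m β n h => ?_⟩
  have h0 := h.pos
  have hm := h.le_card
  have hβ1 : β < 1 := by linarith [h.prob_le']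
  have hdet := det_gramMatrix_pos (m := m) (by omega) h.prob_pos hβ1
  set g : (Fin 3 → ℝ) → ℝ := fun y => (centralRegion m (1 / 12)).indicator
    (fun θ => (centredCharFun m β θ).re) ((gramMatrix m β).mulVec y) with hg
  set G : (Fin 3 → ℝ) → ℝ := fun y => Real.exp (-(∑ a, y a ^ 2) / 2) *
    (1 + edgeworthPoly y / n ^ 2) with hG
  have hmean : HasGaussMean (fun y => 1 + edgeworthPoly y / n ^ 2) (1 + -711 / 980 / n ^ 2) := by
    have := ((hasGaussMean_monomial 0 0 0)).add (hasGaussMean_edgeworthPoly.const_mul (1 / n ^ 2))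
    convert this using 1
    · funext y; simp; ring
    · simp [gaussMoment]; ring
  have hgm : Measurable g := by
    have h1 : Measurable ((centralRegion m (1 / 12)).indicator
        (fun θ => (centredCharFun m β θ).re)) :=
      (Complex.continuous_re.comp (continuous_centredCharFun m β)).measurable.indicator
        (measurableSet_centralRegion _ _)
    exact h1.comp (by fun_prop : Continuous fun y => (gramMatrix m β).mulVec y).measurable
  have hGi : Integrable G := hmean.1
  have hdi : Integrable (fun y => g y - G y) := by
    refine (hint8.const_mul (K / n ^ 4)).mono' (hgm.aestronglyMeasurable.sub hGi.1) ?_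
    exact ae_of_all _ fun y => hb m β n h y
  have hgi : Integrable g := by
    have := hdi.add hGi
    rwa [show (fun y => g y - G y) + G = g from sub_add_cancel g G] at this
  -- `y ↦ A y` has the positive determinant `det A`, which factors out of both integrals
  have e1 : ∫ θ in centralRegion m (1 / 12), (centredCharFun m β θ).re
      = (gramMatrix m β).det * ∫ y, g y := by
    rw [← integral_indicator (measurableSet_centralRegion _ _),
      integral_gramMatrix (m := m) (by omega) h.prob_pos hβ1]
  rw [e1, mul_comm (√(2 * Real.pi) ^ 3), ← hmean.2, ← mul_sub, abs_mul, abs_of_pos hdet]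
  gcongr
  change |(∫ y, g y) - ∫ y, G y| ≤ _
  rw [← integral_sub hgi hGi]
  calc |∫ y, (g y - G y)| ≤ ∫ y : Fin 3 → ℝ, K / n ^ 4 * Real.exp (-(∑ a, y a ^ 2) / 8) :=
        norm_integral_le_of_norm_le (f := fun y => g y - G y) (hint8.const_mul (K / n ^ 4))
          (ae_of_all _ fun y => hb m β n h y)
    _ = K * I / n ^ 4 := by rw [integral_const_mul, ← hI]; ring
    _ ≤ _ := by gcongr; linarith

theorem exists_abs_integral_tail_le : ∃ ε : ℝ, 0 < ε ∧ ∀ (m : ℕ) (β n : ℝ), SparseRegime m β n →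
    |∫ θ in freqCube \ centralRegion m (1 / 12), (centredCharFun m β θ).re|
      ≤ (2 * Real.pi) ^ 3 * Real.exp (-(ε * n ^ 2)) := by
  obtain ⟨ε, hε, hb⟩ := exists_le_sum_one_sub_cos (δ := 1 / 12) (by norm_num) (by norm_num)
  refine ⟨ε / 2, by positivity, fun m β n h => ?_⟩
  have hβ := h.prob_pos
  have hβ' := h.prob_le'
  have hfin : volume (freqCube \ centralRegion m (1 / 12)) < ⊤ :=
    (measure_mono Set.sdiff_subset).trans_lt volume_freqCube_lt_top
  have := norm_setIntegral_le_of_norm_le_const (f := fun θ => (centredCharFun m β θ).re)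
    (C := Real.exp (-(ε / 2 * n ^ 2))) hfin fun θ hθ => by
      refine (Complex.abs_re_le_norm _).trans ((norm_centredCharFun_le m β θ).trans ?_)
      rw [Real.exp_le_exp, neg_le_neg_iff]
      have h1 := hb m (by have := h.le_card; omega) θ hθ.1 hθ.2
      have h2 : 0 ≤ β * (1 - β) := mul_nonneg hβ.le (by linarith)
      have h3 := mul_le_mul_of_nonneg_left h1 h2
      have h4 : ε / 2 * n ^ 2 ≤ β * (1 - β) * (ε * m) := by
        rw [← h.mean_eq]
        have : 0 ≤ ε * (m * β) := by positivity
        nlinarith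
      linarith
  refine this.trans ?_
  rw [mul_comm]
  gcongr
  rw [← volume_real_freqCube]
  exact measureReal_mono Set.sdiff_subset volume_freqCube_lt_top.ne

theorem sqrt_two_pi_cube : √(2 * Real.pi) ^ 3 = (2 * Real.pi) ^ (3 / 2 : ℝ) := by
  rw [Real.sqrt_eq_rpow, ← Real.rpow_natCast, ← Real.rpow_mul (by positivity)]
  norm_num

/-- The Gaussian approximation is only polynomially small in `n`, so that it dominates the
exponentially small contribution of the frequencies away from zero. -/
theorem SparseRegime.one_div_pow_le_det {m : ℕ} {β n : ℝ} (h : SparseRegime m β n)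
    (hmn : (m : ℝ) ≤ n ^ 6) : 1 / n ^ 22 ≤ (gramMatrix m β).det := by
  have hm := h.le_card
  have hn := h.pos
  have hmR : (64 : ℝ) ≤ m := by exact_mod_cast hm
  have im : 1 / (m : ℝ) ≤ 1 / 64 := by gcongr
  have d1 : 1 / 2 ≤ gramCoeff₁ m * m := by
    have := (abs_le.1 (abs_gramCoeff₁_mul_sub_le hm)).1
    have : 1 ≤ √3 := Real.one_le_sqrt.2 (by norm_num)
    linarith
  have d2 : 1 / 2 ≤ gramCoeff₂ m * (m : ℝ) ^ 2 := by
    have := (abs_le.1 (abs_gramCoeff₂_mul_sub_le hm)).1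
    have : 1 ≤ √5 := Real.one_le_sqrt.2 (by norm_num)
    linarith
  have d3 : countDev m β ≤ n := by
    refine le_of_sq_le_sq ?_ hn.le
    rw [h.countDev_sq]
    nlinarith [h.prob_pos, sq_nonneg n]
  have hc := h.countDev_pos
  have hm0 : (0 : ℝ) < m := by linarith
  calc 1 / n ^ 22 ≤ 1 / ((n ^ 6) ^ 3 * n ^ 3) := by
        rw [show (n ^ 6) ^ 3 * n ^ 3 = n ^ 21 by ring]
        gcongr
        · linarith [h.eight_le]
        · norm_num
    _ ≤ 1 / ((m : ℝ) ^ 3 * countDev m β ^ 3) := by gcongr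
    _ ≤ 24 * (gramCoeff₁ m * m) * (gramCoeff₂ m * (m : ℝ) ^ 2) / ((m : ℝ) ^ 3 * countDev m β ^ 3) := by
        gcongr
        nlinarith
    _ = _ := by rw [det_gramMatrix]; field_simp

/-- The local limit theorem with its first Edgeworth correction, uniformly in the sparse regime. -/
theorem exists_abs_bimagicCentralProb_sub_le : ∃ C : ℝ, 0 < C ∧ ∀ (m : ℕ) (β n : ℝ),
    SparseRegime m β n → (m : ℝ) ≤ n ^ 6 →
    (∃ k : Fin 3 → ℤ, ∀ a, β * ∑ i ∈ Finset.Icc 1 m, bimagicVec i a = k a) →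
    |bimagicCentralProb m β - bimagicGaussProb m β * (1 + -711 / 980 / n ^ 2)|
      ≤ C * (bimagicGaussProb m β / n ^ 4) := by
  obtain ⟨K, hK, hcen⟩ := exists_abs_integral_centralRegion_sub_le
  obtain ⟨ε, hε, htail⟩ := exists_abs_integral_tail_le
  set P := (2 * Real.pi) ^ 3 with hP
  have hP0 : 0 < P := by positivity
  set Q := √(2 * Real.pi) ^ 3 with hQ
  have hQ0 : 0 < Q := by positivity
  have hPQ : P = Q * Q := by
    rw [hP, hQ, ← mul_pow, Real.mul_self_sqrt (by positivity)]
  set L := (13 : ℕ).factorial / ε ^ 13 with hL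
  have hL0 : 0 < L := by positivity
  refine ⟨(K + P * L) / Q, by positivity, fun m β n h hmn ⟨k, hk⟩ => ?_⟩
  have hm := h.le_card
  have hn := h.pos
  have hβ1 : β < 1 := by linarith [h.prob_le']
  have hdet := det_gramMatrix_pos (m := m) (by omega) h.prob_pos hβ1
  have hfour := bimagicCentralProb_eq_integral m β k hk
  have hsplit : ∫ θ in freqCube, (centredCharFun m β θ).re
      = (∫ θ in centralRegion m (1 / 12), (centredCharFun m β θ).re)
        + ∫ θ in freqCube \ centralRegion m (1 / 12), (centredCharFun m β θ).re := by
    have hi : IntegrableOn (fun θ => (centredCharFun m β θ).re) freqCube := by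
      refine ((Complex.continuous_re.comp
        (continuous_centredCharFun m β)).continuousOn.integrableOn_compact
        (isCompact_univ_pi fun _ => isCompact_Icc (a := -Real.pi) (b := Real.pi))).mono_set ?_
      exact Set.pi_mono fun _ _ => Set.Ioc_subset_Icc_self
    have hsub := centralRegion_subset_freqCube (m := m) (by omega)
    rw [← setIntegral_union Set.disjoint_sdiff_right
      (measurableSet_freqCube.diff (measurableSet_centralRegion _ _)) (hi.mono_set hsub)
      (hi.mono_set Set.sdiff_subset), Set.union_sdiff_cancel hsub]
  have h1 := hcen m β n h
  have h2 := htail m β n h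
  have hG : bimagicGaussProb m β = (gramMatrix m β).det / Q := by
    rw [bimagicGaussProb_eq (by omega) h.prob_pos hβ1, hQ, sqrt_two_pi_cube]
  set D := (gramMatrix m β).det
  have h3 : Real.exp (-(ε * n ^ 2)) ≤ D * (L / n ^ 4) := by
    have a := Real.pow_div_factorial_le_exp (ε * n ^ 2) (by positivity) 13
    have b : Real.exp (-(ε * n ^ 2)) ≤ 1 / n ^ 22 * (L / n ^ 4) := by
      -- the power `13` is chosen so that `(n ^ 2) ^ 13 = n ^ 22 * n ^ 4`
      rw [Real.exp_neg]
      calc (Real.exp (ε * n ^ 2))⁻¹ ≤ ((ε * n ^ 2) ^ 13 / (13 : ℕ).factorial)⁻¹ := by gcongr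
        _ = _ := by rw [hL]; field_simp
    refine b.trans ?_
    gcongr
    exact h.one_div_pow_le_det hmn
  have h4 : |P * bimagicCentralProb m β - D * (Q * (1 + -711 / 980 / n ^ 2))|
      ≤ D * ((K + P * L) / n ^ 4) := by
    rw [hfour, hsplit, add_sub_right_comm]
    refine (abs_add_le _ _).trans ((add_le_add h1 h2).trans ?_)
    have := mul_le_mul_of_nonneg_left h3 hP0.le
    calc _ ≤ D * (K / n ^ 4) + P * (D * (L / n ^ 4)) := by linarith
      _ = _ := by ring
  have e : bimagicCentralProb m β - bimagicGaussProb m β * (1 + -711 / 980 / n ^ 2)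
      = (P * bimagicCentralProb m β - D * (Q * (1 + -711 / 980 / n ^ 2))) / P := by
    rw [hG, hPQ]; field_simp
  rw [e, abs_div, abs_of_pos hP0, div_le_iff₀ hP0, hG]
  refine h4.trans ?_
  have : D * ((K + P * L) / n ^ 4) = (K + P * L) / Q * (D / Q / n ^ 4) * (Q * Q) := by field_simp
  rw [this, hPQ]

/-! ### The correction coefficient -/

theorem bimagicPropagator_eq : bimagicPropagator =
    !![9, -36, 60; -36, 192, -360; 60, -360, 720] := by
  unfold bimagicPropagator
  refine Matrix.inv_eq_right_inv ?_
  ext a b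
  fin_cases a <;> fin_cases b <;>
    simp [Matrix.mul_apply, Fin.sum_univ_three, bimagicVertex] <;> norm_num

/-- The rational number of which `bimagicVertex l` is the cast. -/
def vertexRat (l : List (Fin 3)) : ℚ := (1 / 2) ^ l.count 2 / (1 + l.count 1 + 2 * l.count 2)

/-- The entries of `bimagicPropagator` as rational numbers. -/
def propagatorRat : Matrix (Fin 3) (Fin 3) ℚ := !![9, -36, 60; -36, 192, -360; 60, -360, 720]

theorem bimagicVertex_eq_cast (l : List (Fin 3)) : bimagicVertex l = (vertexRat l : ℝ) := by
  simp [bimagicVertex, vertexRat]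

theorem bimagicPropagator_eq_cast (a b : Fin 3) :
    bimagicPropagator a b = (propagatorRat a b : ℝ) := by
  rw [bimagicPropagator_eq, propagatorRat]
  fin_cases a <;> fin_cases b <;> simp

theorem bimagicK₁_eq : bimagicK₁ = -711 / 980 := by
  have h : ((-1 / 8) * (∑ a, ∑ b, ∑ c, ∑ d, ∑ e, ∑ f, vertexRat [a, b, c] * vertexRat [d, e, f] *
        propagatorRat a b * propagatorRat c d * propagatorRat e f)
      - (1 / 12) * (∑ a, ∑ b, ∑ c, ∑ d, ∑ e, ∑ f, vertexRat [a, b, c] * vertexRat [d, e, f] *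
        propagatorRat a d * propagatorRat b e * propagatorRat c f)
      + (1 / 8) * (∑ a, ∑ b, ∑ c, ∑ d, vertexRat [a, b, c, d] * propagatorRat a b *
        propagatorRat c d) : ℚ) = -711 / 980 := by
    decide +kernel
  have := congrArg (Rat.cast : ℚ → ℝ) h
  push_cast at this
  simp only [bimagicK₁, bimagicVertex_eq_cast, bimagicPropagator_eq_cast]
  exact this

/-! ### Series as central events -/

theorem sum_Icc_bimagicVec (m : ℕ) (a : Fin 3) : ∑ i ∈ Finset.Icc 1 m, bimagicVec i a =
    ![(m : ℝ), m * (m + 1) / 2, m * ((m : ℝ) ^ 2 - 1) / 6] a := by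
  fin_cases a
  · simp [bimagicVec]
  · simpa [bimagicVec] using sum_Icc_id m
  · have := sum_Icc_quartic m 0 (-1 / 2) (1 / 2) 0 0
    refine (Finset.sum_congr rfl fun i _ => ?_).trans (this.trans ?_)
    · simp [bimagicVec]; ring
    · simp; ring

/-- The mean vector is integral in the cases of squares (`α = 2`) and of cubes (`α = 3`). -/
theorem exists_int_mean {α N : ℕ} (hα : α = 2 ∨ α = 3) (hN : 1 ≤ N) :
    ∃ k : Fin 3 → ℤ, ∀ a,
      1 / (N : ℝ) ^ (α - 1) * ∑ i ∈ Finset.Icc 1 (N ^ α), bimagicVec i a = k a := by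
  have hN0 : (N : ℝ) ≠ 0 := by positivity
  have d2 : ∃ c : ℤ, (N : ℤ) * ((N : ℤ) ^ α + 1) = 2 * c := by
    have h2 : ∀ x : ZMod 2, x * (x ^ 2 + 1) = 0 ∧ x * (x ^ 3 + 1) = 0 := by decide
    refine (ZMod.intCast_zmod_eq_zero_iff_dvd _ 2).1 ?_
    push_cast
    rcases hα with rfl | rfl
    · exact (h2 N).1
    · exact (h2 N).2
  have d6 : ∃ c : ℤ, (N : ℤ) * (((N : ℤ) ^ α) ^ 2 - 1) = 6 * c := by
    have h6 : ∀ x : ZMod 6, x * ((x ^ 2) ^ 2 - 1) = 0 ∧ x * ((x ^ 3) ^ 2 - 1) = 0 := by decide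
    refine (ZMod.intCast_zmod_eq_zero_iff_dvd _ 6).1 ?_
    push_cast
    rcases hα with rfl | rfl
    · exact (h6 N).1
    · exact (h6 N).2
  obtain ⟨c₁, h₁⟩ := d2
  obtain ⟨c₂, h₂⟩ := d6
  have h₁' : (N : ℝ) * ((N : ℝ) ^ α + 1) = 2 * c₁ := by exact_mod_cast h₁
  have h₂' : (N : ℝ) * (((N : ℝ) ^ α) ^ 2 - 1) = 6 * c₂ := by exact_mod_cast h₂
  have hpow : 1 / (N : ℝ) ^ (α - 1) * (N : ℝ) ^ α = N := by
    rcases hα with rfl | rfl <;> · norm_num; field_simp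
  refine ⟨![N, c₁, c₂], fun a => ?_⟩
  rw [sum_Icc_bimagicVec]
  push_cast
  fin_cases a
  · simpa using hpow
  · simp only [Fin.mk_one, Matrix.cons_val_one, Matrix.cons_val_zero]
    linear_combination (((N : ℝ) ^ α + 1) / 2) * hpow + h₁' / 2
  · simp only [Fin.reduceFinMk, Matrix.cons_val]
    linear_combination ((((N : ℝ) ^ α) ^ 2 - 1) / 6) * hpow + h₂' / 6

/-- The three coordinates of the central event: the cardinality, the sum, and (given the sum) the sum
of squares. -/
theorem sum_bimagicVec_eq_iff {α N : ℕ} (hα : α = 2 ∨ α = 3) (hN : 1 ≤ N) (s : Finset ℕ) :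
    ∑ i ∈ s, bimagicVec i =
        (1 / (N : ℝ) ^ (α - 1)) • ∑ i ∈ Finset.Icc 1 (N ^ α), bimagicVec i ↔
      s.card = N ∧
      ∑ i ∈ s, (i : ℚ) = (∑ i ∈ Finset.Icc 1 (N ^ α), (i : ℚ)) / (N : ℚ) ^ (α - 1) ∧
      ∑ i ∈ s, (i : ℚ) ^ 2 = (∑ i ∈ Finset.Icc 1 (N ^ α), (i : ℚ) ^ 2) / (N : ℚ) ^ (α - 1) := by
  have hN0 : (N : ℝ) ≠ 0 := by positivity
  have hpow : 1 / (N : ℝ) ^ (α - 1) * (N : ℝ) ^ α = N := by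
    rcases hα with rfl | rfl <;> · norm_num; field_simp
  have c1 : (∑ i ∈ s, (i : ℚ) = (∑ i ∈ Finset.Icc 1 (N ^ α), (i : ℚ)) / (N : ℚ) ^ (α - 1)) ↔
      ∑ i ∈ s, (i : ℝ) = (∑ i ∈ Finset.Icc 1 (N ^ α), (i : ℝ)) / (N : ℝ) ^ (α - 1) := by
    rw [← Rat.cast_inj (α := ℝ)]; push_cast; rfl
  have c2 : (∑ i ∈ s, (i : ℚ) ^ 2 = (∑ i ∈ Finset.Icc 1 (N ^ α), (i : ℚ) ^ 2) / (N : ℚ) ^ (α - 1)) ↔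
      ∑ i ∈ s, (i : ℝ) ^ 2 = (∑ i ∈ Finset.Icc 1 (N ^ α), (i : ℝ) ^ 2) / (N : ℝ) ^ (α - 1) := by
    rw [← Rat.cast_inj (α := ℝ)]; push_cast; rfl
  have v2 : ∀ t : Finset ℕ, ∑ i ∈ t, (i : ℝ) * ((i : ℝ) - 1) / 2
      = (∑ i ∈ t, (i : ℝ) ^ 2 - ∑ i ∈ t, (i : ℝ)) / 2 := by
    intro t
    rw [← Finset.sum_sub_distrib, Finset.sum_div]
    exact Finset.sum_congr rfl fun i _ => by ring
  rw [c1, c2, funext_iff, Fin.forall_fin_succ, Fin.forall_fin_succ, Fin.forall_fin_succ]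
  simp only [Finset.sum_apply, Pi.smul_apply, smul_eq_mul, bimagicVec, Fin.isValue,
    Matrix.cons_val_zero, Fin.succ_zero_eq_one, Matrix.cons_val_one, Fin.succ_one_eq_two,
    Matrix.cons_val, v2, Finset.sum_const, nsmul_eq_mul, mul_one, Nat.card_Icc,
    Nat.add_sub_cancel, IsEmpty.forall_iff, and_true]
  push_cast
  rw [hpow]
  refine and_congr (by exact_mod_cast Iff.rfl) ?_
  set A := ∑ i ∈ s, (i : ℝ)
  set B := ∑ i ∈ s, (i : ℝ) ^ 2
  constructor
  · rintro ⟨h1, h2⟩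
    exact ⟨by linear_combination h1, by linear_combination h1 + 2 * h2⟩
  · rintro ⟨h1, h2⟩
    exact ⟨by linear_combination h1, by linear_combination (h2 - h1) / 2⟩

theorem bimagicCentralProb_eq_card {α N : ℕ} (hα : α = 2 ∨ α = 3) (hN : 1 ≤ N) :
    bimagicCentralProb (N ^ α) (1 / (N : ℝ) ^ (α - 1)) = (bimagicSeries α N).card *
      ((1 / (N : ℝ) ^ (α - 1)) ^ N * (1 - 1 / (N : ℝ) ^ (α - 1)) ^ (N ^ α - N)) := by
  classical
  have hset : ((Finset.Icc 1 (N ^ α)).powerset.filter fun s => ∑ i ∈ s, bimagicVec i =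
      (1 / (N : ℝ) ^ (α - 1)) • ∑ i ∈ Finset.Icc 1 (N ^ α), bimagicVec i) = bimagicSeries α N := by
    ext s
    rw [Finset.mem_filter, sum_bimagicVec_eq_iff hα hN, bimagicSeries, Finset.mem_filter,
      Finset.mem_powersetCard, Finset.mem_powerset]
    tauto
  rw [bimagicCentralProb]
  have : ∀ s ∈ bimagicSeries α N, (1 / (N : ℝ) ^ (α - 1)) ^ s.card *
      (1 - 1 / (N : ℝ) ^ (α - 1)) ^ (N ^ α - s.card) =
      (1 / (N : ℝ) ^ (α - 1)) ^ N * (1 - 1 / (N : ℝ) ^ (α - 1)) ^ (N ^ α - N) := by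
    intro s hs
    rw [bimagicSeries, Finset.mem_filter, Finset.mem_powersetCard] at hs
    rw [hs.1.2]
  rw [← nsmul_eq_mul, ← Finset.sum_const, ← Finset.sum_congr rfl this, ← hset]

/-! ### Asymptotics of the number of series -/

/-- The logarithm of the factor by which the Gaussian approximation of the number of series exceeds
its Stirling-type leading term. -/
noncomputable def countExponent (α N : ℕ) : ℝ :=
  -(((N : ℝ) ^ α - N + 3 / 2) * Real.log (1 - 1 / (N : ℝ) ^ (α - 1)))
    - Real.log (1 - 1 / ((N : ℝ) ^ α) ^ 2) - Real.log (1 - 4 / ((N : ℝ) ^ α) ^ 2) / 2 - N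

/-- The Gaussian approximation divided by the weight of a single series.  Both sides are positive,
and their squares involve no half-integral powers. -/
theorem gaussProb_div_weight_eq {α N : ℕ} (hα : α = 2 ∨ α = 3) (hN : 2 ≤ N) :
    bimagicGaussProb (N ^ α) (1 / (N : ℝ) ^ (α - 1)) /
      ((1 / (N : ℝ) ^ (α - 1)) ^ N * (1 - 1 / (N : ℝ) ^ (α - 1)) ^ (N ^ α - N)) =
    6 * √30 / Real.pi ^ (3 / 2 : ℝ) * (((N : ℝ) ^ (α - 1) * Real.exp 1) ^ N /
      (N : ℝ) ^ (3 * α + 3 / 2 : ℝ)) * Real.exp (countExponent α N) := by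
  have hNR : (2 : ℝ) ≤ N := by exact_mod_cast hN
  have hN0 : (0 : ℝ) < N := by linarith
  set b : ℝ := (N : ℝ) ^ (α - 1) with hb
  set M : ℝ := (N : ℝ) ^ α with hM
  set q : ℝ := 1 - 1 / b with hq
  have hMb : M = N * b := by
    rcases hα with rfl | rfl <;> · simp only [hM, hb]; ring
  have hb1 : 2 ≤ b := by
    rcases hα with rfl | rfl
    · simpa [hb] using hNR
    · simp only [hb]; norm_num; nlinarith
  have hb0 : 0 < b := by linarith
  have hq0 : 0 < q := by
    rw [hq, sub_pos, div_lt_one hb0]; linarith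
  have hM4 : 4 ≤ M := by rw [hMb]; nlinarith
  have hM0 : 0 < M := by linarith
  have hx1 : 0 < 1 - 1 / M ^ 2 := by
    rw [sub_pos, div_lt_one (by positivity)]; nlinarith
  have hx4 : 0 < 1 - 4 / M ^ 2 := by
    rw [sub_pos, div_lt_one (by positivity)]; nlinarith
  have hle : N ≤ N ^ α := Nat.le_self_pow (by rcases hα with rfl | rfl <;> norm_num) N
  set k := N ^ α - N with hk
  have hkR : (k : ℝ) = M - N := by rw [hk, Nat.cast_sub hle, hM]; push_cast; rfl
  have hdet : (bimagicCov (N ^ α) (1 / b)).det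
      = (q * N) ^ 3 * ((M ^ 2 - 1) ^ 2 * (M ^ 2 - 4)) / 8640 := by
    rw [det_bimagicCov]
    push_cast
    rw [← hM, ← hq, hMb]
    field_simp
  have e1 : 1 - 1 / M ^ 2 = (M ^ 2 - 1) / M ^ 2 := by field_simp
  have e4 : 1 - 4 / M ^ 2 = (M ^ 2 - 4) / M ^ 2 := by field_simp
  have h1 : 0 < M ^ 2 - 1 := by nlinarith
  have h4 : 0 < M ^ 2 - 4 := by nlinarith
  have hexp : Real.exp (countExponent α N) ^ 2 = (q ^ (2 * k + 3))⁻¹ * ((1 - 1 / M ^ 2) ^ 2)⁻¹ *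
      (1 - 4 / M ^ 2)⁻¹ * (Real.exp 1 ^ (2 * N))⁻¹ := by
    rw [← Real.exp_log hq0, ← Real.exp_log hx1, ← Real.exp_log hx4, ← Real.exp_nat_mul,
      ← Real.exp_nat_mul, ← Real.exp_nat_mul, ← Real.exp_nat_mul, ← Real.exp_neg, ← Real.exp_neg,
      ← Real.exp_neg, ← Real.exp_neg, ← Real.exp_add, ← Real.exp_add, ← Real.exp_add]
    congr 1
    rw [countExponent, ← hM, ← hb, ← hq]
    push_cast
    rw [hkR]
    ring
  have hrp : ∀ x : ℝ, 0 < x → (x ^ (3 / 2 : ℝ)) ^ 2 = x ^ 3 := by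
    intro x hx
    rw [← Real.rpow_natCast, ← Real.rpow_mul hx.le, ← Real.rpow_natCast]; norm_num
  have hNp : ((N : ℝ) ^ (3 * α + 3 / 2 : ℝ)) ^ 2 = M ^ 6 * (N : ℝ) ^ 3 := by
    rw [Real.rpow_add hN0, mul_pow, hrp _ hN0, hM, ← pow_mul, show (3 * α : ℝ) = ((3 * α : ℕ) : ℝ) by
      push_cast; rfl, Real.rpow_natCast, ← pow_mul]
    congr 2; ring
  have hq3 : 0 < q * N := by positivity
  have hdet0 : 0 < (bimagicCov (N ^ α) (1 / b)).det := by rw [hdet]; positivity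
  refine (sq_eq_sq₀ ?_ ?_).1 ?_
  · rw [bimagicGaussProb]; positivity
  · positivity
  · have hbN : (1 / b) ^ N = (b ^ N)⁻¹ := by rw [one_div, inv_pow]
    rw [hbN, bimagicGaussProb, mul_pow _ (Real.exp _), hexp, mul_pow _ (_ / _), div_pow _ _ 2, div_pow _ _ 2, div_pow _ _ 2,
      div_pow _ _ 2, mul_pow _ √_, Real.sq_sqrt hdet0.le, hrp _ (by positivity),
      hrp _ Real.pi_pos, hNp, mul_pow _ √30, Real.sq_sqrt (by norm_num), hdet, e1, e4]
    field_simp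
    ring

theorem isBigO_exp_sub {h : ℕ → ℝ} {c : ℝ}
    (hh : (fun N : ℕ => h N - c / N) =O[atTop] fun N : ℕ => 1 / (N : ℝ) ^ 2) :
    (fun N : ℕ => Real.exp (h N) - (1 + c / N)) =O[atTop] fun N : ℕ => 1 / (N : ℝ) ^ 2 := by
  obtain ⟨C, hC0, hC⟩ := hh.exists_pos
  rw [isBigOWith_iff] at hC
  set B := C + |c| with hB
  have hB0 : 0 ≤ B := by positivity
  refine IsBigO.of_bound (C + B ^ 2 * Real.exp B) ?_
  filter_upwards [hC, eventually_ge_atTop 1] with N hN hN1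
  have hNR : (1 : ℝ) ≤ N := by exact_mod_cast hN1
  have hN0 : (0 : ℝ) < N := by linarith
  rw [Real.norm_eq_abs, Real.norm_of_nonneg (by positivity)] at hN ⊢
  have h1 : |h N| ≤ B / N := by
    have a : |h N| ≤ |h N - c / N| + |c / N| := by simpa using abs_add_le (h N - c / N) (c / N)
    have b : 1 / (N : ℝ) ^ 2 ≤ 1 / N := by gcongr; nlinarith
    rw [abs_div, abs_of_pos hN0] at a
    have : C * (1 / (N : ℝ) ^ 2) ≤ C * (1 / N) := by gcongr
    calc |h N| ≤ C * (1 / N) + |c| / N := by linarith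
      _ = B / N := by rw [hB]; ring
  have h2 : |h N| ≤ B := h1.trans (div_le_self hB0 hNR)
  have h3 := abs_exp_sub_one_sub_le (h N)
  have h4 : h N ^ 2 * Real.exp |h N| ≤ (B / N) ^ 2 * Real.exp B := by
    rw [← sq_abs (h N)]; gcongr
  have e : Real.exp (h N) - (1 + c / N) = (Real.exp (h N) - 1 - h N) + (h N - c / N) := by ring
  rw [e]
  refine (abs_add_le _ _).trans ?_
  calc _ ≤ (B / N) ^ 2 * Real.exp B + C * (1 / (N : ℝ) ^ 2) := by linarith
    _ = _ := by ring

theorem abs_log_one_sub_le {x : ℝ} (h0 : 0 ≤ x) (hx : x ≤ 1 / 2) : |Real.log (1 - x)| ≤ 2 * x := by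
  have := Real.abs_log_sub_add_sum_range_le (x := x) (by rw [abs_of_nonneg h0]; linarith) 0
  simp only [Finset.range_zero, Finset.sum_empty, zero_add, pow_one, abs_of_nonneg h0] at this
  refine this.trans ?_
  rw [div_le_iff₀ (by linarith)]
  nlinarith

/-- The two logarithms coming from the determinant of the covariance matrix are negligible. -/
theorem abs_log_add_log_le {α N : ℕ} (hα : 2 ≤ α) (hN : 2 ≤ N) :
    |Real.log (1 - 1 / ((N : ℝ) ^ α) ^ 2) + Real.log (1 - 4 / ((N : ℝ) ^ α) ^ 2) / 2|
      ≤ 6 / (N : ℝ) ^ 2 := by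
  have hNR : (2 : ℝ) ≤ N := by exact_mod_cast hN
  have h1 : (4 : ℝ) ≤ (N : ℝ) ^ 2 := by nlinarith
  have h2 : (N : ℝ) ^ 2 * 4 ≤ ((N : ℝ) ^ α) ^ 2 := by
    have : (N : ℝ) ^ 2 ≤ (N : ℝ) ^ α := pow_le_pow_right₀ (by linarith) hα
    nlinarith
  have h3 : 1 / ((N : ℝ) ^ α) ^ 2 ≤ 1 / ((N : ℝ) ^ 2 * 4) := by gcongr
  have h4 : 1 / ((N : ℝ) ^ 2 * 4) ≤ 1 / 16 := by gcongr; linarith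
  have e : 4 / ((N : ℝ) ^ α) ^ 2 = 4 * (1 / ((N : ℝ) ^ α) ^ 2) := by ring
  have e2 : 1 / ((N : ℝ) ^ 2 * 4) = (1 / (N : ℝ) ^ 2) / 4 := by field_simp
  have h0 : 0 ≤ 1 / ((N : ℝ) ^ α) ^ 2 := by positivity
  have a := abs_log_one_sub_le h0 (by linarith)
  have b := abs_log_one_sub_le (x := 4 / ((N : ℝ) ^ α) ^ 2) (by positivity) (by rw [e]; linarith)
  refine (abs_add_le _ _).trans ?_
  rw [abs_div, abs_two]
  rw [e] at b ⊢
  have : 6 / (N : ℝ) ^ 2 = 6 * (1 / (N : ℝ) ^ 2) := by ring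
  rw [this]
  have : 0 ≤ 1 / (N : ℝ) ^ 2 := by positivity
  linarith

theorem isBigO_countExponent_two :
    (fun N : ℕ => (countExponent 2 N + 1 / 2) - (4 / 3) / N) =O[atTop]
      fun N : ℕ => 1 / (N : ℝ) ^ 2 := by
  refine IsBigO.of_bound 20 ?_
  filter_upwards [eventually_ge_atTop 2] with N hN
  have hNR : (2 : ℝ) ≤ N := by exact_mod_cast hN
  have hN0 : (0 : ℝ) < N := by linarith
  rw [Real.norm_eq_abs, Real.norm_of_nonneg (by positivity)]
  have hl := abs_log_add_log_le le_rfl hN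
  set x : ℝ := 1 / N with hx
  have hx0 : 0 < x := by positivity
  have hx2 : x ≤ 1 / 2 := by rw [hx]; gcongr
  have hNx : (N : ℝ) * x = 1 := by rw [hx]; field_simp
  have h3 := Real.abs_log_sub_add_sum_range_le (x := x) (by rw [abs_of_pos hx0]; linarith) 3
  simp only [Finset.sum_range_succ, Finset.sum_range_zero, abs_of_pos hx0] at h3
  norm_num at h3
  have h3' : |x + x ^ 2 / 2 + x ^ 3 / 3 + Real.log (1 - x)| ≤ 2 * x ^ 4 := by
    have : x ^ 4 / (1 - x) ≤ 2 * x ^ 4 := by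
      rw [div_le_iff₀ (by linarith)]
      nlinarith [pow_pos hx0 4]
    exact h3.trans this
  set l := Real.log (1 - x) with hldef
  have hc : countExponent 2 N = -(((N : ℝ) ^ 2 - N + 3 / 2) * l)
      - (Real.log (1 - 1 / ((N : ℝ) ^ 2) ^ 2) + Real.log (1 - 4 / ((N : ℝ) ^ 2) ^ 2) / 2) - N := by
    rw [countExponent, hldef, hx]; norm_num; ring
  set t := Real.log (1 - 1 / ((N : ℝ) ^ 2) ^ 2) + Real.log (1 - 4 / ((N : ℝ) ^ 2) ^ 2) / 2
  set r := x + x ^ 2 / 2 + x ^ 3 / 3 + l with hr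
  have hNi : (N : ℝ) = x⁻¹ := by rw [hx, one_div, inv_inv]
  have e : (countExponent 2 N + 1 / 2) - (4 / 3) / N
      = -(((N : ℝ) ^ 2 - N + 3 / 2) * r) - t + (5 / 12 * x ^ 2 + x ^ 3 / 2) := by
    rw [hc, hr, hNi]
    field_simp
    ring
  have hxx : 1 / (N : ℝ) ^ 2 = x ^ 2 := by rw [hx]; ring
  have hxx' : 6 / (N : ℝ) ^ 2 = 6 * x ^ 2 := by rw [hx]; ring
  have hb : |((N : ℝ) ^ 2 - N + 3 / 2) * r| ≤ 2 * x ^ 2 := by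
    rw [abs_mul, abs_of_nonneg (by nlinarith : (0 : ℝ) ≤ (N : ℝ) ^ 2 - N + 3 / 2)]
    calc _ ≤ (N : ℝ) ^ 2 * (2 * x ^ 4) := by gcongr; linarith
      _ = 2 * x ^ 2 := by rw [hNi]; field_simp
  rw [e, hxx]
  rw [hxx'] at hl
  have hx3 : x ^ 3 ≤ x ^ 2 := pow_le_pow_of_le_one hx0.le (by linarith) (by norm_num)
  have hx30 : 0 < x ^ 3 := by positivity
  rw [abs_le] at *
  constructor <;> linarith [hb.1, hb.2, hl.1, hl.2]

theorem isBigO_countExponent_three :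
    (fun N : ℕ => countExponent 3 N - (-1 / 2) / N) =O[atTop] fun N : ℕ => 1 / (N : ℝ) ^ 2 := by
  refine IsBigO.of_bound 20 ?_
  filter_upwards [eventually_ge_atTop 2] with N hN
  have hNR : (2 : ℝ) ≤ N := by exact_mod_cast hN
  have hN0 : (0 : ℝ) < N := by linarith
  rw [Real.norm_eq_abs, Real.norm_of_nonneg (by positivity)]
  have hl := abs_log_add_log_le (α := 3) (by norm_num) hN
  set x : ℝ := 1 / N with hx
  have hx0 : 0 < x := by positivity
  have hx2 : x ≤ 1 / 2 := by rw [hx]; gcongr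
  have hxsq : x ^ 2 ≤ 1 / 2 := by nlinarith
  have hxsq0 : 0 < x ^ 2 := by positivity
  have h3 := Real.abs_log_sub_add_sum_range_le (x := x ^ 2) (by rw [abs_of_pos hxsq0]; linarith) 2
  simp only [Finset.sum_range_succ, Finset.sum_range_zero, abs_of_pos hxsq0] at h3
  norm_num at h3
  have h3' : |x ^ 2 + (x ^ 2) ^ 2 / 2 + Real.log (1 - x ^ 2)| ≤ 2 * x ^ 6 := by
    refine h3.trans ?_
    rw [div_le_iff₀ (by linarith)]
    nlinarith [pow_pos hx0 6]
  set l := Real.log (1 - x ^ 2) with hldef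
  have hc : countExponent 3 N = -(((N : ℝ) ^ 3 - N + 3 / 2) * l)
      - (Real.log (1 - 1 / ((N : ℝ) ^ 3) ^ 2) + Real.log (1 - 4 / ((N : ℝ) ^ 3) ^ 2) / 2) - N := by
    rw [countExponent, hldef, hx]; norm_num; ring
  set t := Real.log (1 - 1 / ((N : ℝ) ^ 3) ^ 2) + Real.log (1 - 4 / ((N : ℝ) ^ 3) ^ 2) / 2
  set r := x ^ 2 + (x ^ 2) ^ 2 / 2 + l with hr
  have hNi : (N : ℝ) = x⁻¹ := by rw [hx, one_div, inv_inv]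
  have e : countExponent 3 N - (-1 / 2) / N = -(((N : ℝ) ^ 3 - N + 3 / 2) * r) - t
      + (3 / 2 * x ^ 2 - x ^ 3 / 2 + 3 / 4 * x ^ 4) := by
    rw [hc, hr, hNi]
    field_simp
    ring
  have hxx : 1 / (N : ℝ) ^ 2 = x ^ 2 := by rw [hx]; ring
  have hxx' : 6 / (N : ℝ) ^ 2 = 6 * x ^ 2 := by rw [hx]; ring
  have hb : |((N : ℝ) ^ 3 - N + 3 / 2) * r| ≤ 2 * x ^ 3 := by
    rw [abs_mul, abs_of_nonneg (by nlinarith [mul_self_nonneg (N : ℝ)] :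
      (0 : ℝ) ≤ (N : ℝ) ^ 3 - N + 3 / 2)]
    calc _ ≤ (N : ℝ) ^ 3 * (2 * x ^ 6) := by gcongr; linarith
      _ = 2 * x ^ 3 := by rw [hNi]; field_simp
  rw [e, hxx]
  rw [hxx'] at hl
  have hx3 : x ^ 3 ≤ x ^ 2 := pow_le_pow_of_le_one hx0.le (by linarith) (by norm_num)
  have hx4 : x ^ 4 ≤ x ^ 2 := pow_le_pow_of_le_one hx0.le (by linarith) (by norm_num)
  have hx30 : 0 < x ^ 3 := by positivity
  have hx40 : 0 < x ^ 4 := by positivity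
  rw [abs_le] at *
  constructor <;> linarith [hb.1, hb.2, hl.1, hl.2]

theorem isBigO_bimagicCentralProb {α : ℕ} (hα : α = 2 ∨ α = 3) :
    (fun N : ℕ => bimagicCentralProb (N ^ α) (1 / (N : ℝ) ^ (α - 1))
        - bimagicGaussProb (N ^ α) (1 / (N : ℝ) ^ (α - 1)) * (1 + bimagicK₁ / N))
      =O[atTop] fun N : ℕ =>
        bimagicGaussProb (N ^ α) (1 / (N : ℝ) ^ (α - 1)) / (N : ℝ) ^ 2 := by
  obtain ⟨C, hC, hmain⟩ := exists_abs_bimagicCentralProb_sub_le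
  refine IsBigO.of_bound C ?_
  filter_upwards [eventually_ge_atTop 64] with N hN
  have hNR : (64 : ℝ) ≤ N := by exact_mod_cast hN
  have hN0 : (0 : ℝ) < N := by linarith
  have hs : √(N : ℝ) ^ 2 = N := Real.sq_sqrt hN0.le
  have hs4 : √(N : ℝ) ^ 4 = (N : ℝ) ^ 2 := by rw [pow_mul √(N : ℝ) 2 2, hs]
  have hs6 : √(N : ℝ) ^ 6 = (N : ℝ) ^ 3 := by rw [pow_mul √(N : ℝ) 2 3, hs]
  have hreg : SparseRegime (N ^ α) (1 / (N : ℝ) ^ (α - 1)) √(N : ℝ) := by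
    refine ⟨Real.le_sqrt_of_sq_le (by linarith), ?_, by positivity, ?_⟩
    · rw [hs]; push_cast
      rcases hα with rfl | rfl <;> · norm_num; field_simp
    · rw [hs]
      gcongr
      exact le_self_pow₀ (by linarith) (by rcases hα with rfl | rfl <;> norm_num)
  have h := hmain _ _ _ hreg (by
    rw [hs6]; push_cast
    exact pow_le_pow_right₀ (by linarith) (by rcases hα with rfl | rfl <;> norm_num))
    (exists_int_mean hα (by omega))
  rw [hs, hs4] at h
  rw [bimagicK₁_eq, Real.norm_eq_abs, Real.norm_of_nonneg]
  · exact h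
  · rw [bimagicGaussProb]; positivity

/-- Transfer from the central probability to the number of series: `A` is the leading term, and `X`
with its own correction `c / N` accounts for the difference between `A` and the Gaussian
approximation. -/
theorem isBigO_card_sub {α : ℕ} (hα : α = 2 ∨ α = 3) {A X : ℕ → ℝ} {c κ : ℝ}
    (hA : ∀ N ≥ 2, bimagicGaussProb (N ^ α) (1 / (N : ℝ) ^ (α - 1)) /
      ((1 / (N : ℝ) ^ (α - 1)) ^ N * (1 - 1 / (N : ℝ) ^ (α - 1)) ^ (N ^ α - N)) = A N * X N)
    (hX : (fun N : ℕ => X N - (1 + c / N)) =O[atTop] fun N : ℕ => 1 / (N : ℝ) ^ 2)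
    (hκ : κ = c + bimagicK₁) :
    (fun N : ℕ => ((bimagicSeries α N).card : ℝ) - A N * (1 + κ / N)) =O[atTop]
      fun N : ℕ => A N / (N : ℝ) ^ 2 := by
  have hinv : (fun N : ℕ => 1 / (N : ℝ)) =O[atTop] fun _ => (1 : ℝ) := by
    refine IsBigO.of_bound 1 ?_
    filter_upwards [eventually_ge_atTop 1] with N hN
    have : (1 : ℝ) ≤ N := by exact_mod_cast hN
    rw [Real.norm_of_nonneg (by positivity), norm_one, mul_one, div_le_one (by linarith)]
    exact this
  have hinv2 : (fun N : ℕ => 1 / (N : ℝ) ^ 2) =O[atTop] fun _ => (1 : ℝ) := by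
    simpa [sq] using hinv.mul hinv
  have hone : ∀ k : ℝ, (fun N : ℕ => 1 + k / (N : ℝ)) =O[atTop] fun _ => (1 : ℝ) := by
    intro k
    refine (isBigO_refl _ _).add ?_
    simpa [div_eq_mul_inv] using hinv.const_mul_left k
  have hX1 : X =O[atTop] fun _ => (1 : ℝ) := by
    simpa using (hX.trans hinv2).add (hone c)
  -- the series are counted by the central probability divided by the weight of a single series
  set W : ℕ → ℝ := fun N => (1 / (N : ℝ) ^ (α - 1)) ^ N *
    (1 - 1 / (N : ℝ) ^ (α - 1)) ^ (N ^ α - N) with hW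
  have hW0 : ∀ N : ℕ, 2 ≤ N → W N ≠ 0 := by
    intro N hN
    have hNR : (2 : ℝ) ≤ N := by exact_mod_cast hN
    have hb : 1 < (N : ℝ) ^ (α - 1) :=
      one_lt_pow₀ (by linarith) (by rcases hα with rfl | rfl <;> norm_num)
    have : 0 < 1 - 1 / (N : ℝ) ^ (α - 1) := by
      rw [sub_pos, div_lt_one (by linarith)]; exact hb
    simp only [hW]
    positivity
  have hP := (isBigO_refl (fun N => (W N)⁻¹) atTop).mul (isBigO_bimagicCentralProb hα)
  have h1 : (fun N : ℕ => ((bimagicSeries α N).card : ℝ) - A N * X N * (1 + bimagicK₁ / N))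
      =O[atTop] fun N : ℕ => A N / (N : ℝ) ^ 2 := by
    refine (hP.congr' (g₂ := fun N : ℕ => A N / (N : ℝ) ^ 2 * X N) ?_ ?_).trans ?_
    · filter_upwards [eventually_ge_atTop 2] with N hN
      have := hW0 N hN
      rw [← hA N hN, bimagicCentralProb_eq_card hα (by omega)]
      change (W N)⁻¹ * (_ * W N - _) = _ - _ / W N * _
      field_simp
    · filter_upwards [eventually_ge_atTop 2] with N hN
      have := hA N hN
      change _ / W N = _ at this
      rw [div_mul_eq_mul_div, ← this]
      ring
    · simpa using (isBigO_refl (fun N : ℕ => A N / (N : ℝ) ^ 2) atTop).mul hX1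
  have h2 : (fun N : ℕ => A N * X N * (1 + bimagicK₁ / N) - A N * (1 + κ / N))
      =O[atTop] fun N : ℕ => A N / (N : ℝ) ^ 2 := by
    have h3 : (fun N : ℕ => (X N - (1 + c / N)) * (1 + bimagicK₁ / N)
        + c * bimagicK₁ * (1 / (N : ℝ) ^ 2)) =O[atTop] fun N : ℕ => 1 / (N : ℝ) ^ 2 := by
      refine IsBigO.add ?_ ((isBigO_refl _ _).const_mul_left _)
      simpa using hX.mul (hone bimagicK₁)
    refine ((isBigO_refl A atTop).mul h3).congr ?_ ?_
    · intro N; rw [hκ]; ring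
    · intro N; ring
  refine (h1.add h2).congr_left fun N => ?_
  ring

theorem mainTheorem5 :
    bimagicK₁ = -711 / 980 ∧
    (fun N : ℕ => bimagicCentralProb (N ^ 2) (1 / N)
        - bimagicGaussProb (N ^ 2) (1 / N) * (1 + bimagicK₁ / N))
      =O[atTop] (fun N : ℕ => bimagicGaussProb (N ^ 2) (1 / N) / (N : ℝ) ^ 2) ∧
    (fun N : ℕ => bimagicCentralProb (N ^ 3) (1 / (N : ℝ) ^ 2)
        - bimagicGaussProb (N ^ 3) (1 / (N : ℝ) ^ 2) * (1 + bimagicK₁ / N))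
      =O[atTop] (fun N : ℕ => bimagicGaussProb (N ^ 3) (1 / (N : ℝ) ^ 2) / (N : ℝ) ^ 2) ∧
    (fun N : ℕ => ((bimagicSeries 2 N).card : ℝ)
        - bimagicSquareMain N * (1 + 1787 / (2940 * (N : ℝ))))
      =O[atTop] (fun N : ℕ => bimagicSquareMain N / (N : ℝ) ^ 2) ∧
    (fun N : ℕ => ((bimagicSeries 3 N).card : ℝ)
        - bimagicCubeMain N * (1 - 1201 / (980 * (N : ℝ))))
      =O[atTop] (fun N : ℕ => bimagicCubeMain N / (N : ℝ) ^ 2) := by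
  refine ⟨bimagicK₁_eq, ?_, ?_, ?_, ?_⟩
  · simpa using isBigO_bimagicCentralProb (α := 2) (Or.inl rfl)
  · simpa using isBigO_bimagicCentralProb (α := 3) (Or.inr rfl)
  · have := isBigO_card_sub (α := 2) (A := bimagicSquareMain)
      (X := fun N => Real.exp (countExponent 2 N + 1 / 2)) (κ := 1787 / 2940) (Or.inl rfl)
      (fun N hN => by
        rw [gaussProb_div_weight_eq (Or.inl rfl) hN, bimagicSquareMain,
          Real.sqrt_div (by norm_num), ← Real.exp_half, Real.exp_add]
        norm_num
        field_simp)
      (isBigO_exp_sub isBigO_countExponent_two) (by rw [bimagicK₁_eq]; norm_num)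
    refine this.congr_left fun N => ?_
    rw [← div_div]
  · have := isBigO_card_sub (α := 3) (A := bimagicCubeMain)
      (X := fun N => Real.exp (countExponent 3 N)) (κ := -1201 / 980) (Or.inr rfl)
      (fun N hN => by
        rw [gaussProb_div_weight_eq (Or.inr rfl) hN, bimagicCubeMain]
        norm_num)
      (isBigO_exp_sub isBigO_countExponent_three) (by rw [bimagicK₁_eq]; norm_num)
    refine this.congr_left fun N => ?_
    rw [← div_div]
    ring
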